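/- **Setting.** Identify $SU(2)$ with the unit quaternions. Let $F$ be a closed connected smooth surface (in particular any closed connected oriented one; orientability is not needed), $I=[0,1]$, and let $C\colon S^1\to F$ be a smooth embedding (an oriented embedded curve). Let $N\colon S^1\times\mathbb C\to F\times(0,1)$ be a diffeomorphism onto an open subset with $N(z,0)=(C(z),\tfrac12)$; the solid torus $N_C=N(S^1\times D^2)$, with $D^2$ the closed unit disc, is a tubular neighborhood of $C\times\{\tfrac12\}$. (Every smooth embedding of $S^1\times D^2$ in $F\times(0,1)$ extends to such an $N$.) Assume that it is framed so that its longitude is represented by a push off of $C$: for some $\epsilon>0$ with $C\times[\tfrac12,\tfrac12+\epsilon]\subset N_C$, the maps $z\mapsto N(z,1)$ and $z\mapsto (C(z),\tfrac12+\epsilon)$ are homotopic in $N_C\setminus (C\times\{\tfrac12\})$. Let $k\in\{0,1,2,\dots,\infty\}$ and let $f\colon\mathbb R\to\mathbb R$ be a $C^k$, odd, $2\pi$-periodic function. It defines $\mathbf F\colon SU(2)\to SU(2)$ by $\mathbf F(e^{\alpha Q})=e^{f(\alpha)Q}$ for $\alpha\in\mathbb R$ and $Q$ a purely imaginary unit quaternion.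 Put $\pi_C=(N_C,f)$, let $X$ be the complement in $F\times I$ of $N(S^1\times\operatorname{int}D^2)$, and let $\lambda=N(S^1\times\{1\})$ and $\mu=N(\{1\}\times\partial D^2)$, joined to the base point of $X$ by a common path from $N(1,1)$. Define $$\mathcal M(F)=\operatorname{Hom}(\pi_1(F),SU(2))/\mathrm{conj},\qquad \mathcal M_{\pi_C}(F\times I)=\{\rho\in\operatorname{Hom}(\pi_1(X),SU(2)) : \rho(\mu)=\mathbf F(\rho(\lambda))\}/\mathrm{conj}.$$ The spaces of representations carry the topology of pointwise convergence, and the quotients carry the quotient topology. The orbit type stratum of a subgroup $H\le SU(2)$ is the set of classes of representations whose stabilizer under conjugation is conjugate to $H$; the strata that can be non-empty are those of the center $\{\pm1\}\cong\mathbb Z/2$, of a maximal torus $U(1)$ and of $SU(2)$. A real function on a stratum is called $C^k$ if its lift to the representations over the stratum is locally the restriction of a $C^k$ function of the values $\rho(s_1),\dots,\rho(s_m)$ at finitely many group elements. **Proposition 7.1.** For $t=0$ and for $t=1$, and for all choices of base points of $F$ and $X$ and of a path in $X$ between them, the restriction map $$\mathcal M_{\pi_C}(F\times I)\to\mathcal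 M(F\times\{t\})=\mathcal M(F)$$ is a homeomorphism. It preserves the orbit type stratification: for every subgroup $H\le SU(2)$ it maps the stratum of $H$ bijectively onto the stratum of $H$. On each stratum it is a $C^k$-diffeomorphism, that is, a function on the stratum of $\mathcal M(F)$ is $C^k$ if and only if its composite with the restriction map is $C^k$ on the corresponding stratum of $\mathcal M_{\pi_C}(F\times I)$. -/

import Mathlib

open scoped Quaternion Manifold ContDiff

noncomputable section

/-- `SU(2)`, identified with the topological group of unit quaternions. -/
abbrev SU2 : Type := Metric.sphere (0 : ℍ[ℝ]) 1

/-- `Hom(G, SU(2))` for a discrete group `G`. -/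
def RepSpace (G : Type*) [Group G] : Type _ := G →* SU2

namespace RepSpace

variable {G : Type*} [Group G]

instance : FunLike (RepSpace G) G SU2 := inferInstanceAs (FunLike (G →* SU2) G SU2)

instance : MonoidHomClass (RepSpace G) G SU2 := inferInstanceAs (MonoidHomClass (G →* SU2) G SU2)

/-- The topology of pointwise convergence. If `G` is generated by `x₁, …, x_q`, this is the topology
of `Hom(G, SU(2))` as a subspace of `SU(2)^q`. -/
instance : TopologicalSpace (RepSpace G) :=
  TopologicalSpace.induced (fun ρ (a : G) => ρ a) Pi.topologicalSpace

/-- `SU(2)` acts on `Hom(G, SU(2))` by conjugation. -/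
instance : MulAction SU2 (RepSpace G) where
  smul g ρ := ((MulAut.conj g).toMonoidHom.comp (ρ : G →* SU2) : G →* SU2)
  one_smul ρ := by
    refine DFunLike.ext _ _ fun a => ?_
    change 1 * ρ a * 1⁻¹ = ρ a
    simp
  mul_smul g h ρ := by
    refine DFunLike.ext _ _ fun a => ?_
    change (g * h) * ρ a * (g * h)⁻¹ = g * (h * ρ a * h⁻¹) * g⁻¹
    simp [mul_assoc]

theorem smul_apply (g : SU2) (ρ : RepSpace G) (a : G) : (g • ρ) a = g * ρ a * g⁻¹ := rfl

/-- Restriction of representations along a group homomorphism. -/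
def comap {G' : Type*} [Group G'] (φ : G' →* G) (ρ : RepSpace G) : RepSpace G' :=
  MonoidHom.comp (ρ : G →* SU2) φ

end RepSpace

/-- The space `P / conj` of conjugacy classes of the representations that lie in
`P ⊆ Hom(G, SU(2))`. -/
def CharVar {G : Type*} [Group G] (P : Set (RepSpace G)) : Type _ :=
  Quotient ((MulAction.orbitRel SU2 (RepSpace G)).comap (Subtype.val : P → RepSpace G))

namespace CharVar

variable {G : Type*} [Group G]

/-- The quotient topology. -/
instance (P : Set (RepSpace G)) : TopologicalSpace (CharVar P) :=
  inferInstanceAs (TopologicalSpace (Quotient _))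

/-- The conjugacy class of a representation. -/
def mk {P : Set (RepSpace G)} (ρ : P) : CharVar P := Quotient.mk _ ρ

/-- The orbit type stratum of `H ≤ SU(2)`: the conjugacy classes of representations with
stabilizer `H` (equivalently, with stabilizer conjugate to `H`).  It can be non-empty only if `H` is
the centre `{±1}`, a maximal torus, or all of `SU(2)`. -/
def stratum (P : Set (RepSpace G)) (H : Subgroup SU2) : Set (CharVar P) :=
  {q | ∃ ρ : P, mk ρ = q ∧ MulAction.stabilizer SU2 (ρ : RepSpace G) = H}

/-- A function on a subset `S` of a character variety is of class `C^k` if its lift to the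
representations lying over `S` is, locally, the restriction of a `C^k` function of the values at
finitely many group elements. This is the `C^k` structure of `S` as a subquotient of `SU(2)^q`. -/
def IsCkOn (k : ℕ∞) {P : Set (RepSpace G)} (S : Set (CharVar P)) (u : CharVar P → ℝ) : Prop :=
  ∀ ρ₀ : P, mk ρ₀ ∈ S → ∃ (m : ℕ) (s : Fin m → G) (Φ : (Fin m → ℍ[ℝ]) → ℝ),
    ContDiff ℝ k Φ ∧
      ∀ᶠ ρ in nhds ρ₀, mk ρ ∈ S → u (mk ρ) = Φ fun i => ((ρ : RepSpace G) (s i) : ℍ[ℝ])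

/-- `r` restricts to a bijection from `S` to `S'` under which the `C^k` functions on `S'` and those
on `S` correspond to each other. -/
def IsCkDiffeoOn (k : ℕ∞) {G' : Type*} [Group G'] {P : Set (RepSpace G)} {P' : Set (RepSpace G')}
    (r : CharVar P → CharVar P') (S : Set (CharVar P)) (S' : Set (CharVar P')) : Prop :=
  Set.BijOn r S S' ∧ ∀ u : CharVar P' → ℝ, IsCkOn k S' u ↔ IsCkOn k S (u ∘ r)

/-- The map `[ρ] ↦ [ρ ∘ φ]` of character varieties induced by a group homomorphism `φ`. -/
def restrict {G' : Type*} [Group G'] (φ : G' →* G) (P : Set (RepSpace G)) :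
    CharVar P → CharVar (Set.univ : Set (RepSpace G')) :=
  Quotient.map (fun ρ => ⟨RepSpace.comap φ ρ, Set.mem_univ _⟩) (by
    rintro ρ σ ⟨g, hg⟩
    refine ⟨g, ?_⟩
    refine DFunLike.ext _ _ fun a => ?_
    exact DFunLike.congr_fun hg (φ a))

end CharVar

/-- The character variety `𝓜(M) = Hom(π₁(M), SU(2)) / conj`, with base point `x`. -/
abbrev CharacterVariety (M : Type*) [TopologicalSpace M] (x : M) : Type _ :=
  CharVar (Set.univ : Set (RepSpace (FundamentalGroup M x)))

/-- Perturbation functions: `C^k`, odd and `2π`-periodic. -/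
structure IsPerturbationFunction (k : ℕ∞) (f : ℝ → ℝ) : Prop where
  contDiff : ContDiff ℝ k f
  odd : f.Odd
  periodic : f.Periodic (2 * Real.pi)

/-- `m = F(l)`, where `F(e^{αQ}) = e^{f(α)Q}` for purely imaginary unit quaternions `Q`. Here
`e^{αQ} = cos α + sin α Q`; every unit quaternion has this form. -/
def PerturbationRelation (f : ℝ → ℝ) (l m : SU2) : Prop :=
  ∀ (α : ℝ) (Q : ℍ[ℝ]), Q.re = 0 → ‖Q‖ = 1 →
    (l : ℍ[ℝ]) = (Real.cos α : ℍ[ℝ]) + Real.sin α • Q →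
      (m : ℍ[ℝ]) = (Real.cos (f α) : ℍ[ℝ]) + Real.sin (f α) • Q

section Tube

variable {F : Type*} [TopologicalSpace F] [ChartedSpace (EuclideanSpace ℝ (Fin 2)) F]

/-- A tubular neighbourhood of `C × {1/2}` in `F × (0,1)`, framed by the surface. A smooth embedding
`S¹ × D² → F × (0,1)` is given together with an extension to an open embedding of `S¹ × ℂ` (one
always exists); the solid torus is the image of the points of `S¹ × ℂ` with `‖w‖ ≤ 1`. -/
structure PushedInTube (C : Circle → F) where
  toFun : Circle × ℂ → F × ℝ
  /-- a diffeomorphism onto an open subset of `F × (0,1)` -/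
  isLocalDiffeomorph : IsLocalDiffeomorph ((𝓡 1).prod 𝓘(ℝ, ℂ)) ((𝓡 2).prod 𝓘(ℝ, ℝ)) ∞ toFun
  injective : Function.Injective toFun
  mem_Ioo : ∀ p, (toFun p).2 ∈ Set.Ioo (0 : ℝ) 1
  /-- the core is `C × {1/2}` -/
  core : ∀ z, toFun (z, 0) = (C z, 1 / 2)
  /-- the longitude `z ↦ N(z, 1)` is represented by a push off `z ↦ (C z, 1/2 + ε)`, where
  `C × [1/2, 1/2 + ε]` lies in the solid torus: the two are homotopic in the solid torus minus its
  core -/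
  framing : ∃ ε : ℝ, 0 < ε ∧
    (∀ z : Circle, ∀ s ∈ Set.Icc 0 ε,
      (C z, 1 / 2 + s) ∈ toFun '' (Set.univ ×ˢ Metric.closedBall 0 1)) ∧
    ∃ h : Circle × unitInterval → F × ℝ, Continuous h ∧
      (∀ z, h (z, 0) = toFun (z, 1)) ∧ (∀ z, h (z, 1) = (C z, 1 / 2 + ε)) ∧
      ∀ p, h p ∈ toFun '' (Set.univ ×ˢ (Metric.closedBall 0 1 \ {0}))

namespace PushedInTube

variable {C : Circle → F} (N : PushedInTube C)

/-- The complement of the (interior of the) solid torus in `F × [0,1]`. -/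
def exterior : Set (F × ℝ) :=
  {p | p.2 ∈ Set.Icc (0 : ℝ) 1 ∧ p ∉ N.toFun '' (Set.univ ×ˢ Metric.ball 0 1)}

theorem mem_exterior_of_norm (z : Circle) {w : ℂ} (hw : ‖w‖ = 1) :
    N.toFun (z, w) ∈ N.exterior := by
  refine ⟨Set.Ioo_subset_Icc_self (N.mem_Ioo _), ?_⟩
  rintro ⟨⟨z', w'⟩, ⟨-, hw'⟩, h⟩
  have := N.injective h
  simp only [Prod.mk.injEq] at this
  simp [this.2, hw] at hw'

theorem mem_exterior_of_end (x : F) {t : ℝ} (ht : t = 0 ∨ t = 1) : (x, t) ∈ N.exterior := by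
  refine ⟨by rcases ht with rfl | rfl <;> simp, ?_⟩
  rintro ⟨p, -, h⟩
  have := N.mem_Ioo p
  rw [h] at this
  rcases ht with rfl | rfl <;> simp at this

/-- The point `N(1,1)` on the boundary torus. -/
def basePoint : N.exterior := ⟨N.toFun (1, 1), N.mem_exterior_of_norm _ (by simp)⟩

/-- The longitude `N(S¹ × {1})`. -/
def longitude : Path N.basePoint N.basePoint where
  toFun t := ⟨N.toFun (Circle.exp (2 * Real.pi * t), 1), N.mem_exterior_of_norm _ (by simp)⟩
  continuous_toFun := by
    have := N.isLocalDiffeomorph.contMDiff.continuous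
    fun_prop
  source' := by simp [basePoint]
  target' := by simp [basePoint]

/-- The meridian `N({1} × ∂D²)`. -/
def meridian : Path N.basePoint N.basePoint where
  toFun t := ⟨N.toFun (1, (Circle.exp (2 * Real.pi * t) : ℂ)),
    N.mem_exterior_of_norm _ (Circle.norm_coe _)⟩
  continuous_toFun := by
    have := N.isLocalDiffeomorph.contMDiff.continuous
    fun_prop
  source' := by simp [basePoint]
  target' := by simp [basePoint]

/-- The class in `π₁` based at `y` of a loop at `N(1,1)`, joined to `y` by the path `δ`. -/
def loopClass {y : N.exterior} (δ : Path N.basePoint y) (l : Path N.basePoint N.basePoint) :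
    FundamentalGroup N.exterior y :=
  FundamentalGroup.fundamentalGroupMulEquivOfPath δ
    (FundamentalGroup.fromPath (Path.Homotopic.Quotient.mk l))

/-- The representations of `π₁` of the exterior that satisfy the perturbation condition
`ρ(μ) = F(ρ(λ))`. Conjugation invariance makes the choice of `δ` irrelevant. -/
def perturbedReps (f : ℝ → ℝ) (y : N.exterior) : Set (RepSpace (FundamentalGroup N.exterior y)) :=
  {ρ | ∀ δ : Path N.basePoint y,
    PerturbationRelation f (ρ (N.loopClass δ N.longitude)) (ρ (N.loopClass δ N.meridian))}

/-- The perturbed character variety `𝓜_π(F × I)` for `π = (N, f)`, with base point `y`. -/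
abbrev PerturbedCharacterVariety (f : ℝ → ℝ) (y : N.exterior) : Type _ :=
  CharVar (N.perturbedReps f y)

/-- The inclusion of the end `F × {t}`, `t = 0, 1`, into the exterior. -/
def endInclusion {t : ℝ} (ht : t = 0 ∨ t = 1) : C(F, N.exterior) where
  toFun x := ⟨(x, t), N.mem_exterior_of_end x ht⟩

/-- The restriction map `𝓜_π(F × I) → 𝓜(F × {t}) = 𝓜(F)`, induced by the inclusion of the end and a
path `γ` between the base points. -/
def restrictToEnd (f : ℝ → ℝ) {t : ℝ} (ht : t = 0 ∨ t = 1) {x : F} {y : N.exterior}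
    (γ : Path (N.endInclusion ht x) y) :
    N.PerturbedCharacterVariety f y → CharacterVariety F x :=
  CharVar.restrict
    ((FundamentalGroup.fundamentalGroupMulEquivOfPath γ).toMonoidHom.comp
      (FundamentalGroup.map (N.endInclusion ht) x)) _

end PushedInTube

end Tube

end

open Topology unitInterval Set

universe u

/-! Cut the complement of `C × {1/2}` in `F × [0,1]` along the wall `C × (1/2, 1]`. Away from the
wall everything can be pushed vertically down to the bottom, and a path that crosses the wall picks
up a meridian. By van Kampen, the fundamental group of the exterior is therefore that of `F` with
one generator `μ` added, subject only to the relation that `μ` commutes with the longitude, which is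
the class of `C`. So a representation `χ` of `π₁(F)` together with an element commuting with `χ(C)`
is the same as a representation of the exterior. The perturbation condition prescribes this element
as the value of the perturbation map at `χ(C)`. It does commute with `χ(C)`, because the
perturbation map is equivariant under conjugation. Hence restriction to an end has an inverse
already before dividing by conjugation. By uniqueness the inverse is equivariant, so stabilizers
agree, and the assertions about the quotients follow formally (`CharVar.isIso_restrict`).

Van Kampen is carried out for holonomies, that is functors from the fundamental groupoid to a group
`G`, so no presentation is needed. Uniqueness is `Collar.holonomy_bottom_unique`, existence is
`Collar.holonomy_bottom_exists`; the top end follows by reflecting the interval. Both concern the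
complement of the core of a bicollar `S¹ × ℝ → F` with a standard elliptic meridian. A general tube
is compared with this model in `exists_collar_comparison`: the height has non-zero gradient in each
normal disc, the lines orthogonal to it project to a bicollar, and small normal circles deform into
ellipses without meeting the core. The longitude is handled by the framing. A radial retraction then
passes from the complement of the core to the exterior (`exists_end_data`).

The smoothness of the inverse needs no separate estimate. Existence holds for every group `G`, so it
can be applied to the group of `C^k` maps `Hom(π₁(F), SU(2)) → SU(2)` and the tautological
representation into it (`exists_extension`). The values of the extension are then `C^k` functions by
construction. This requires that the perturbation map extend to a `C^k` map of the quaternions,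
without loss of derivatives at `±1`; there the parity of `f` is used, through a Taylor polynomial of
the right parity and a flat remainder. -/

/-- A holonomy on `Y` with values in `G`: a multiplicative homotopy invariant of paths, i.e. a
functor from the fundamental groupoid of `Y` to `G`. -/
structure Holonomy (Y : Type*) [TopologicalSpace Y] (G : Type*) [Group G] where
  toFun : ∀ {a b : Y}, Path a b → G
  map_trans' : ∀ {a b d : Y} (p : Path a b) (q : Path b d), toFun (p.trans q) = toFun q * toFun p
  map_homotopic' : ∀ {a b : Y} {p q : Path a b}, p.Homotopic q → toFun p = toFun q

/-! ### Holonomies: functors from the fundamental groupoid to a group -/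

namespace Holonomy

variable {Y Z W : Type*} [TopologicalSpace Y] [TopologicalSpace Z] [TopologicalSpace W]
  {G : Type*} [Group G]

instance : CoeFun (Holonomy Y G) fun _ => ∀ {a b : Y}, Path a b → G := ⟨@Holonomy.toFun Y _ G _⟩

variable (c : Holonomy Y G) {a b d : Y}

theorem map_trans (p : Path a b) (q : Path b d) : c (p.trans q) = c q * c p := c.map_trans' p q

theorem map_homotopic {p q : Path a b} (h : p.Homotopic q) : c p = c q := c.map_homotopic' h

@[simp] theorem map_refl : c (Path.refl a) = 1 := by
  have h := c.map_trans (Path.refl a) (Path.refl a)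
  rw [Path.refl_trans_refl] at h
  simpa using h

@[simp] theorem map_symm (p : Path a b) : c p.symm = (c p)⁻¹ := by
  have h := c.map_trans p p.symm
  rw [← c.map_homotopic ⟨Path.Homotopy.reflTransSymm p⟩, map_refl] at h
  exact eq_inv_of_mul_eq_one_left h.symm

/-- Pointwise comparison lets the endpoints be equal only propositionally, so that casts of paths
never need to be transported. -/
theorem map_eq_of_eq {a' b' : Y} {p : Path a b} {q : Path a' b'} (h : ∀ t, p t = q t) :
    c p = c q := by
  obtain rfl : a = a' := by simpa using h 0
  obtain rfl : b = b' := by simpa using h 1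
  congr 1
  ext t
  exact h t

@[simp] theorem map_cast (p : Path a b) {a' b' : Y} (ha : a' = a) (hb : b' = b) :
    c (p.cast ha hb) = c p := c.map_eq_of_eq fun _ => rfl

/-- Pull back of a holonomy along a continuous map. -/
def comap (c : Holonomy Z G) (f : C(Y, Z)) : Holonomy Y G where
  toFun p := c (p.map f.continuous)
  map_trans' p q := by rw [Path.map_trans, c.map_trans]
  map_homotopic' h := c.map_homotopic (h.map f)

theorem comap_apply (c : Holonomy Z G) (f : C(Y, Z)) (p : Path a b) :
    c.comap f p = c (p.map f.continuous) := rfl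

/-- Gauge transformation of a holonomy. -/
def gauge (u : Y → G) : Holonomy Y G where
  toFun {a b} p := u b * c p * (u a)⁻¹
  map_trans' p q := by rw [c.map_trans]; group
  map_homotopic' h := by rw [c.map_homotopic h]

theorem gauge_apply (u : Y → G) (p : Path a b) : c.gauge u p = u b * c p * (u a)⁻¹ := rfl

/-- The holonomy between two points of a simply connected space. -/
noncomputable def diff [SimplyConnectedSpace Y] (a b : Y) : G :=
  c (PathConnectedSpace.somePath a b)

section SimplyConnected

variable [SimplyConnectedSpace Y]

theorem apply_eq_diff (p : Path a b) : c p = c.diff a b :=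
  c.map_homotopic (SimplyConnectedSpace.paths_homotopic _ _)

variable (a b d) in
theorem diff_mul : c.diff b d * c.diff a b = c.diff a d := by
  rw [diff, diff, ← c.map_trans, c.apply_eq_diff]

variable (a) in
@[simp] theorem diff_self : c.diff a a = 1 := by rw [← c.apply_eq_diff (Path.refl a), map_refl]

variable (a b) in
theorem diff_inv : (c.diff a b)⁻¹ = c.diff b a := by
  rw [inv_eq_iff_mul_eq_one, diff_mul, diff_self]

theorem diff_comap_gauge (c : Holonomy Z G) (u : Z → G) (f : C(Y, Z)) (a b : Y) :
    ((c.gauge u).comap f).diff a b = u (f b) * (c.comap f).diff a b * (u (f a))⁻¹ := rfl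

/-- The main computing device: the value on a path that lifts to a simply connected space depends
only on the ends of the lift, so homotopies turn into instances of `diff_mul`. -/
theorem apply_eq_diff_of_lift (c : Holonomy Z G) (f : C(Y, Z)) {x y : Z} (p : Path x y)
    (q : Path a b) (h : ∀ t, p t = f (q t)) : c p = (c.comap f).diff a b := by
  rw [← apply_eq_diff _ q, comap_apply]
  exact c.map_eq_of_eq h

/-- Used for deck transformations (`φ` a translation) and for changes of parameter. -/
theorem diff_eq_of_comp [SimplyConnectedSpace W] (c : Holonomy Z G) (f : C(Y, Z)) (g : C(W, Z))
    (φ : C(W, Y)) (h : ∀ w, g w = f (φ w)) (w w' : W) :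
    (c.comap g).diff w w' = (c.comap f).diff (φ w) (φ w') :=
  apply_eq_diff_of_lift c f _ ((PathConnectedSpace.somePath w w').map φ.continuous) fun _ => h _

end SimplyConnected

/-- The homomorphism on the fundamental group given by a holonomy. -/
def hom (y : Y) : FundamentalGroup Y y →* G where
  toFun p := Quotient.lift (fun q : Path y y => c q) (fun _ _ h => c.map_homotopic h)
    (FundamentalGroup.toPath p)
  map_one' := c.map_refl
  map_mul' p q := by
    refine Quotient.inductionOn₂ p q fun p q => ?_
    exact c.map_trans q p

theorem hom_mk (y : Y) (p : Path y y) :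
    c.hom y (FundamentalGroup.fromPath (Path.Homotopic.Quotient.mk p)) = c p := rfl

/-- A homomorphism from the fundamental group of a path connected space comes from a holonomy. -/
theorem exists_hom_eq [PathConnectedSpace Y] (y : Y) (ρ : FundamentalGroup Y y →* G) :
    ∃ c : Holonomy Y G, c.hom y = ρ := by
  let r : ∀ z : Y, Path y z := fun z => (PathConnectedSpace.somePath y y).symm.trans
    (PathConnectedSpace.somePath y z)
  have hr : (r y).Homotopic (Path.refl y) := ⟨(Path.Homotopy.reflSymmTrans _).symm⟩
  let mk := fun p : Path y y => FundamentalGroup.fromPath (Path.Homotopic.Quotient.mk p)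
  refine ⟨⟨fun {a b} p => ρ (mk (((r a).trans p).trans (r b).symm)), fun {a b d} p q => ?_,
    fun {a b p q} h => ?_⟩, ?_⟩
  · rw [← map_mul]
    congr 1
    refine Path.Homotopic.Quotient.eq.2 ?_
    refine Path.Homotopic.Quotient.exact ?_
    simp only [Path.Homotopic.Quotient.mk_trans, Path.Homotopic.Quotient.mk_symm]
    have key : ∀ (s : Path.Homotopic.Quotient y b) (t : Path.Homotopic.Quotient b y),
        s.symm.trans (s.trans t) = t := fun s t => by
      rw [← Path.Homotopic.Quotient.trans_assoc, Path.Homotopic.Quotient.symm_trans,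
        Path.Homotopic.Quotient.refl_trans]
    simp only [Path.Homotopic.Quotient.trans_assoc]
    rw [← Path.Homotopic.Quotient.trans_assoc _ (Path.Homotopic.Quotient.mk (r b))]
    simp
  · congr 1
    refine Path.Homotopic.Quotient.eq.2 ?_
    exact ((Path.Homotopic.refl _).hcomp h).hcomp (Path.Homotopic.refl _)
  · refine MonoidHom.ext fun p => ?_
    refine Quotient.inductionOn p fun p => ?_
    change ρ _ = ρ _
    congr 1
    refine Path.Homotopic.Quotient.eq.2 ?_
    refine ((hr.hcomp (Path.Homotopic.refl _)).hcomp hr.symm₂).trans ?_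
    exact (Path.Homotopic.trans ⟨Path.Homotopy.transRefl _⟩ ⟨Path.Homotopy.reflTrans _⟩)

/-- Two holonomies agree on the paths with endpoints in `D` if they agree locally. -/
theorem eq_of_local (c c' : Holonomy Y G) (D : Set Y) (V : Y → Set Y) (hV : ∀ y, IsOpen (V y))
    (hyV : ∀ y, y ∈ V y)
    (hD : ∀ y, ∀ U ∈ 𝓝 y, ∃ d ∈ D, ∃ p : Path y d, range p ⊆ U)
    (hloc : ∀ y, ∀ a ∈ D, ∀ b ∈ D, ∀ p : Path a b, range p ⊆ V y → c p = c' p)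
    (ha : a ∈ D) (hb : b ∈ D) (p : Path a b) : c p = c' p := by
  obtain ⟨t, ht0, htm, ⟨m, hm⟩, ht⟩ := exists_monotone_Icc_subset_open_cover_unitInterval
    (c := fun y => p ⁻¹' V y) (fun y => (hV y).preimage p.continuous)
    (fun s _ => mem_iUnion.2 ⟨p s, hyV _⟩)
  choose y hy using ht
  -- The subdivision points of `p` need not lie in `D`. Each is joined to `D` by a short tail `r`;
  -- in the inductive step the tail is chosen in two consecutive sets of the cover, so that it
  -- serves for both pieces.
  have key : ∀ n, ∃ d ∈ D, ∃ r : Path (p (t n)) d, range r ⊆ V (y n) ∧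
      c ((p.subpath 0 (t n)).trans r) = c' ((p.subpath 0 (t n)).trans r) := by
    intro n
    induction n with
    | zero =>
      refine ⟨a, ha, (Path.refl a).cast (by simp [ht0]) rfl, ?_, ?_⟩
      · rintro _ ⟨s, rfl⟩
        have := hy 0 ⟨le_rfl, htm (Nat.zero_le 1)⟩
        simpa [ht0] using this
      · rw [map_trans, map_trans, map_cast, map_cast, map_refl, map_refl]
        have : ∀ c : Holonomy Y G, c (p.subpath 0 (t 0)) = 1 := fun c => by
          rw [ht0, Path.subpath_self, map_refl]
        rw [this, this]
    | succ n ih =>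
      obtain ⟨d, hd, r, hr, hcr⟩ := ih
      have hmem : p (t (n + 1)) ∈ V (y n) ∩ V (y (n + 1)) :=
        ⟨hy n ⟨htm n.le_succ, le_rfl⟩, hy (n + 1) ⟨le_rfl, htm (n + 1).le_succ⟩⟩
      obtain ⟨d', hd', r', hr'⟩ := hD _ _ (((hV _).inter (hV _)).mem_nhds hmem)
      refine ⟨d', hd', r', hr'.trans inter_subset_right, ?_⟩
      have h1 := hloc (y n) d hd d' hd' ((r.symm.trans (p.subpath (t n) (t (n + 1)))).trans r') (by
        rw [Path.trans_range, Path.trans_range, Path.symm_range,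
          Path.range_subpath_of_le _ _ _ (htm n.le_succ)]
        exact union_subset (union_subset hr (image_subset_iff.2 (hy n)))
          (hr'.trans inter_subset_left))
      have h2 : ∀ c : Holonomy Y G, c ((p.subpath 0 (t (n + 1))).trans r') =
          c ((r.symm.trans (p.subpath (t n) (t (n + 1)))).trans r') *
            c ((p.subpath 0 (t n)).trans r) := fun c => by
        simp only [map_trans, map_symm]
        have := c.map_homotopic ⟨Path.Homotopy.subpathTransSubpath p 0 (t n) (t (n + 1))⟩
        rw [map_trans] at this
        rw [← this]
        group
      rw [h2, h2, h1, hcr]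
  obtain ⟨d, hd, r, hr, hcr⟩ := key m
  have htm1 : t m = 1 := hm m le_rfl
  have hbm : b = p (t m) := by simp [htm1]
  have h1 := hloc (y m) b hb d hd (r.cast hbm rfl) hr
  rw [map_cast, map_cast] at h1
  have h2 : ∀ c : Holonomy Y G, c (p.subpath 0 (t m)) = c p := fun c => by
    rw [htm1, Path.subpath_zero_one, map_cast]
  rwa [map_trans, map_trans, h1, h2, h2, mul_right_inj] at hcr

/-! ### Gluing a holonomy from local sections -/

section Glue

variable {ι : Type*}

/-- `e` is a flat section along `f` of the local system given by the local sections `s i`. -/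
def IsFlatAlong (V : ι → Set Y) (s : ι → Y → G) (f : Z → Y) (e : Z → G) : Prop :=
  ∀ z i, f z ∈ V i → ∀ᶠ z' in 𝓝 z, s i (f z') * e z' = s i (f z) * e z

variable {V : ι → Set Y} {s : ι → Y → G} {f : Z → Y} {e e' : Z → G}

omit [TopologicalSpace Y] in
theorem IsFlatAlong.comp (h : IsFlatAlong V s f e) {φ : W → Z} (hφ : Continuous φ) :
    IsFlatAlong V s (f ∘ φ) (e ∘ φ) := fun w i hi =>
  (hφ.tendsto w).eventually (h (φ w) i hi)

omit [TopologicalSpace Y] in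
-- Since `s i * e` and `s i * e'` are both locally constant, so is `e⁻¹ * e'`. Two flat sections
-- thus differ by a constant right factor, which cancels in `e z' * (e z)⁻¹`.
theorem IsFlatAlong.eq_mul [PreconnectedSpace Z] (h : IsFlatAlong V s f e)
    (h' : IsFlatAlong V s f e') (hV : ∀ y, ∃ i, y ∈ V i) (z z' : Z) :
    e z' * (e z)⁻¹ = e' z' * (e' z)⁻¹ := by
  have : IsLocallyConstant fun z => (e z)⁻¹ * e' z := by
    refine (IsLocallyConstant.iff_eventually_eq _).2 fun z => ?_
    obtain ⟨i, hi⟩ := hV (f z)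
    filter_upwards [h z i hi, h' z i hi] with w hw hw'
    have : (e w)⁻¹ * e' w = (s i (f w) * e w)⁻¹ * (s i (f w) * e' w) := by group
    rw [this, hw, hw']
    group
  have := this.apply_eq_of_preconnectedSpace z z'
  rw [eq_comm, mul_inv_eq_iff_eq_mul, eq_comm]
  rw [inv_mul_eq_iff_eq_mul] at this
  rw [this]
  group

/-- The quotients `s j * (s i)⁻¹` are locally constant transition functions of a bundle with
discrete fibre `G`, which is a covering. A lift of the square to it, read in the frames `s i`, is
the flat section. -/
theorem exists_isFlatAlong (hV : ∀ i, IsOpen (V i)) (hcov : ∀ y, ∃ i, y ∈ V i)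
    (hs : ∀ i j y, y ∈ V i → y ∈ V j → ∀ᶠ y' in 𝓝 y,
      s i y' * (s j y')⁻¹ = s i y * (s j y)⁻¹) (f : C(I × I, Y)) :
    ∃ e : I × I → G, IsFlatAlong V s f e := by
  -- With the discrete topology on the fibre, continuity of the coordinate changes is exactly the
  -- local constancy in `hs`.
  let _ : TopologicalSpace G := ⊥
  have : DiscreteTopology G := ⟨rfl⟩
  choose idx hidx using hcov
  let B : FiberBundleCore ι Y G :=
    { baseSet := V
      isOpen_baseSet := hV
      indexAt := idx
      mem_baseSet_at := hidx
      coordChange := fun i j y g => s j y * (s i y)⁻¹ * g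
      coordChange_self := fun i y _ g => by simp
      continuousOn_coordChange := fun i j => by
        rintro ⟨y, g⟩ ⟨hy, -⟩
        refine ContinuousAt.continuousWithinAt ?_
        refine (continuousAt_const (y := s j y * (s i y)⁻¹ * g)).congr ?_
        filter_upwards [continuousAt_fst.eventually (hs j i y hy.2 hy.1),
          continuousAt_snd.eventually (IsOpen.mem_nhds (isOpen_discrete {g}) rfl)] with p hp hp'
        rw [hp, hp']
      coordChange_comp := fun i j k y _ g => by group }
  have cov : IsCoveringMap (Bundle.TotalSpace.proj : B.TotalSpace → Y) :=
    FiberBundle.isCoveringMap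
  obtain ⟨Γ₀, hΓ₀, -⟩ := cov.exists_path_lifts (f.comp ⟨fun t => (0, t), by fun_prop⟩)
    ⟨f (0, 0), (1 : G)⟩ rfl
  let Γ := cov.liftHomotopy f Γ₀ (fun a => (congr_fun hΓ₀ a).symm)
  have hΓ : ∀ z, (Γ z).proj = f z := fun z => congr_fun (cov.liftHomotopy_lifts f Γ₀ _) z
  let v : I × I → G := fun z => (Γ z).snd
  refine ⟨fun z => (s (idx (Γ z).proj) (Γ z).proj)⁻¹ * v z, fun z i hi => ?_⟩
  have hmem : Γ z ∈ (B.localTriv i).source := by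
    rw [FiberBundleCore.mem_localTriv_source]
    exact (hΓ z).symm ▸ hi
  have hc : ContinuousAt (fun z => (B.localTriv i (Γ z)).2) z :=
    continuousAt_snd.comp (((B.localTriv i).continuousAt hmem).comp Γ.continuous.continuousAt)
  filter_upwards [hc.eventually (IsOpen.mem_nhds (isOpen_discrete {_}) rfl)] with w hw
  have hw' : s i (Γ w).proj * (s (idx (Γ w).proj) (Γ w).proj)⁻¹ * v w =
    s i (Γ z).proj * (s (idx (Γ z).proj) (Γ z).proj)⁻¹ * v z := hw
  rw [mul_assoc, mul_assoc, hΓ w, hΓ z] at hw'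
  simpa only [hΓ w, hΓ z] using hw'

/-- Local sections whose quotients are locally constant determine a holonomy. -/
theorem exists_of_local_sections (hV : ∀ i, IsOpen (V i)) (hcov : ∀ y, ∃ i, y ∈ V i)
    (hs : ∀ i j y, y ∈ V i → y ∈ V j → ∀ᶠ y' in 𝓝 y,
      s i y' * (s j y')⁻¹ = s i y * (s j y)⁻¹) :
    ∃ c : Holonomy Y G, ∀ i {a b : Y} (p : Path a b), range p ⊆ V i →
      c p = (s i b)⁻¹ * s i a := by
  -- A path is treated as a homotopy that is constant in the second variable.
  have ex : ∀ {a b : Y} (p : Path a b), ∃ e : I → G, IsFlatAlong V s p e := fun p => by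
    obtain ⟨e, he⟩ := exists_isFlatAlong hV hcov hs (⟨fun x => p x.1, by fun_prop⟩ : C(I × I, Y))
    exact ⟨_, he.comp (φ := fun t => (t, 0)) (by fun_prop)⟩
  choose E hE using @ex
  have hE' : ∀ {a b : Y} (p : Path a b) (e : I → G), IsFlatAlong V s p e →
      E p 1 * (E p 0)⁻¹ = e 1 * (e 0)⁻¹ := fun p e he => (hE p).eq_mul he hcov 0 1
  refine ⟨⟨fun p => E p 1 * (E p 0)⁻¹, fun {a b d} p q => ?_, ?_⟩, ?_⟩
  · let φ : I → I := fun t => ⟨t / 2, by constructor <;> linarith [t.2.1, t.2.2]⟩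
    let ψ : I → I := fun t => ⟨(1 + t) / 2, by constructor <;> linarith [t.2.1, t.2.2]⟩
    have hφ : p.trans q ∘ φ = p := by
      funext t
      have h2 : ((φ t : I) : ℝ) ≤ 1 / 2 := by simp only [φ]; linarith [t.2.2]
      simp only [Function.comp_apply, Path.trans_apply, dif_pos h2]
      congr 1
      ext
      simp only [φ]; ring
    have hψ : p.trans q ∘ ψ = q := by
      funext t
      by_cases h2 : ((ψ t : I) : ℝ) ≤ 1 / 2
      · have : t = 0 := by
          ext
          simp only [ψ] at h2
          exact le_antisymm (by simp; linarith) t.2.1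
        subst this
        simp [Path.trans_apply, ψ]
      · simp only [Function.comp_apply, Path.trans_apply, dif_neg h2]
        congr 1
        ext
        simp only [ψ]; ring
    have h1 := hE' p _ (by simpa only [hφ] using (hE (p.trans q)).comp (φ := φ) (by fun_prop))
    have h2 := hE' q _ (by simpa only [hψ] using (hE (p.trans q)).comp (φ := ψ) (by fun_prop))
    rw [h1, h2]
    have e1 : φ 1 = ψ 0 := by ext; simp [φ, ψ]
    have e2 : φ 0 = 0 := by ext; simp [φ]
    have e3 : ψ 1 = 1 := by ext; simp [ψ]
    simp only [Function.comp_apply, e1, e2, e3]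
    group
  · rintro a b p q ⟨H⟩
    obtain ⟨e, he⟩ := exists_isFlatAlong hV hcov hs H.toContinuousMap
    -- The two sides of the homotopy that lie over the endpoints are constant paths, so a flat
    -- section on the square is constant along them, and its two remaining sides give equal values.
    have hconst : ∀ y : Y, IsFlatAlong V s (fun _ : I => y) (fun _ => (1 : G)) :=
      fun y z i _ => Filter.Eventually.of_forall fun _ => rfl
    have hcomp : ∀ (φ : I → I × I) (f : I → Y), Continuous φ → H.toContinuousMap ∘ φ = f →
        IsFlatAlong V s f (e ∘ φ) := fun φ f hφ hf => hf ▸ he.comp hφ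
    have h1 := hE' p _ (hcomp (fun t => (0, t)) p (by fun_prop) (by ext t; simp))
    have h2 := hE' q _ (hcomp (fun t => (1, t)) q (by fun_prop) (by ext t; simp))
    have h3 := (hcomp (fun t => (t, 0)) (fun _ => a) (by fun_prop) (by ext t; simp)).eq_mul
      (hconst a) hcov 0 1
    have h4 := (hcomp (fun t => (t, 1)) (fun _ => b) (by fun_prop) (by ext t; simp)).eq_mul
      (hconst b) hcov 0 1
    simp only [Function.comp_apply, inv_one, mul_one, mul_inv_eq_one] at h1 h2 h3 h4
    rw [h1, h2, h3, h4]
  · intro i a b p hp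
    refine (hE' p (fun t => (s i (p t))⁻¹) fun t j hj => ?_).trans (by simp)
    exact p.continuous.continuousAt.eventually (hs j i (p t) hj (hp ⟨t, rfl⟩))

end Glue

end Holonomy

theorem exists_path_real (a b : ℝ) (h : a ≤ b) : ∃ p : Path a b, ∀ t, p t ∈ Icc a b := by
  have : JoinedIn (Icc a b) a b := (convex_Icc a b).isPathConnected ⟨a, le_rfl, h⟩ |>.joinedIn
    a ⟨le_rfl, h⟩ b ⟨h, le_rfl⟩
  exact ⟨this.somePath, this.somePath_mem⟩

/-- A path in a convex set that stays in a convex subset. -/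
theorem Convex.exists_path {E : Type*} [AddCommGroup E] [Module ℝ E] [TopologicalSpace E]
    [IsTopologicalAddGroup E] [ContinuousSMul ℝ E] {S T : Set E} (hT : Convex ℝ T) (hTS : T ⊆ S)
    (a b : S) (ha : (a : E) ∈ T) (hb : (b : E) ∈ T) :
    ∃ p : Path a b, ∀ t, (p t : E) ∈ T := by
  have h := (hT.isPathConnected ⟨a, ha⟩).joinedIn a ha b hb
  exact ⟨⟨⟨fun t => ⟨h.somePath t, hTS (h.somePath_mem t)⟩, by fun_prop⟩, by simp, by simp⟩,
    fun t => h.somePath_mem t⟩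

/-- An open embedding of `S¹ × ℝ`, i.e. a bicollar of the curve `S¹ × 0`. -/
structure Collar (F : Type*) [TopologicalSpace F] where
  toFun : Circle × ℝ → F
  isOpenEmbedding : IsOpenEmbedding toFun

namespace Holonomy

variable {Y : Type*} [TopologicalSpace Y] {G : Type*} [Group G] {a b : Y}

/-- This is `eq_of_local` on the interval, for the holonomies pulled back along `p` and `D = univ`.
-/
theorem eq_of_local_path (c c' : Holonomy Y G) (p : Path a b)
    (h : ∀ t, ∃ V, IsOpen V ∧ p t ∈ V ∧ ∀ {x y : Y} (r : Path x y), range r ⊆ V → c r = c' r) :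
    c p = c' p := by
  choose V hV hpV hc using h
  have h1 := eq_of_local (c.comap p.toContinuousMap) (c'.comap p.toContinuousMap) univ
    (fun t => p ⁻¹' V t) (fun t => (hV t).preimage p.continuous) hpV
    (fun t U hU => ⟨t, mem_univ _, Path.refl t, by simpa using mem_of_mem_nhds hU⟩)
    (fun t _ _ _ _ r hr => hc t _ (by rintro _ ⟨s, rfl⟩; exact hr ⟨s, rfl⟩))
    (mem_univ _) (mem_univ _) Path.id
  have h2 : ∀ c : Holonomy Y G, c.comap p.toContinuousMap Path.id = c p := fun c =>
    c.map_eq_of_eq fun t => rfl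
  rwa [h2, h2] at h1

end Holonomy

/-! ### The complement of the core of a bicollar -/

namespace Collar

variable {F : Type*} [TopologicalSpace F] (K : Collar F)

theorem continuous_toFun : Continuous K.toFun := K.isOpenEmbedding.continuous

theorem injective : Function.Injective K.toFun := K.isOpenEmbedding.injective

/-- The core curve of the collar. -/
def core : Set F := range fun z => K.toFun (z, 0)

theorem mem_core_iff {e : Circle × ℝ} : K.toFun e ∈ K.core ↔ e.2 = 0 := by
  constructor
  · rintro ⟨z, hz⟩
    rw [← K.injective hz]
  · rintro h
    exact ⟨e.1, by rw [← h]⟩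

/-- The complement of `core × {1/2}` in `F × [0,1]`. -/
def space : Set (F × ℝ) := {p | p.2 ∈ Icc (0 : ℝ) 1 ∧ ¬ (p.1 ∈ K.core ∧ p.2 = 1 / 2)}

/-- The part of the complement that lies below the wall `core × [1/2, 1]`. -/
def lower : Set K.space := {y | y.1.1 ∈ K.core → y.1.2 < 1 / 2}

/-- The part of the complement that lies over the collar and above the level `1/2`. -/
def upper : Set K.space := {y | y.1.1 ∈ range K.toFun ∧ 1 / 2 < y.1.2}

theorem isClosed_core [T2Space F] : IsClosed K.core :=
  (isCompact_range (K.continuous_toFun.comp (by fun_prop))).isClosed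

theorem isOpen_lower [T2Space F] : IsOpen K.lower := by
  have : K.lower = {y : K.space | y.1.1 ∈ K.core}ᶜ ∪ {y | y.1.2 < 1 / 2} := by
    ext y
    simp only [lower, mem_ofPred_eq, mem_union, mem_compl_iff]
    tauto
  rw [this]
  refine IsOpen.union ?_ ?_
  · exact (K.isClosed_core.preimage (by fun_prop)).isOpen_compl
  · exact isOpen_lt (by fun_prop) (by fun_prop)

theorem isOpen_upper : IsOpen K.upper :=
  (K.isOpenEmbedding.isOpen_range.preimage
    (f := fun y : K.space => y.1.1) (by fun_prop)).inter
    (isOpen_lt (f := fun _ => 1 / 2) (g := fun y : K.space => y.1.2) (by fun_prop) (by fun_prop))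

theorem mem_upper_of_notMem_lower {y : K.space} (h : y ∉ K.lower) : y ∈ K.upper := by
  simp only [lower, mem_ofPred_eq, not_forall, not_lt] at h
  obtain ⟨⟨z, hz⟩, h2⟩ := h
  refine ⟨⟨_, hz⟩, lt_of_le_of_ne h2 fun h3 => y.2.2 ⟨⟨z, hz⟩, h3.symm⟩⟩

/-- The projection to the surface. -/
def proj : C(K.space, F) := ⟨fun y => y.1.1, by fun_prop⟩

/-- The inclusion of the bottom end. -/
def bottom : C(F, K.space) :=
  ⟨fun x => ⟨(x, 0), by simp [space]⟩, by fun_prop⟩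

/-- The reflection that exchanges the ends. -/
def reflect : C(K.space, K.space) :=
  ⟨fun y => ⟨(y.1.1, 1 - y.1.2), ⟨⟨by linarith [y.2.1.2], by linarith [y.2.1.1]⟩,
    fun h => y.2.2 ⟨h.1, by linarith [h.2]⟩⟩⟩, by fun_prop⟩

theorem reflect_reflect (y : K.space) : K.reflect (K.reflect y) = y := by
  ext <;> simp [reflect]

/-- The inclusion of the top end. -/
def top : C(F, K.space) := K.reflect.comp K.bottom

/-- Over the core, a point of `K.lower` is strictly below level `1/2`, so lowering it cannot run
into the removed curve; elsewhere there is nothing to avoid. -/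
theorem mem_space_of_mem_lower {y : K.space} (hy : y ∈ K.lower) {r : ℝ} (h0 : 0 ≤ r)
    (h1 : r ≤ 1) : (y.1.1, r * y.1.2) ∈ K.space := by
  have h2 := y.2.1
  refine ⟨⟨mul_nonneg h0 h2.1, mul_le_one₀ h1 h2.1 h2.2⟩, fun h => ?_⟩
  have h3 := hy h.1
  have h4 := h.2
  dsimp only at h4
  nlinarith [h2.1]

/-- The vertical path from the bottom to a point below the wall. -/
def vert (y : K.space) (hy : y ∈ K.lower) : Path (K.bottom (K.proj y)) y where
  toFun t := ⟨(y.1.1, t * y.1.2), K.mem_space_of_mem_lower hy t.2.1 t.2.2⟩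
  continuous_toFun := by fun_prop
  source' := by simp [bottom, proj]
  target' := by simp

theorem vert_mem_lower (y : K.space) (hy : y ∈ K.lower) (t : I) : K.vert y hy t ∈ K.lower := by
  intro h
  have h3 := hy h
  have h2 := y.2.1
  change (t : ℝ) * y.1.2 < 1 / 2
  nlinarith [t.2.2, h2.1]

theorem bottom_mem_lower (x : F) : K.bottom x ∈ K.lower := fun _ => by
  change (0 : ℝ) < 1 / 2
  norm_num

/-- The standard meridian, an ellipse around `(K (1, 0), 1/2)`; it starts below the core and goes
first to the negative side. -/
noncomputable def meridian (r s : ℝ) (hr : 0 < r) (hs : 0 < s) (hs' : s < 1 / 2) : C(ℝ, K.space) where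
  toFun θ := ⟨(K.toFun (1, -(r * Real.sin θ)), 1 / 2 - s * Real.cos θ), by
    refine ⟨⟨by nlinarith [Real.cos_le_one θ], by nlinarith [Real.neg_one_le_cos θ]⟩, fun h => ?_⟩
    have h1 := K.mem_core_iff.1 h.1
    have h2 : s * Real.cos θ = 0 := by linarith [h.2]
    have h3 : Real.sin θ = 0 := by simpa [hr.ne'] using h1
    have h4 : Real.cos θ = 0 := by simpa [hs.ne'] using h2
    simpa [h3, h4] using Real.sin_sq_add_cos_sq θ⟩
  continuous_toFun := by
    have := K.continuous_toFun
    fun_prop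

section Merid

variable {r s : ℝ} (hr : 0 < r) (hs : 0 < s) (hs' : s < 1 / 2)

theorem meridian_mem_lower {θ : ℝ} (h : Real.sin θ ≠ 0 ∨ 0 < Real.cos θ) :
    K.meridian r s hr hs hs' θ ∈ K.lower := by
  intro h1
  have h1 : Real.sin θ = 0 := by simpa [hr.ne'] using K.mem_core_iff.1 h1
  have h2 := h.resolve_left (not_not.2 h1)
  change 1 / 2 - s * Real.cos θ < 1 / 2
  nlinarith

theorem meridian_zero_mem_lower : K.meridian r s hr hs hs' 0 ∈ K.lower :=
  K.meridian_mem_lower _ _ _ (by simp)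

theorem reflect_meridian (θ : ℝ) : K.reflect (K.meridian r s hr hs hs' θ) =
    K.meridian r s hr hs hs' (Real.pi - θ) := by
  refine Subtype.ext (Prod.ext ?_ ?_)
  · simp [reflect, meridian]
  · simp [reflect, meridian]; ring

end Merid

section Lift

/-- The universal cover of the collar. -/
noncomputable def cover : C(ℝ × ℝ, F) := ⟨fun e => K.toFun (Circle.exp e.1, e.2), by
  have := K.continuous_toFun; fun_prop⟩

theorem exists_lift {a b : F} (p : Path a b) (hp : range p ⊆ range K.toFun) :
    ∃ q : C(I, ℝ × ℝ), ∀ t, p t = K.cover (q t) := by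
  let ψ := K.isOpenEmbedding.toIsEmbedding.toHomeomorph
  let p' : C(I, Circle × ℝ) := ⟨fun t => ψ.symm ⟨p t, hp ⟨t, rfl⟩⟩, by fun_prop⟩
  have hp' : ∀ t, K.toFun (p' t) = p t := fun t =>
    congrArg Subtype.val (ψ.apply_symm_apply ⟨p t, hp ⟨t, rfl⟩⟩)
  obtain ⟨q, hq, -⟩ := Circle.isCoveringMap_exp.exists_path_lifts
    (ContinuousMap.fst.comp p') (Complex.arg (p' 0).1) (by simp)
  refine ⟨q.prodMk (ContinuousMap.snd.comp p'), fun t => ?_⟩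
  have h1 : Circle.exp (q t) = (p' t).1 := congr_fun hq t
  rw [← hp']
  change K.toFun (p' t) = K.toFun (Circle.exp (q t), (p' t).2)
  rw [h1]

end Lift

end Collar

instance : ContractibleSpace I := (convex_Icc (0 : ℝ) 1).contractibleSpace ⟨0, by simp⟩

/-! ### Uniqueness of the holonomy with given bottom and meridian -/

namespace Collar

variable {F : Type*} [TopologicalSpace F] (K : Collar F) {G : Type*} [Group G]

/-- A holonomy that is trivial along the vertical paths is, below the wall, pulled back from the
bottom. -/
theorem holonomy_lower (c : Holonomy K.space G) (hc : ∀ y hy, c (K.vert y hy) = 1) {a b : K.space}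
    (p : Path a b) (hp : range p ⊆ K.lower) :
    c p = c ((p.map K.proj.continuous).map K.bottom.continuous) := by
  have hmem : ∀ t, p t ∈ K.lower := fun t => hp ⟨t, rfl⟩
  -- The rectangle of vertical segments under `p`: its upper side is `p`, its lower side the shadow
  -- of `p` on the bottom, and its other two sides are vertical paths, on which `c` is trivial.
  let f : C(I × I, K.space) :=
    ⟨fun z => ⟨((p z.1).1.1, z.2 * (p z.1).1.2),
      K.mem_space_of_mem_lower (hmem _) z.2.2.1 z.2.2.2⟩, by fun_prop⟩
  have h0 : c ((p.map K.proj.continuous).map K.bottom.continuous) = (c.comap f).diff (0, 0) (1, 0) :=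
    Holonomy.apply_eq_diff_of_lift c f _ (Path.id.prod (Path.refl 0)) fun t => by
      simp only [f, Path.prod_coe, ContinuousMap.coe_mk, Path.refl_apply, Icc.coe_zero, zero_mul]
      rfl
  have h1 : c p = (c.comap f).diff (0, 1) (1, 1) :=
    Holonomy.apply_eq_diff_of_lift c f _ (Path.id.prod (Path.refl 1)) fun t => by
      simp only [f, Path.prod_coe, ContinuousMap.coe_mk, Path.refl_apply, Icc.coe_one, one_mul]
      rfl
  have h2 : ∀ t : I, (c.comap f).diff (t, 0) (t, 1) = 1 := fun t => by
    rw [← hc (p t) (hmem t)]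
    exact (Holonomy.apply_eq_diff_of_lift c f _ ((Path.refl t).prod Path.id) fun s => rfl).symm
  rw [h0, h1, ← Holonomy.diff_mul _ (0, 1) (1, 0) (1, 1), h2, one_mul,
    ← Holonomy.diff_mul _ (0, 1) (0, 0) (1, 0), ← Holonomy.diff_inv _ (0, 0) (0, 1), h2]
  simp

/-- The universal cover of the part over the collar and above the core. -/
def upperCoverSet : Set (ℝ × ℝ × ℝ) := {e | e.2.2 ∈ Ioc (1 / 2 : ℝ) 1}

theorem convex_upperCoverSet : Convex ℝ upperCoverSet :=
  ((convex_Ioc (1 / 2 : ℝ) 1).linear_preimage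
    (LinearMap.snd ℝ ℝ ℝ ∘ₗ LinearMap.snd ℝ ℝ (ℝ × ℝ)))

instance : ContractibleSpace upperCoverSet :=
  convex_upperCoverSet.contractibleSpace ⟨(0, 0, 1), by constructor <;> norm_num⟩

noncomputable def upperCover : C(upperCoverSet, K.space) :=
  ⟨fun e => ⟨(K.cover (e.1.1, e.1.2.1), e.1.2.2), ⟨⟨by linarith [e.2.1], e.2.2⟩, fun h => by
    have h1 : (1 / 2 : ℝ) < e.1.2.2 := e.2.1
    exact h1.ne' h.2⟩⟩, by fun_prop⟩

/-- Above level `1/2` the wall is the zero set of the collar coordinate; it cuts the cover into two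
convex halves. -/
theorem upperCover_mem_lower {e : upperCoverSet} : K.upperCover e ∈ K.lower ↔ e.1.2.1 ≠ 0 := by
  have h1 : (1 / 2 : ℝ) < e.1.2.2 := e.2.1
  have h2 : K.cover (e.1.1, e.1.2.1) ∈ K.core ↔ e.1.2.1 = 0 := K.mem_core_iff
  change (K.cover (e.1.1, e.1.2.1) ∈ K.core → e.1.2.2 < 1 / 2) ↔ _
  rw [h2]
  constructor
  · exact fun h h3 => lt_asymm h1 (h h3)
  · exact fun h h3 => absurd h3 h

theorem exists_upper_lift {a b : K.space} (p : Path a b) (hp : range p ⊆ K.upper) :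
    ∃ q : C(I, upperCoverSet), ∀ t, p t = K.upperCover (q t) := by
  obtain ⟨q, hq⟩ := K.exists_lift (p.map K.proj.continuous) (by
    rintro _ ⟨t, rfl⟩; exact (hp ⟨t, rfl⟩).1)
  refine ⟨⟨fun t => ⟨((q t).1, (q t).2, (p t).1.2), ⟨(hp ⟨t, rfl⟩).2, (p t).2.1.2⟩⟩,
    by fun_prop⟩, fun t => Subtype.ext (Prod.ext (hq t) rfl)⟩

section Unique

variable {r s : ℝ} (hr : 0 < r) (hs : 0 < s) (hs' : s < 1 / 2)

/-- The part of the meridian that crosses the wall. -/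
theorem meridian_crossing (G : Type*) [Group G] : ∃ e e' : upperCoverSet,
    e.1.2.1 < 0 ∧ 0 < e'.1.2.1 ∧
      (e.1.1, e.1.2.1) = (0, -(r * Real.sin (Real.pi - 1))) ∧
      (e'.1.1, e'.1.2.1) = (0, -(r * Real.sin (Real.pi + 1))) ∧ ∀ c : Holonomy K.space G,
      (c.comap (K.meridian r s hr hs hs')).diff (Real.pi - 1) (Real.pi + 1) =
        (c.comap K.upperCover).diff e e' := by
  -- Any radius below `π / 2` would do in place of `1`: the arc then stays above level `1/2` and
  -- meets the wall only at `π`.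
  have hcos : ∀ θ ∈ Icc (Real.pi - 1) (Real.pi + 1), Real.cos θ < 0 := fun θ hθ =>
    Real.cos_neg_of_pi_div_two_lt_of_lt (by linarith [hθ.1, Real.pi_gt_three])
      (by linarith [hθ.2, Real.pi_gt_three])
  obtain ⟨p, hp⟩ := exists_path_real (Real.pi - 1) (Real.pi + 1) (by linarith)
  let q : C(I, upperCoverSet) := ⟨fun t => ⟨(0, -(r * Real.sin (p t)), 1 / 2 - s * Real.cos (p t)),
    ⟨by nlinarith [hcos _ (hp t)], by nlinarith [Real.neg_one_le_cos (p t)]⟩⟩, by fun_prop⟩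
  have hsin : 0 < Real.sin 1 := Real.sin_pos_of_pos_of_lt_pi one_pos (by linarith [Real.pi_gt_three])
  refine ⟨q 0, q 1, ?_, ?_, by simp [q], by simp [q], fun c => ?_⟩
  · simp only [q, ContinuousMap.coe_mk, p.source, Real.sin_pi_sub]
    nlinarith
  · simp only [q, ContinuousMap.coe_mk, p.target, add_comm Real.pi, Real.sin_add_pi]
    nlinarith
  · rw [← Holonomy.apply_eq_diff _ p, Holonomy.comap_apply]
    exact Holonomy.apply_eq_diff_of_lift c _ _ ⟨q, rfl, rfl⟩ fun t =>
      Subtype.ext (Prod.ext (by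
        change K.toFun (1, _) = K.toFun (Circle.exp 0, _)
        rw [Circle.exp_zero]; rfl) rfl)

/-- The meridian consists of a path below the wall, a crossing, and a path below the wall. -/
theorem meridian_paths : ∃ (p : Path (0 : ℝ) (Real.pi - 1))
    (q : Path (Real.pi + 1) (2 * Real.pi)),
    (∀ t, K.meridian r s hr hs hs' (p t) ∈ K.lower) ∧
    (∀ t, K.meridian r s hr hs hs' (q t) ∈ K.lower) := by
  obtain ⟨p, hp⟩ := exists_path_real 0 (Real.pi - 1) (by linarith [Real.pi_gt_three])
  obtain ⟨q, hq⟩ := exists_path_real (Real.pi + 1) (2 * Real.pi) (by linarith [Real.pi_gt_three])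
  refine ⟨p, q, fun t => K.meridian_mem_lower _ _ _ ?_, fun t => K.meridian_mem_lower _ _ _ ?_⟩
  · rcases (hp t).1.eq_or_lt with h | h
    · right; simp [← h]
    · exact .inl (Real.sin_pos_of_pos_of_lt_pi h (by linarith [(hp t).2])).ne'
  · rcases (hq t).2.eq_or_lt with h | h
    · right; simp [h]
    · refine .inl ?_
      rw [← Real.sin_sub_two_pi]
      exact (Real.sin_neg_of_neg_of_neg_pi_lt (by linarith) (by linarith [(hq t).1])).ne

/-- Van Kampen for the cover by `K.lower` and `K.upper`. On the first set both holonomies come from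
the bottom. On the second they agree on either side of the wall, and it is enough to compare a
single crossing; the meridian contains one, and the rest of the meridian is in `K.lower`. -/
theorem holonomy_eq_of_normalized [T2Space F] (c c' : Holonomy K.space G)
    (hc : ∀ y hy, c (K.vert y hy) = 1) (hc' : ∀ y hy, c' (K.vert y hy) = 1)
    (hF : ∀ {a b : F} (p : Path a b), c.comap K.bottom p = c'.comap K.bottom p)
    (hm : (c.comap (K.meridian r s hr hs hs')).diff 0 (2 * Real.pi) =
      (c'.comap (K.meridian r s hr hs hs')).diff 0 (2 * Real.pi))
    {a b : K.space} (ha : a ∈ K.lower) (hb : b ∈ K.lower) (p : Path a b) : c p = c' p := by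
  have hlow : ∀ {a b : K.space} (p : Path a b), range p ⊆ K.lower → c p = c' p := fun p hp => by
    rw [K.holonomy_lower c hc p hp, K.holonomy_lower c' hc' p hp]
    exact hF _
  classical
  refine Holonomy.eq_of_local c c' K.lower (fun y => if y ∈ K.lower then K.lower else K.upper)
    (fun y => ?_) (fun y => ?_) (fun y U hU => ?_) (fun y a ha b hb p hp => ?_) ha hb p
  · split_ifs
    exacts [K.isOpen_lower, K.isOpen_upper]
  · split_ifs with h
    exacts [h, K.mem_upper_of_notMem_lower h]
  -- A point of the wall leaves it by a short path in the direction of the collar coordinate, at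
  -- constant height.
  · by_cases hy : y ∈ K.lower
    · exact ⟨y, hy, Path.refl y, by simpa using mem_of_mem_nhds hU⟩
    · obtain ⟨q, hq⟩ := K.exists_upper_lift (Path.refl y)
        (by simpa using K.mem_upper_of_notMem_lower hy)
      have hq0 : K.upperCover (q 0) = y := (hq 0).symm
      have hb0 : (q 0).1.2.1 = 0 := by
        by_contra h
        exact hy (hq0 ▸ K.upperCover_mem_lower.2 h)
      let f : ℝ → upperCoverSet := fun b => ⟨((q 0).1.1, b, (q 0).1.2.2), (q 0).2⟩
      have hf : Continuous f := by fun_prop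
      have hf0 : f 0 = q 0 := Subtype.ext (Prod.ext rfl (Prod.ext hb0.symm rfl))
      have : (K.upperCover ∘ f) ⁻¹' U ∈ 𝓝 0 :=
        (K.upperCover.continuous.comp hf).continuousAt.preimage_mem_nhds (by simpa [hf0, hq0])
      obtain ⟨ε, hε, hball⟩ := Metric.mem_nhds_iff.1 this
      obtain ⟨p, hp⟩ := exists_path_real 0 (ε / 2) (by positivity)
      refine ⟨K.upperCover (f (ε / 2)), K.upperCover_mem_lower.2 (by simp [f, hε.ne']),
        (p.map (K.upperCover.continuous.comp hf)).cast (by simp [hf0, hq0]) rfl, ?_⟩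
      rintro _ ⟨t, rfl⟩
      refine hball ?_
      have := hp t
      simp only [Metric.mem_ball, Real.dist_eq, sub_zero, abs_lt]
      constructor <;> linarith [this.1, this.2]
  · split_ifs at hp with hy
    · exact hlow p hp
    · have hside : ∀ (T : Set ℝ), Convex ℝ T → (0 ∉ T) → ∀ e e' : upperCoverSet, e.1.2.1 ∈ T →
          e'.1.2.1 ∈ T → (c.comap K.upperCover).diff e e' = (c'.comap K.upperCover).diff e e' := by
        intro T hT h0 e e' he he'
        have hconv : Convex ℝ (upperCoverSet ∩ {x | x.2.1 ∈ T}) :=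
          convex_upperCoverSet.inter (hT.linear_preimage
            (LinearMap.fst ℝ ℝ ℝ ∘ₗ LinearMap.snd ℝ ℝ (ℝ × ℝ)))
        obtain ⟨p, hp⟩ := hconv.exists_path inter_subset_left e e' ⟨e.2, he⟩ ⟨e'.2, he'⟩
        rw [← Holonomy.apply_eq_diff _ p, ← Holonomy.apply_eq_diff _ p]
        refine hlow _ ?_
        rintro _ ⟨t, rfl⟩
        exact K.upperCover_mem_lower.2 fun h => h0 (h ▸ (hp t).2)
      have hpos := hside (Ioi 0) (convex_Ioi 0) (by simp)
      have hneg := hside (Iio 0) (convex_Iio 0) (by simp)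
      have hcross : ∃ e e' : upperCoverSet, e.1.2.1 < 0 ∧ 0 < e'.1.2.1 ∧
          (c.comap K.upperCover).diff e e' = (c'.comap K.upperCover).diff e e' := by
        obtain ⟨e, e', he, he', -, -, h⟩ := K.meridian_crossing hr hs hs' G
        obtain ⟨p₁, p₂, h₁, h₂⟩ := K.meridian_paths hr hs hs'
        refine ⟨e, e', he, he', ?_⟩
        have e1 := hlow (p₁.map (K.meridian r s hr hs hs').continuous)
          (by rintro _ ⟨t, rfl⟩; exact h₁ t)
        have e2 := hlow (p₂.map (K.meridian r s hr hs hs').continuous)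
          (by rintro _ ⟨t, rfl⟩; exact h₂ t)
        rw [← Holonomy.comap_apply, ← Holonomy.comap_apply, Holonomy.apply_eq_diff,
          Holonomy.apply_eq_diff] at e1 e2
        have e3 : ∀ c : Holonomy ℝ G, c.diff 0 (2 * Real.pi) = c.diff (Real.pi + 1) (2 * Real.pi) *
            c.diff (Real.pi - 1) (Real.pi + 1) * c.diff 0 (Real.pi - 1) := fun c => by
          rw [Holonomy.diff_mul, Holonomy.diff_mul]
        rw [e3, e3, e1, e2, h, h] at hm
        simpa using hm
      obtain ⟨n, o, hn, ho, hno⟩ := hcross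
      -- Any crossing is routed through the one crossing from `n` to `o`, forwards or backwards.
      have hall : ∀ e e' : upperCoverSet, e.1.2.1 ≠ 0 → e'.1.2.1 ≠ 0 →
          (c.comap K.upperCover).diff e e' = (c'.comap K.upperCover).diff e e' := by
        intro e e' he he'
        rcases lt_or_gt_of_ne he with h | h <;> rcases lt_or_gt_of_ne he' with h' | h'
        · exact hneg e e' h h'
        · rw [← Holonomy.diff_mul _ e n e', ← Holonomy.diff_mul _ n o e',
            ← Holonomy.diff_mul _ e n e', ← Holonomy.diff_mul _ n o e', hno, hneg e n h hn,
            hpos o e' ho h']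
        · rw [← Holonomy.diff_mul _ e o e', ← Holonomy.diff_mul _ o n e',
            ← Holonomy.diff_mul _ e o e', ← Holonomy.diff_mul _ o n e',
            ← Holonomy.diff_inv _ n o, ← Holonomy.diff_inv _ n o, hno, hneg n e' hn h',
            hpos e o h ho]
        · exact hpos e e' h h'
      obtain ⟨q, hq⟩ := K.exists_upper_lift p hp
      rw [Holonomy.apply_eq_diff_of_lift c K.upperCover p ⟨q, rfl, rfl⟩ hq,
        Holonomy.apply_eq_diff_of_lift c' K.upperCover p ⟨q, rfl, rfl⟩ hq]
      refine hall _ _ (K.upperCover_mem_lower.1 ?_) (K.upperCover_mem_lower.1 ?_)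
      · exact (hq 0).symm.trans p.source ▸ ha
      · exact (hq 1).symm.trans p.target ▸ hb

/-- A holonomy on the complement of the core is determined by its restriction to the bottom and its
value on the meridian. -/
theorem holonomy_bottom_unique [T2Space F] (c c' : Holonomy K.space G)
    (hF : ∀ {a b : F} (p : Path a b), c.comap K.bottom p = c'.comap K.bottom p)
    (hm : ∀ (v : Path (K.bottom (K.toFun (1, 0))) (K.meridian r s hr hs hs' 0)),
      (∀ t, (v t).1 = (K.toFun (1, 0), t * (1 / 2 - s))) →
      (c v)⁻¹ * (c.comap (K.meridian r s hr hs hs')).diff 0 (2 * Real.pi) * c v =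
      (c' v)⁻¹ * (c'.comap (K.meridian r s hr hs hs')).diff 0 (2 * Real.pi) * c' v)
    {a b : F} (p : Path (K.bottom a) (K.bottom b)) : c p = c' p := by
  classical
  -- This gauge makes `c` trivial on vertical paths and equals `1` on the bottom. The value on the
  -- wall is arbitrary, since only paths with both ends in `K.lower` are compared.
  let u : Holonomy K.space G → K.space → G := fun c y => if hy : y ∈ K.lower then
    (c (K.vert y hy))⁻¹ else 1
  have hvb : ∀ (c : Holonomy K.space G) x hx, c (K.vert (K.bottom x) hx) = 1 := fun c x hx => by
    rw [← c.map_refl (a := K.bottom x)]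
    exact c.map_eq_of_eq fun t => Subtype.ext (Prod.ext rfl (mul_zero _))
  have hu : ∀ (c : Holonomy K.space G) x, u c (K.bottom x) = 1 := fun c x => by
    simp only [u, dif_pos (K.bottom_mem_lower x), hvb, inv_one]
  have hgb : ∀ (c : Holonomy K.space G) {a b : F} (p : Path (K.bottom a) (K.bottom b)),
      c.gauge (u c) p = c p := fun c a b p => by simp [Holonomy.gauge_apply, hu]
  have hgn : ∀ (c : Holonomy K.space G) y hy, c.gauge (u c) (K.vert y hy) = 1 := fun c y hy => by
    rw [Holonomy.gauge_apply, hu]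
    simp [u, dif_pos hy]
  rw [← hgb c, ← hgb c']
  have h0 := K.meridian_zero_mem_lower hr hs hs'
  let v := (K.vert _ h0).cast (show K.bottom (K.toFun (1, 0)) = _ by simp [meridian, proj]) rfl
  have hv := hm v fun t => Prod.ext (by
    change K.toFun (1, -(r * Real.sin 0)) = _
    simp) (by
    change (t : ℝ) * (1 / 2 - s * Real.cos 0) = _
    simp)
  have hgm : ∀ c : Holonomy K.space G,
      ((c.gauge (u c)).comap (K.meridian r s hr hs hs')).diff 0 (2 * Real.pi) =
      (c v)⁻¹ * (c.comap (K.meridian r s hr hs hs')).diff 0 (2 * Real.pi) * c v := fun c => by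
    have h2 : K.meridian r s hr hs hs' (2 * Real.pi) = K.meridian r s hr hs hs' 0 := by
      simp [meridian]
    rw [Holonomy.diff_comap_gauge, h2]
    simp only [u, dif_pos h0, inv_inv, v, Holonomy.map_cast]
  exact K.holonomy_eq_of_normalized hr hs hs' _ _ (hgn c) (hgn c')
    (fun p => by
      rw [Holonomy.comap_apply, Holonomy.comap_apply, hgb, hgb]
      exact hF p)
    (by rw [hgm, hgm, hv]) (K.bottom_mem_lower a) (K.bottom_mem_lower b) p

end Unique

end Collar

/-! ### Existence of the holonomy with given bottom and meridian -/

namespace Holonomy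

variable {Y : Type*} [TopologicalSpace Y] {G : Type*} [Group G]

/-- On a simply connected set a holonomy has a primitive. -/
theorem exists_primitive (c : Holonomy Y G) (B : Set Y) [SimplyConnectedSpace B] :
    ∃ prim : Y → G, ∀ {a b : Y} (p : Path a b), range p ⊆ B → c p = (prim b)⁻¹ * prim a := by
  classical
  let ι : C(B, Y) := ⟨Subtype.val, by fun_prop⟩
  let o : B := Classical.arbitrary B
  refine ⟨fun y => if h : y ∈ B then (c.comap ι).diff ⟨y, h⟩ o else 1, fun {a b} p hp => ?_⟩
  have hmem : ∀ t, p t ∈ B := fun t => hp ⟨t, rfl⟩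
  have ha : a ∈ B := by simpa using hmem 0
  have hb : b ∈ B := by simpa using hmem 1
  simp only [dif_pos ha, dif_pos hb]
  rw [diff_inv, diff_mul]
  exact apply_eq_diff_of_lift c ι p ⟨⟨fun t => ⟨p t, hmem t⟩, by fun_prop⟩, by simp, by simp⟩
    fun t => rfl

end Holonomy

namespace Collar

variable {F : Type*} [TopologicalSpace F] (K : Collar F) {G : Type*} [Group G]

/-- The core of the collar, as a loop. -/
noncomputable def coreLoop : Path (K.toFun (1, 0)) (K.toFun (1, 0)) where
  toFun t := K.toFun (Circle.exp (2 * Real.pi * t), 0)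
  continuous_toFun := by have := K.continuous_toFun; fun_prop
  source' := by simp
  target' := by simp

theorem diff_cover_coreLoop (c : Holonomy F G) :
    (c.comap K.cover).diff (0, 0) (2 * Real.pi, 0) = c K.coreLoop :=
  (Holonomy.apply_eq_diff_of_lift c K.cover _
    (⟨⟨fun t => (2 * Real.pi * t, 0), by fun_prop⟩, by simp, by simp⟩) fun t => rfl).symm

/-- The parallel transport of `m` over the universal cover of the collar. -/
noncomputable def transport (c : Holonomy F G) (m : G) (e : ℝ × ℝ) : G :=
  (c.comap K.cover).diff (0, 0) e * m * ((c.comap K.cover).diff (0, 0) e)⁻¹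

/-- Going once around the collar conjugates `m` by the value on the core. This is where the
commutation hypothesis enters. -/
theorem transport_periodic (c : Holonomy F G) (m : G) (hm : Commute m (c K.coreLoop)) (b : ℝ) :
    Function.Periodic (fun α => K.transport c m (α, b)) (2 * Real.pi) := by
  intro α
  have h : (c.comap K.cover).diff (0 + 2 * Real.pi, 0) (α + 2 * Real.pi, b) =
      (c.comap K.cover).diff (0, 0) (α, b) :=
    (Holonomy.diff_eq_of_comp c K.cover K.cover
      ⟨fun e => (e.1 + 2 * Real.pi, e.2), by fun_prop⟩ (fun e => by simp [cover, Circle.exp_add])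
      (0, 0) (α, b)).symm
  rw [zero_add] at h
  simp only [transport]
  rw [← Holonomy.diff_mul _ (0, 0) (2 * Real.pi, 0) (α + 2 * Real.pi, b), h, diff_cover_coreLoop]
  have := hm.eq
  rw [mul_inv_rev, mul_assoc _ (c K.coreLoop) m, ← hm.eq]
  group

/-- There is a `c`-parallel section over the collar whose value on the meridian fibre is `m`. -/
theorem exists_parallel (c : Holonomy F G) (m : G) (hm : Commute m (c K.coreLoop)) :
    ∃ h : Circle × ℝ → G, ∀ α b, h (Circle.exp α, b) = K.transport c m (α, b) := by
  refine ⟨fun e => K.transport c m (Complex.arg e.1, e.2), fun α b => ?_⟩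
  have h1 : Circle.exp (Complex.arg (Circle.exp α)) = Circle.exp α := Circle.exp_arg _
  obtain ⟨n, hn⟩ := Circle.exp_eq_exp.1 h1
  dsimp only
  rw [hn]
  exact (K.transport_periodic c m hm b).int_mul n α

theorem transport_mul (c : Holonomy F G) (m : G) (e e' : ℝ × ℝ) :
    (c.comap K.cover).diff e e' * K.transport c m e =
      K.transport c m e' * (c.comap K.cover).diff e e' := by
  simp only [transport]
  rw [← Holonomy.diff_mul _ (0, 0) e e']
  group

section Exists

variable {r s : ℝ} (hr : 0 < r) (hs : 0 < s) (hs' : s < 1 / 2)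

/-- A holonomy on the surface extends to the complement of the core, with any prescribed value on
the meridian that commutes with the value on the core. -/
theorem holonomy_bottom_exists [T2Space F] [LocallyPathConnectedSpace F]
    (hF : ∀ x : F, ∃ B, IsOpen B ∧ x ∈ B ∧ SimplyConnectedSpace B)
    (c₀ : Holonomy F G) (m : G) (hm : Commute m (c₀ K.coreLoop)) :
    ∃ c : Holonomy K.space G, (∀ {a b : F} (p : Path a b), c.comap K.bottom p = c₀ p) ∧
      (∀ y hy, c (K.vert y hy) = 1) ∧
      (c.comap (K.meridian r s hr hs hs')).diff 0 (2 * Real.pi) = m := by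
  classical
  obtain ⟨h, hh⟩ := K.exists_parallel c₀ m hm
  choose B hBo hB hBs using hF
  have hprim : ∀ x, ∃ prim : F → G, ∀ {a b : F} (p : Path a b), range p ⊆ B x →
      c₀ p = (prim b)⁻¹ * prim a := fun x => by
    have := hBs x
    exact c₀.exists_primitive (B x)
  choose prim hprim using hprim
  -- The upper charts (`true`) are twisted by the parallel section `h` on the positive side of the
  -- wall only. Lower and upper charts then agree on the negative side and differ by `h` on the
  -- positive side, so that crossing the wall contributes `m`. The jump of `u true` at the wall is
  -- harmless: it cancels between two upper charts, and lower charts do not reach the wall.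
  let u : Bool → F → G := fun i x => if i ∧ ∃ e, K.toFun e = x ∧ 0 < e.2 then
    (h (Function.invFun K.toFun x))⁻¹ else 1
  have hinv : ∀ e, Function.invFun K.toFun (K.toFun e) = e :=
    Function.leftInverse_invFun K.injective
  have hu0 : ∀ x, u false x = 1 := fun x => by simp [u]
  have hupos : ∀ e : ℝ × ℝ, 0 < e.2 → u true (K.cover e) = (K.transport c₀ m e)⁻¹ := fun e he => by
    have : true = true ∧ ∃ e', K.toFun e' = K.cover e ∧ 0 < e'.2 := ⟨rfl, _, rfl, he⟩
    simp only [u, if_pos this]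
    rw [← hh, cover, ContinuousMap.coe_mk, hinv]
  have huneg : ∀ e : ℝ × ℝ, e.2 < 0 → u true (K.cover e) = 1 := fun e he => by
    have : ¬ (true = true ∧ ∃ e', K.toFun e' = K.cover e ∧ 0 < e'.2) := by
      rintro ⟨-, e', he', h0⟩
      rw [K.injective he'] at h0
      exact lt_asymm he h0
    simp only [u, if_neg this]
  -- On each side separately `u true` is parallel for `c₀`, which makes the transition functions
  -- between lower and upper charts locally constant.
  have hupar : ∀ {a b : F} (p : Path a b), range p ⊆ K.toFun '' {e | 0 < e.2} ∨
      range p ⊆ K.toFun '' {e | e.2 < 0} → u true b * c₀ p = c₀ p * u true a := by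
    intro a b p hp
    have hp' : range p ⊆ range K.toFun := hp.elim (fun h => h.trans (image_subset_range _ _))
      (fun h => h.trans (image_subset_range _ _))
    obtain ⟨q, hq⟩ := K.exists_lift p hp'
    have ha : a = K.cover (q 0) := by rw [← hq, p.source]
    have hb : b = K.cover (q 1) := by rw [← hq, p.target]
    rw [Holonomy.apply_eq_diff_of_lift c₀ K.cover p (⟨q, rfl, rfl⟩ : Path (q 0) (q 1)) hq]
    rcases hp with hp | hp
    · have hpos : ∀ t, 0 < (q t).2 := fun t => by
        obtain ⟨e, he, het⟩ := hp ⟨t, rfl⟩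
        rw [hq] at het
        rwa [K.injective het] at he
      rw [ha, hb, hupos _ (hpos 0), hupos _ (hpos 1), inv_mul_eq_iff_eq_mul, ← mul_assoc,
        eq_mul_inv_iff_mul_eq, transport_mul]
    · have hneg : ∀ t, (q t).2 < 0 := fun t => by
        obtain ⟨e, he, het⟩ := hp ⟨t, rfl⟩
        rw [hq] at het
        rwa [K.injective het] at he
      rw [ha, hb, huneg _ (hneg 0), huneg _ (hneg 1), one_mul, mul_one]
  let W : Bool → Set K.space := fun i => if i then K.upper else K.lower
  have hWo : ∀ i, IsOpen (W i) := by rintro (_ | _); exacts [K.isOpen_lower, K.isOpen_upper]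
  let V : Bool × F → Set K.space := fun i => W i.1 ∩ K.proj ⁻¹' B i.2
  let sec : Bool × F → K.space → G := fun i y => prim i.2 (K.proj y) * u i.1 (K.proj y)
  have hVo : ∀ i, IsOpen (V i) := fun i => (hWo _).inter ((hBo _).preimage K.proj.continuous)
  -- it suffices to compare the two kinds of charts along short paths
  have hloc : ∀ i j y, y ∈ V i → y ∈ V j → ∃ U ∈ 𝓝 (K.proj y), ∀ x ∈ U,
      ∀ p : Path (K.proj y) x, range p ⊆ U →
        (u i.1 x * (u j.1 x)⁻¹) * c₀ p = c₀ p * (u i.1 (K.proj y) * (u j.1 (K.proj y))⁻¹) := by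
    have aux : ∀ y, y ∈ K.upper → y ∈ K.lower → ∃ U ∈ 𝓝 (K.proj y), ∀ x ∈ U,
      ∀ p : Path (K.proj y) x, range p ⊆ U →
        u true x * c₀ p = c₀ p * u true (K.proj y) := by
      intro y hy hy'
      obtain ⟨⟨e, he⟩, ht⟩ := hy
      have he0 : e.2 ≠ 0 := fun h0 => by
        refine lt_asymm ht (hy' ?_)
        rw [← he]
        exact K.mem_core_iff.2 h0
      rcases lt_or_gt_of_ne he0 with h0 | h0
      · refine ⟨K.toFun '' {e | e.2 < 0}, ?_, fun x _ p hp => hupar p (.inr hp)⟩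
        exact (K.isOpenEmbedding.isOpenMap _ (isOpen_lt continuous_snd continuous_const)).mem_nhds
          ⟨e, h0, he⟩
      · refine ⟨K.toFun '' {e | 0 < e.2}, ?_, fun x _ p hp => hupar p (.inl hp)⟩
        exact (K.isOpenEmbedding.isOpenMap _ (isOpen_lt continuous_const continuous_snd)).mem_nhds
          ⟨e, h0, he⟩
    rintro ⟨_ | _, x⟩ ⟨_ | _, x'⟩ y hy hy'
    · exact ⟨univ, Filter.univ_mem, fun _ _ p _ => by simp [hu0]⟩
    · obtain ⟨U, hU, hUp⟩ := aux y hy'.1 hy.1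
      refine ⟨U, hU, fun x hx p hp => ?_⟩
      simp only [hu0, one_mul]
      rw [inv_mul_eq_iff_eq_mul, ← mul_assoc, eq_mul_inv_iff_mul_eq, hUp x hx p hp]
    · obtain ⟨U, hU, hUp⟩ := aux y hy.1 hy'.1
      exact ⟨U, hU, fun x hx p hp => by simpa [hu0] using hUp x hx p hp⟩
    · exact ⟨univ, Filter.univ_mem, fun _ _ p _ => by simp⟩
  obtain ⟨c, hc⟩ := Holonomy.exists_of_local_sections (V := V) (s := sec) hVo
    (fun y => by
      by_cases hy : y ∈ K.lower
      · exact ⟨(false, K.proj y), hy, hB _⟩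
      · exact ⟨(true, K.proj y), K.mem_upper_of_notMem_lower hy, hB _⟩)
    (fun i j y hi hj => by
      obtain ⟨U, hU, hUp⟩ := hloc i j y hi hj
      obtain ⟨U', hU', hpc, hUU⟩ : ∃ U' ∈ 𝓝 (K.proj y), IsPathConnected U' ∧
          U' ⊆ U ∩ B i.2 ∩ B j.2 := by
        obtain ⟨U', ⟨h1, h2⟩, h3⟩ := (path_connected_basis (K.proj y)).mem_iff.1
          (Filter.inter_mem (Filter.inter_mem hU ((hBo i.2).mem_nhds hi.2))
            ((hBo j.2).mem_nhds hj.2))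
        exact ⟨U', h1, h2, h3⟩
      filter_upwards [K.proj.continuous.continuousAt hU'] with y' hy'
      obtain ⟨p, hp⟩ := hpc.joinedIn _ (mem_of_mem_nhds hU') _ hy'
      have hpr : range p ⊆ U' := by rintro _ ⟨t, rfl⟩; exact hp t
      have e1 := hUp _ (hUU hy').1.1 p (hpr.trans fun z hz => (hUU hz).1.1)
      have e2 := hprim i.2 p (hpr.trans fun z hz => (hUU hz).1.2)
      have e3 := hprim j.2 p (hpr.trans fun z hz => (hUU hz).2)
      have e4 : prim i.2 (K.proj y') = prim i.2 (K.proj y) * (c₀ p)⁻¹ := by rw [e2]; group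
      have e5 : prim j.2 (K.proj y') = prim j.2 (K.proj y) * (c₀ p)⁻¹ := by rw [e3]; group
      have e6 : u i.1 (K.proj y') * (u j.1 (K.proj y'))⁻¹ =
          c₀ p * (u i.1 (K.proj y) * (u j.1 (K.proj y))⁻¹) * (c₀ p)⁻¹ := by
        rw [← e1]; group
      calc sec i y' * (sec j y')⁻¹ = prim i.2 (K.proj y') * (u i.1 (K.proj y') *
            (u j.1 (K.proj y'))⁻¹) * (prim j.2 (K.proj y'))⁻¹ := by simp only [sec]; group
        _ = _ := by rw [e6, e4, e5]; simp only [sec]; group)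
  -- The primitives were auxiliary: on the whole of `W i` the glued holonomy is `c₀` gauged by the
  -- inverse of `u i`.
  have hW : ∀ i {a b : K.space} (p : Path a b), range p ⊆ W i →
      c p = (u i (K.proj b))⁻¹ * c₀ (p.map K.proj.continuous) * u i (K.proj a) := by
    intro i a b p hp
    have := Holonomy.eq_of_local_path c ((c₀.comap K.proj).gauge fun y => (u i (K.proj y))⁻¹) p
      fun t => ⟨V (i, K.proj (p t)), hVo _, ⟨hp ⟨t, rfl⟩, hB _⟩, fun {x y} r hr => by
        rw [hc _ r hr, Holonomy.gauge_apply, Holonomy.comap_apply,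
          hprim (K.proj (p t)) (r.map K.proj.continuous)
            (by rintro _ ⟨s, rfl⟩; exact (hr ⟨s, rfl⟩).2)]
        simp only [sec]
        group⟩
    rw [this, Holonomy.gauge_apply, Holonomy.comap_apply, inv_inv]
  have hlow : ∀ {a b : K.space} (p : Path a b), range p ⊆ K.lower →
      c p = c₀ (p.map K.proj.continuous) := fun p hp => by simpa [hu0] using hW false p hp
  refine ⟨c, fun p => ?_, fun y hy => ?_, ?_⟩
  · rw [Holonomy.comap_apply, hlow _ (by rintro _ ⟨t, rfl⟩; exact K.bottom_mem_lower _)]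
    exact c₀.map_eq_of_eq fun t => rfl
  · rw [hlow _ (by rintro _ ⟨t, rfl⟩; exact K.vert_mem_lower _ _ _)]
    rw [← c₀.map_refl (a := K.proj y)]
    exact c₀.map_eq_of_eq fun t => rfl
  · obtain ⟨p₁, p₂, h₁, h₂⟩ := K.meridian_paths hr hs hs'
    obtain ⟨e, e', he, he', hα, hα', hcross⟩ := K.meridian_crossing hr hs hs' G
    have hpm : ∀ a b (p : Path a b), c₀ ((p.map (K.meridian r s hr hs hs').continuous).map
        K.proj.continuous) = (c₀.comap K.cover).diff (0, -(r * Real.sin a)) (0, -(r * Real.sin b)) :=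
      fun a b p => Holonomy.apply_eq_diff_of_lift c₀ K.cover _
        (p.map (f := fun θ : ℝ => ((0 : ℝ), -(r * Real.sin θ))) (by fun_prop)) fun t => by
          change K.toFun (1, _) = K.toFun (Circle.exp 0, _)
          rw [Circle.exp_zero]; rfl
    have hup : ∀ e e' : upperCoverSet, e.1.2.1 < 0 → 0 < e'.1.2.1 →
        (c.comap K.upperCover).diff e e' = K.transport c₀ m (e'.1.1, e'.1.2.1) *
          (c₀.comap K.cover).diff (e.1.1, e.1.2.1) (e'.1.1, e'.1.2.1) := by
      intro e e' he he'
      let p : Path e e' := PathConnectedSpace.somePath e e'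
      rw [← Holonomy.apply_eq_diff _ p, Holonomy.comap_apply, hW true _ (by
        rintro _ ⟨t, rfl⟩; exact ⟨⟨_, rfl⟩, (p t).2.1⟩)]
      have e1 : u true (K.proj (K.upperCover e)) = 1 := huneg (e.1.1, e.1.2.1) he
      have e2 : u true (K.proj (K.upperCover e')) = _ := hupos (e'.1.1, e'.1.2.1) he'
      rw [e1, e2, inv_inv, mul_one]
      congr 1
      exact Holonomy.apply_eq_diff_of_lift c₀ K.cover _
        (p.map (f := fun e : upperCoverSet => (e.1.1, e.1.2.1)) (by fun_prop)) fun t => rfl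
    have hlm : ∀ {a b : ℝ} (p : Path a b), (∀ t, K.meridian r s hr hs hs' (p t) ∈ K.lower) →
        (c.comap (K.meridian r s hr hs hs')).diff a b =
          (c₀.comap K.cover).diff (0, -(r * Real.sin a)) (0, -(r * Real.sin b)) := fun p hp => by
      rw [← Holonomy.apply_eq_diff _ p, Holonomy.comap_apply, hlow _ (by
        rintro _ ⟨t, rfl⟩; exact hp t), hpm]
    rw [← Holonomy.diff_mul _ 0 (Real.pi - 1) (2 * Real.pi),
      ← Holonomy.diff_mul _ (Real.pi - 1) (Real.pi + 1) (2 * Real.pi),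
      hlm p₁ h₁, hlm p₂ h₂, hcross, hup e e' he he']
    rw [hα, hα']
    simp only [transport, Real.sin_zero, Real.sin_two_pi, mul_zero, neg_zero]
    rw [← Holonomy.diff_inv _ (0, 0) (0, -(r * Real.sin (Real.pi + 1))),
      ← Holonomy.diff_mul _ (0, -(r * Real.sin (Real.pi - 1))) (0, 0)
        (0, -(r * Real.sin (Real.pi + 1))),
      ← Holonomy.diff_inv _ (0, 0) (0, -(r * Real.sin (Real.pi - 1)))]
    group

end Exists

end Collar

/-! ### The torus around the core, and the two ends -/

namespace Collar

variable {F : Type u} [TopologicalSpace F] (K : Collar F)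

section Ends

variable {r s : ℝ} (hr : 0 < r) (hs : 0 < s) (hs' : s < 1 / 2)

/-- The universal cover of the standard torus around the core. -/
noncomputable def torus (r s : ℝ) (hr : 0 < r) (hs : 0 < s) (hs' : s < 1 / 2) :
    C(ℝ × ℝ, K.space) where
  toFun e := ⟨(K.toFun (Circle.exp e.1, -(r * Real.sin e.2)), 1 / 2 - s * Real.cos e.2),
    (K.meridian r s hr hs hs' e.2).2.1, fun h => (K.meridian r s hr hs hs' e.2).2.2
      ⟨K.mem_core_iff.2 ((K.mem_core_iff (e := (Circle.exp e.1, -(r * Real.sin e.2)))).1 h.1),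
        h.2⟩⟩
  continuous_toFun := by have := K.continuous_toFun; fun_prop

theorem meridian_eq_torus (θ : ℝ) :
    K.meridian r s hr hs hs' θ = K.torus r s hr hs hs' (0, θ) := by
  refine Subtype.ext (Prod.ext ?_ rfl)
  change _ = K.toFun (Circle.exp 0, _)
  rw [Circle.exp_zero]
  rfl

theorem reflect_torus (e : ℝ × ℝ) : K.reflect (K.torus r s hr hs hs' e) =
    K.torus r s hr hs hs' (e.1, Real.pi - e.2) := by
  refine Subtype.ext (Prod.ext ?_ ?_)
  · simp [reflect, torus]
  · simp [reflect, torus]; ring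

variable {G : Type*} [Group G]

theorem diff_torus_add (c : Holonomy K.space G) (e e' : ℝ × ℝ) :
    (c.comap (K.torus r s hr hs hs')).diff (e.1 + 2 * Real.pi, e.2) (e'.1 + 2 * Real.pi, e'.2) =
      (c.comap (K.torus r s hr hs hs')).diff e e' :=
  (Holonomy.diff_eq_of_comp c (K.torus r s hr hs hs') (K.torus r s hr hs hs')
    ⟨fun e => (e.1 + 2 * Real.pi, e.2), by fun_prop⟩
    (fun e => by simp [torus, Circle.exp_add]) e e').symm

theorem diff_meridian_add (c : Holonomy K.space G) (a b : ℝ) :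
    (c.comap (K.meridian r s hr hs hs')).diff (a + 2 * Real.pi) (b + 2 * Real.pi) =
      (c.comap (K.meridian r s hr hs hs')).diff a b :=
  (Holonomy.diff_eq_of_comp c (K.meridian r s hr hs hs') (K.meridian r s hr hs hs')
    ⟨fun e => e + 2 * Real.pi, by fun_prop⟩
    (fun e => by simp [meridian]) a b).symm

theorem diff_meridian (c : Holonomy K.space G) (a b : ℝ) :
    (c.comap (K.meridian r s hr hs hs')).diff a b =
      (c.comap (K.torus r s hr hs hs')).diff (0, a) (0, b) :=
  Holonomy.diff_eq_of_comp c (K.torus r s hr hs hs') (K.meridian r s hr hs hs')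
    ⟨fun e => (0, e), by fun_prop⟩ (fun e => K.meridian_eq_torus _ _ _ e) a b

/-- The longitudes of the torus are conjugate along the meridian. -/
theorem diff_torus_longitude (c : Holonomy K.space G) (a b : ℝ) :
    (c.comap (K.torus r s hr hs hs')).diff (0, a) (2 * Real.pi, a) =
      ((c.comap (K.meridian r s hr hs hs')).diff a b)⁻¹ *
      (c.comap (K.torus r s hr hs hs')).diff (0, b) (2 * Real.pi, b) *
      (c.comap (K.meridian r s hr hs hs')).diff a b := by
  have h := K.diff_torus_add hr hs hs' c (0, a) (0, b)
  rw [← diff_meridian] at h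
  simp only [zero_add] at h
  rw [← h, Holonomy.diff_inv]
  rw [h, diff_meridian, mul_assoc, Holonomy.diff_mul, Holonomy.diff_mul]

/-- The uniqueness and existence results base the meridian below the core (angle `0`), the framing
of the tube requires a base point above it (angle `π`). The half turn between them conjugates one
into the other. -/
theorem diff_meridian_pi (c : Holonomy K.space G) :
    (c.comap (K.meridian r s hr hs hs')).diff Real.pi (3 * Real.pi) =
      (c.comap (K.meridian r s hr hs hs')).diff 0 Real.pi *
      (c.comap (K.meridian r s hr hs hs')).diff 0 (2 * Real.pi) *
      ((c.comap (K.meridian r s hr hs hs')).diff 0 Real.pi)⁻¹ := by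
  have h := K.diff_meridian_add hr hs hs' c 0 Real.pi
  rw [Holonomy.diff_inv]
  conv_rhs => rw [← h]
  rw [show Real.pi + 2 * Real.pi = 3 * Real.pi by ring, zero_add, Holonomy.diff_mul,
    Holonomy.diff_mul]

/-- The vertical path from the bottom to the meridian. -/
noncomputable def vertMeridian : Path (K.bottom (K.toFun (1, 0))) (K.meridian r s hr hs hs' 0) :=
  (K.vert _ (K.meridian_zero_mem_lower hr hs hs')).cast (by simp [meridian, proj]) rfl

theorem vertMeridian_apply (t : I) : (K.vertMeridian hr hs hs' t).1 =
    (K.toFun (1, 0), t * (1 / 2 - s)) := by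
  refine Prod.ext ?_ ?_
  · change K.toFun (1, -(r * Real.sin 0)) = _
    simp
  · change (t : ℝ) * (1 / 2 - s * Real.cos 0) = _
    simp

/-- The longitude of the torus below the core is homotopic to the core curve in the bottom. -/
theorem diff_torus_bottom (c : Holonomy K.space G) :
    (c.comap (K.torus r s hr hs hs')).diff (0, 0) (2 * Real.pi, 0) =
      c (K.vertMeridian hr hs hs') * c.comap K.bottom K.coreLoop *
        (c (K.vertMeridian hr hs hs'))⁻¹ := by
  -- The unrolled vertical annulus between the core curve in the bottom and the lowest longitude of
  -- the torus.
  let f : C(ℝ × I, K.space) := ⟨fun e => ⟨(K.toFun (Circle.exp e.1, 0), e.2 * (1 / 2 - s)), by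
    have h1 := e.2.2.1
    have h2 := e.2.2.2
    exact ⟨⟨by nlinarith, by nlinarith⟩, fun h => by have := h.2; dsimp only at this; nlinarith⟩⟩,
    by have := K.continuous_toFun; fun_prop⟩
  have hv : ∀ α : ℝ, Circle.exp α = 1 →
      c (K.vertMeridian hr hs hs') = (c.comap f).diff (α, 0) (α, 1) := fun α hα =>
    Holonomy.apply_eq_diff_of_lift c f _ ((Path.refl α).prod Path.id) fun t =>
      Subtype.ext ((K.vertMeridian_apply hr hs hs' t).trans (by
        change _ = (K.toFun (Circle.exp α, 0), (t : ℝ) * (1 / 2 - s))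
        rw [hα]))
  have h1 : (c.comap (K.torus r s hr hs hs')).diff (0, 0) (2 * Real.pi, 0) =
      (c.comap f).diff (0, 1) (2 * Real.pi, 1) := by
    let p : Path (0 : ℝ) (2 * Real.pi) := PathConnectedSpace.somePath _ _
    rw [← Holonomy.apply_eq_diff _ (p.prod (Path.refl 0))]
    exact Holonomy.apply_eq_diff_of_lift c f _ (p.prod (Path.refl 1)) fun t =>
      Subtype.ext (Prod.ext (by
        change K.toFun (Circle.exp (p t), -(r * Real.sin 0)) = K.toFun (Circle.exp (p t), 0)
        simp) (by
        change 1 / 2 - s * Real.cos 0 = ((1 : I) : ℝ) * (1 / 2 - s)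
        simp))
  have h2 : c.comap K.bottom K.coreLoop = (c.comap f).diff (0, 0) (2 * Real.pi, 0) :=
    Holonomy.apply_eq_diff_of_lift c f _
      ((⟨⟨fun t => 2 * Real.pi * t, by fun_prop⟩, by simp, by simp⟩ :
        Path (0 : ℝ) (2 * Real.pi)).prod (Path.refl 0)) fun t =>
      Subtype.ext (Prod.ext rfl (by
        change (0 : ℝ) = ((0 : I) : ℝ) * (1 / 2 - s)
        simp))
  rw [h1, h2]
  conv_rhs => rw [hv 0 Circle.exp_zero]
  have e0 : c (K.vertMeridian hr hs hs') = (c.comap f).diff (0, 0) (0, 1) := hv 0 Circle.exp_zero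
  have e1 := hv (2 * Real.pi) Circle.exp_two_pi
  rw [Holonomy.diff_inv, ← e0, e1, Holonomy.diff_mul, Holonomy.diff_mul]

/-- The properties of the end `e` of the complement of the core that describe its fundamental
group in terms of that of the end and a meridian. -/
def IsEnd (e : C(F, K.space)) : Prop :=
  ∃ δ : Path (K.meridian r s hr hs hs' Real.pi) (e (K.toFun (1, 0))),
    (∀ (G : Type u) [Group G] (c : Holonomy K.space G),
      c δ * (c.comap (K.torus r s hr hs hs')).diff (0, Real.pi) (2 * Real.pi, Real.pi) * (c δ)⁻¹ =
        c.comap e K.coreLoop) ∧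
    (∀ (G : Type u) [Group G] (c c' : Holonomy K.space G),
      (∀ {a b : F} (p : Path a b), c.comap e p = c'.comap e p) →
      c δ * (c.comap (K.meridian r s hr hs hs')).diff Real.pi (3 * Real.pi) * (c δ)⁻¹ =
        c' δ * (c'.comap (K.meridian r s hr hs hs')).diff Real.pi (3 * Real.pi) * (c' δ)⁻¹ →
      ∀ {a b : F} (p : Path (e a) (e b)), c p = c' p) ∧
    (∀ (G : Type u) [Group G] (c₀ : Holonomy F G) (m : G), Commute m (c₀ K.coreLoop) →
      ∃ c : Holonomy K.space G, (∀ {a b : F} (p : Path a b), c.comap e p = c₀ p) ∧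
        c δ * (c.comap (K.meridian r s hr hs hs')).diff Real.pi (3 * Real.pi) * (c δ)⁻¹ = m)

variable [T2Space F] [LocallyPathConnectedSpace F]
  (hF : ∀ x : F, ∃ B, IsOpen B ∧ x ∈ B ∧ SimplyConnectedSpace B)
include hF

/-- The path `δ` runs from the highest point of the meridian along half of it to the lowest point,
then vertically down. -/
theorem isEnd_bottom : K.IsEnd hr hs hs' K.bottom := by
  let p : Path Real.pi 0 := PathConnectedSpace.somePath _ _
  let δ := (p.map (K.meridian r s hr hs hs').continuous).trans (K.vertMeridian hr hs hs').symm
  have hδ : ∀ (G : Type u) [Group G] (c : Holonomy K.space G), c δ =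
      (c (K.vertMeridian hr hs hs'))⁻¹ *
        ((c.comap (K.meridian r s hr hs hs')).diff 0 Real.pi)⁻¹ := fun G _ c => by
    rw [Holonomy.map_trans, Holonomy.map_symm, Holonomy.diff_inv,
      ← Holonomy.apply_eq_diff (c.comap (K.meridian r s hr hs hs')) p]
    rfl
  have hm : ∀ (G : Type u) [Group G] (c : Holonomy K.space G),
      c δ * (c.comap (K.meridian r s hr hs hs')).diff Real.pi (3 * Real.pi) * (c δ)⁻¹ =
      (c (K.vertMeridian hr hs hs'))⁻¹ * (c.comap (K.meridian r s hr hs hs')).diff 0 (2 * Real.pi) *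
        c (K.vertMeridian hr hs hs') := fun G _ c => by
    rw [diff_meridian_pi, hδ]
    group
  refine ⟨δ, fun G _ c => ?_, fun G _ c c' h hmm => ?_, fun G _ c₀ m hc => ?_⟩
  · rw [hδ, K.diff_torus_longitude hr hs hs' c Real.pi 0, diff_torus_bottom,
      ← Holonomy.diff_inv _ 0 Real.pi]
    group
  · rw [hm, hm] at hmm
    refine K.holonomy_bottom_unique hr hs hs' c c' h fun v hv => ?_
    have : ∀ c : Holonomy K.space G, c v = c (K.vertMeridian hr hs hs') := fun c =>
      c.map_eq_of_eq fun t => Subtype.ext ((hv t).trans (K.vertMeridian_apply hr hs hs' t).symm)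
    rw [this, this, hmm]
  · obtain ⟨c, h1, h2, h3⟩ := K.holonomy_bottom_exists hr hs hs' hF c₀ m hc
    refine ⟨c, h1, ?_⟩
    rw [hm, h3, vertMeridian, Holonomy.map_cast, h2]
    simp

/-- The reflection exchanges the ends and acts on the ellipse as `θ ↦ π - θ`, so it inverts the
meridian; everything is reduced to the bottom with `m⁻¹` in place of `m`. -/
theorem isEnd_top : K.IsEnd hr hs hs' K.top := by
  have hM : ∀ (G : Type u) [Group G] (c : Holonomy K.space G),
      (c.comap (K.meridian r s hr hs hs')).diff Real.pi (3 * Real.pi) =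
      (((c.comap K.reflect).comap (K.meridian r s hr hs hs')).diff 0 (2 * Real.pi))⁻¹ := by
    intro G _ c
    have h1 : ((c.comap K.reflect).comap (K.meridian r s hr hs hs')).diff 0 (2 * Real.pi) =
        (c.comap (K.meridian r s hr hs hs')).diff (Real.pi - 0) (Real.pi - 2 * Real.pi) :=
      Holonomy.diff_eq_of_comp c (K.meridian r s hr hs hs')
        (K.reflect.comp (K.meridian r s hr hs hs')) ⟨fun θ => Real.pi - θ, by fun_prop⟩
        (fun θ => K.reflect_meridian hr hs hs' θ) 0 (2 * Real.pi)
    have h2 := K.diff_meridian_add hr hs hs' c (-Real.pi) Real.pi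
    rw [show -Real.pi + 2 * Real.pi = Real.pi by ring,
      show Real.pi + 2 * Real.pi = 3 * Real.pi by ring] at h2
    rw [h1, Holonomy.diff_inv, h2, sub_zero, show Real.pi - 2 * Real.pi = -Real.pi by ring]
  have h0 : K.meridian r s hr hs hs' Real.pi = K.reflect (K.meridian r s hr hs hs' 0) := by
    rw [reflect_meridian, sub_zero]
  let δ : Path (K.meridian r s hr hs hs' Real.pi) (K.top (K.toFun (1, 0))) :=
    ((K.vertMeridian hr hs hs').symm.map K.reflect.continuous).cast h0 rfl
  have hδ : ∀ (G : Type u) [Group G] (c : Holonomy K.space G), c δ =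
      (c.comap K.reflect (K.vertMeridian hr hs hs'))⁻¹ := fun G _ c => by
    rw [← Holonomy.map_symm, Holonomy.comap_apply]
    exact c.map_eq_of_eq fun _ => rfl
  refine ⟨δ, fun G _ c => ?_, fun G _ c c' h hmm a b p => ?_, fun G _ c₀ m hc => ?_⟩
  · have h1 : (c.comap (K.torus r s hr hs hs')).diff (0, Real.pi) (2 * Real.pi, Real.pi) =
        ((c.comap K.reflect).comap (K.torus r s hr hs hs')).diff (0, 0) (2 * Real.pi, 0) := by
      have := Holonomy.diff_eq_of_comp c (K.torus r s hr hs hs')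
        (K.reflect.comp (K.torus r s hr hs hs')) ⟨fun e => (e.1, Real.pi - e.2), by fun_prop⟩
        (fun θ => K.reflect_torus hr hs hs' θ) (0, 0) (2 * Real.pi, 0)
      refine (this.trans ?_).symm
      simp
    rw [h1, diff_torus_bottom, hδ]
    have : (c.comap K.reflect).comap K.bottom K.coreLoop = c.comap K.top K.coreLoop := rfl
    rw [this]
    group
  · rw [hM, hM, hδ, hδ] at hmm
    have key := K.holonomy_bottom_unique hr hs hs' (c.comap K.reflect) (c'.comap K.reflect)
      (fun p => h p) (fun v hv => by
        have : ∀ c : Holonomy K.space G, c v = c (K.vertMeridian hr hs hs') := fun c =>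
          c.map_eq_of_eq fun t =>
            Subtype.ext ((hv t).trans (K.vertMeridian_apply hr hs hs' t).symm)
        rw [this, this]
        simpa only [mul_inv_rev, inv_inv, mul_assoc] using congrArg (·⁻¹) hmm)
      ((p.map K.reflect.continuous).cast (K.reflect_reflect _).symm (K.reflect_reflect _).symm)
    have e : ∀ c : Holonomy K.space G, c.comap K.reflect ((p.map K.reflect.continuous).cast
        (K.reflect_reflect _).symm (K.reflect_reflect _).symm) = c p := fun c =>
      c.map_eq_of_eq fun t => K.reflect_reflect _
    rwa [e, e] at key
  · obtain ⟨c, h1, h2, h3⟩ := K.holonomy_bottom_exists hr hs hs' hF c₀ m⁻¹ hc.inv_left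
    have hrr : (K.reflect.comp K.reflect) = ContinuousMap.id _ :=
      ContinuousMap.ext fun y => K.reflect_reflect y
    have hcc : ∀ {a b : K.space} (p : Path a b), (c.comap K.reflect).comap K.reflect p = c p :=
      fun p => c.map_eq_of_eq fun t => K.reflect_reflect _
    refine ⟨c.comap K.reflect, fun p => ?_, ?_⟩
    · rw [← h1]
      exact c.map_eq_of_eq fun t => K.reflect_reflect _
    · have e1 : (((c.comap K.reflect).comap K.reflect).comap
          (K.meridian r s hr hs hs')).diff 0 (2 * Real.pi) = m⁻¹ := by
        rw [← h3]; exact hcc _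
      rw [hM, e1, hδ, hcc, vertMeridian, Holonomy.map_cast, h2]
      simp

end Ends

end Collar

theorem contMDiff_circle_coe : ContMDiff (𝓡 1) 𝓘(ℝ, ℂ) ∞ (fun z : Circle => (z : ℂ)) := by
  have := finrank_real_complex_fact'
  exact contMDiff_coe_sphere (E := ℂ) (n := 1)

/-! ### The tube in charts of the surface -/

namespace PushedInTube

variable {F : Type*} [TopologicalSpace F] [ChartedSpace (EuclideanSpace ℝ (Fin 2)) F]
  {C : Circle → F} (N : PushedInTube C)

theorem continuous_toFun : Continuous N.toFun := N.isLocalDiffeomorph.contMDiff.continuous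

theorem isOpenEmbedding : IsOpenEmbedding N.toFun :=
  .of_continuous_injective_isOpenMap N.continuous_toFun N.injective
    N.isLocalDiffeomorph.isLocalHomeomorph.isOpenMap

include N in
theorem core_injective : Function.Injective C := fun z z' h => by
  have := N.injective ((N.core z).trans ((congrArg (·, 1 / 2) h).trans (N.core z').symm))
  exact congrArg Prod.fst this

include N in
theorem core_continuous : Continuous C := by
  have h : C = fun z => (N.toFun (z, 0)).1 := funext fun z => by rw [N.core]
  rw [h]
  have := N.continuous_toFun
  fun_prop

/-- The tube, unrolled along the curve. -/
noncomputable def unroll : C(ℝ × ℂ, F × ℝ) where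
  toFun e := N.toFun (Circle.exp e.1, e.2)
  continuous_toFun := by have := N.continuous_toFun; fun_prop

theorem unroll_apply (a : ℝ) (w : ℂ) : N.unroll (a, w) = N.toFun (Circle.exp a, w) := rfl

theorem contMDiff_unroll :
    ContMDiff 𝓘(ℝ, ℝ × ℂ) ((𝓡 2).prod 𝓘(ℝ, ℝ)) ∞ N.unroll := by
  have h1 : ContMDiff 𝓘(ℝ, ℝ × ℂ) (𝓡 1) ∞ fun e : ℝ × ℂ => Circle.exp e.1 :=
    contMDiff_circleExp.comp contDiff_fst.contMDiff
  have h2 : ContMDiff 𝓘(ℝ, ℝ × ℂ) 𝓘(ℝ, ℂ) ∞ fun e : ℝ × ℂ => e.2 := contDiff_snd.contMDiff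
  exact N.isLocalDiffeomorph.contMDiff.comp (h1.prodMk h2)

/-- The height of a point of the unrolled tube. -/
noncomputable def height (e : ℝ × ℂ) : ℝ := (N.unroll e).2

theorem contDiff_height : ContDiff ℝ ∞ N.height :=
  (contMDiff_snd.comp N.contMDiff_unroll).contDiff

theorem height_core (a : ℝ) : N.height (a, 0) = 1 / 2 := by
  rw [height, unroll_apply, N.core]

/-- The unrolled tube, in a chart of the surface around the point `C (exp a)`. -/
noncomputable def inChart (a : ℝ) (e : ℝ × ℂ) : EuclideanSpace ℝ (Fin 2) × ℝ :=
  (chartAt (EuclideanSpace ℝ (Fin 2)) (C (Circle.exp a)) (N.unroll e).1, N.height e)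

theorem contDiffAt_inChart (a : ℝ) : ContDiffAt ℝ ∞ (N.inChart a) (a, 0) := by
  have h1 : ContMDiffAt 𝓘(ℝ, ℝ × ℂ) (𝓡 2) ∞ (fun e => (N.unroll e).1) (a, 0) :=
    (contMDiff_fst.comp N.contMDiff_unroll).contMDiffAt
  have h2 : ContMDiffAt (𝓡 2) (𝓡 2) ∞ (extChartAt (𝓡 2) (C (Circle.exp a)))
    (N.unroll (a, 0)).1 := by
    rw [unroll_apply, N.core]
    exact contMDiffAt_extChartAt
  have h3 := (ContMDiffAt.comp (a, (0 : ℂ)) h2 h1).contDiffAt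
  exact h3.prodMk N.contDiff_height.contDiffAt

/-- A local inverse of the tube, read in the chart, is a differentiable left inverse up to
`Circle.exp`, whose derivative does not vanish. -/
theorem injective_fderiv_inChart [IsManifold (𝓡 2) ∞ F] (a : ℝ) :
    Function.Injective (fderiv ℝ (N.inChart a) (a, 0)) := by
  obtain ⟨Φ, hΦ, hΦN⟩ := N.isLocalDiffeomorph (Circle.exp a, 0)
  let ψ := extChartAt (𝓡 2) (C (Circle.exp a))
  have hψ : ∀ x, ψ x = chartAt (EuclideanSpace ℝ (Fin 2)) (C (Circle.exp a)) x := fun _ => rfl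
  have hΦa : Φ.toFun (Circle.exp a, 0) = (C (Circle.exp a), 1 / 2) := by
    rw [← N.core]; exact (hΦN hΦ).symm
  have hinv : ContMDiffAt ((𝓡 2).prod 𝓘(ℝ, ℝ)) ((𝓡 1).prod 𝓘(ℝ, ℂ)) ∞ Φ.invFun
      (C (Circle.exp a), 1 / 2) := by
    refine (Φ.contMDiffOn_invFun _ ?_).contMDiffAt (Φ.open_target.mem_nhds ?_) <;>
    · rw [← hΦa]; exact Φ.map_source hΦ
  have hval : N.inChart a (a, 0) = (ψ (C (Circle.exp a)), 1 / 2) := by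
    rw [inChart, height_core, unroll_apply, N.core]; rfl
  have hsymm : ContMDiffAt 𝓘(ℝ, EuclideanSpace ℝ (Fin 2) × ℝ) ((𝓡 2).prod 𝓘(ℝ, ℝ)) ∞
      (fun e : EuclideanSpace ℝ (Fin 2) × ℝ => (ψ.symm e.1, e.2)) (N.inChart a (a, 0)) := by
    rw [hval]
    have hψt : ψ.target ∈ 𝓝 (ψ (C (Circle.exp a))) := extChartAt_target_mem_nhds _
    refine ContMDiffAt.prodMk ?_ contDiff_snd.contMDiff.contMDiffAt
    refine ContMDiffAt.comp _ (I' := 𝓡 2) ?_ contDiff_fst.contMDiff.contMDiffAt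
    exact (contMDiffOn_extChartAt_symm _).contMDiffAt hψt
  -- The circle is placed in `ℂ` so that ordinary derivatives and the chain rule apply.
  let J : EuclideanSpace ℝ (Fin 2) × ℝ → ℂ × ℂ := fun e =>
    (((Φ.invFun (ψ.symm e.1, e.2)).1 : ℂ), (Φ.invFun (ψ.symm e.1, e.2)).2)
  have hJ : ContDiffAt ℝ ∞ J (N.inChart a (a, 0)) := by
    have h1 : ContMDiffAt 𝓘(ℝ, EuclideanSpace ℝ (Fin 2) × ℝ) ((𝓡 1).prod 𝓘(ℝ, ℂ)) ∞
        (fun e : EuclideanSpace ℝ (Fin 2) × ℝ => Φ.invFun (ψ.symm e.1, e.2))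
        (N.inChart a (a, 0)) := by
      refine ContMDiffAt.comp _ ?_ hsymm
      rw [hval]
      dsimp only
      rw [extChartAt_to_inv]
      exact hinv
    have h2 : ContMDiffAt 𝓘(ℝ, EuclideanSpace ℝ (Fin 2) × ℝ) 𝓘(ℝ, ℂ) ∞
        (fun e : EuclideanSpace ℝ (Fin 2) × ℝ => ((Φ.invFun (ψ.symm e.1, e.2)).1 : ℂ))
        (N.inChart a (a, 0)) := by
      have h3 := ContMDiffAt.comp (N.inChart a (a, 0)) contMDiffAt_fst h1
      exact ContMDiffAt.comp (I' := 𝓡 1) (N.inChart a (a, 0)) (contMDiff_circle_coe _) h3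
    have h4 := ContMDiffAt.comp (N.inChart a (a, 0)) contMDiffAt_snd h1
    exact h2.contDiffAt.prodMk h4.contDiffAt
  have heq : (J ∘ N.inChart a) =ᶠ[𝓝 (a, 0)] fun e => ((Circle.exp e.1 : ℂ), e.2) := by
    have hs : ∀ᶠ e in 𝓝 ((a, 0) : ℝ × ℂ), (N.unroll e).1 ∈ ψ.source := by
      refine ContinuousAt.preimage_mem_nhds (by fun_prop) ?_
      rw [unroll_apply, N.core]
      exact extChartAt_source_mem_nhds _
    have hs' : ∀ᶠ e in 𝓝 ((a, 0) : ℝ × ℂ), (Circle.exp e.1, e.2) ∈ Φ.source :=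
      ContinuousAt.preimage_mem_nhds (by fun_prop) (Φ.open_source.mem_nhds hΦ)
    filter_upwards [hs, hs'] with e he he'
    have h1 : (ψ.symm (N.inChart a e).1, (N.inChart a e).2) = N.unroll e :=
      Prod.ext (ψ.left_inv he) rfl
    have h2 : Φ.invFun (N.unroll e) = (Circle.exp e.1, e.2) := by
      change Φ.invFun (N.toFun (Circle.exp e.1, e.2)) = _
      rw [hΦN he']
      exact Φ.left_inv he'
    simp only [Function.comp_apply, J, h1, h2]
  have hd : HasFDerivAt (fun e : ℝ × ℂ => ((Circle.exp e.1 : ℂ), e.2))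
      ((fderiv ℝ J (N.inChart a (a, 0))).comp (fderiv ℝ (N.inChart a) (a, 0))) (a, 0) := by
    refine (HasFDerivAt.comp (a, (0 : ℂ)) (hJ.differentiableAt (by simp)).hasFDerivAt
      ((N.contDiffAt_inChart a).differentiableAt (by simp)).hasFDerivAt).congr_of_eventuallyEq
      heq.symm
  have hexp : HasDerivAt (fun x : ℝ => (Circle.exp x : ℂ)) (Circle.exp a * Complex.I) a := by
    simp only [Circle.coe_exp]
    simpa using ((hasDerivAt_id a).ofReal_comp.mul_const Complex.I).cexp
  have hd' : HasFDerivAt (fun e : ℝ × ℂ => ((Circle.exp e.1 : ℂ), e.2)) _ (a, 0) :=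
    (HasFDerivAt.comp (f := Prod.fst) (a, (0 : ℂ)) hexp.hasFDerivAt hasFDerivAt_fst).prodMk hasFDerivAt_snd
  refine (injective_iff_map_eq_zero _).2 fun v hv => ?_
  have h := congrArg (fun L => L v) (hd.unique hd')
  simp only [ContinuousLinearMap.comp_apply, hv, map_zero] at h
  have h2 := congrArg Prod.snd h
  have h1 := congrArg Prod.fst h
  simp at h1 h2
  exact Prod.ext h1 h2.symm

end PushedInTube

/-! ### A bicollar adapted to the tube -/

namespace PushedInTube

variable {F : Type*} [TopologicalSpace F] [ChartedSpace (EuclideanSpace ℝ (Fin 2)) F]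
  {C : Circle → F} (N : PushedInTube C)

/-- The gradient of the height in the normal disc at a point of the core. -/
noncomputable def normal (z : Circle) : ℂ :=
  ⟨fderiv ℝ (fun w => (N.toFun (z, w)).2) 0 1, fderiv ℝ (fun w => (N.toFun (z, w)).2) 0 Complex.I⟩

theorem fderiv_slice (a : ℝ) (w : ℂ) : fderiv ℝ (fun w => (N.toFun (Circle.exp a, w)).2) 0 w =
    fderiv ℝ N.height (a, 0) (0, w) := by
  have h1 : HasFDerivAt N.height (fderiv ℝ N.height (a, 0)) (a, 0) :=
    (N.contDiff_height.differentiable (by simp) _).hasFDerivAt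
  have h2 := HasFDerivAt.comp (0 : ℂ) h1 (hasFDerivAt_prodMk_right a 0)
  have h3 : N.height ∘ (fun w => (a, w)) = fun w => (N.toFun (Circle.exp a, w)).2 := rfl
  rw [h3] at h2
  rw [h2.fderiv]
  rfl

theorem contDiff_normal : ContDiff ℝ ∞ fun a => N.normal (Circle.exp a) := by
  have h1 : ∀ w : ℂ, ContDiff ℝ ∞ fun a : ℝ => fderiv ℝ N.height (a, 0) (0, w) := fun w => by
    have h2 : ContDiff ℝ ∞ (fderiv ℝ N.height) := N.contDiff_height.fderiv_right (by simp)
    exact (h2.comp (contDiff_id.prodMk contDiff_const)).clm_apply contDiff_const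
  have h2 : (fun a => N.normal (Circle.exp a)) = fun a => Complex.equivRealProdCLM.symm
      (fderiv ℝ N.height (a, 0) (0, 1), fderiv ℝ N.height (a, 0) (0, Complex.I)) := by
    funext a
    simp only [normal, fderiv_slice]
    rfl
  rw [h2]
  exact Complex.equivRealProdCLM.symm.contDiff.comp ((h1 1).prodMk (h1 Complex.I))

theorem continuous_normal : Continuous N.normal := by
  have : IsQuotientMap Circle.exp := Circle.isCoveringMap_exp.isQuotientMap Circle.exp_surjective
  exact this.continuous_iff.2 N.contDiff_normal.continuous

/-- The height is constant along the core, so only the normal component contributes. -/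
theorem fderiv_height (a x : ℝ) (w : ℂ) : fderiv ℝ N.height (a, 0) (x, w) =
    (N.normal (Circle.exp a)).re * w.re + (N.normal (Circle.exp a)).im * w.im := by
  have h1 : HasFDerivAt N.height (fderiv ℝ N.height (a, 0)) (a, 0) :=
    (N.contDiff_height.differentiable (by simp) _).hasFDerivAt
  have h2 := HasFDerivAt.comp (f := fun a => (a, (0 : ℂ))) a h1
    (hasFDerivAt_prodMk_left (𝕜 := ℝ) a (0 : ℂ))
  have h3 : N.height ∘ (fun a => (a, 0)) = fun _ => 1 / 2 := funext N.height_core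
  rw [h3] at h2
  have h4 := congrArg (fun L => L x) (h2.unique (hasFDerivAt_const _ _))
  have h5 : fderiv ℝ N.height (a, 0) (x, 0) = 0 := h4
  have h6 : (x, w) = (x, 0) + (w.re • ((0 : ℝ), (1 : ℂ)) + w.im • ((0 : ℝ), Complex.I)) := by
    ext <;> simp
  rw [h6, map_add, map_add, map_smul, map_smul, h5, ← fderiv_slice, ← fderiv_slice]
  simp only [normal, zero_add, smul_eq_mul]
  ring

/-- The images of the lines orthogonal to the gradient of the height. -/
noncomputable def collarMap (e : Circle × ℝ) : F :=
  (N.toFun (e.1, e.2 * (Complex.I * N.normal e.1))).1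

theorem collarMap_zero (z : Circle) : N.collarMap (z, 0) = C z := by
  simp [collarMap, N.core]

theorem continuous_collarMap : Continuous N.collarMap := by
  have := N.continuous_toFun
  have := N.continuous_normal
  unfold collarMap
  fun_prop

variable [IsManifold (𝓡 2) ∞ F]

/-- Otherwise the injective derivative on the three-dimensional `ℝ × ℂ` would take its values in the
two directions of the surface. -/
theorem normal_ne_zero (z : Circle) : N.normal z ≠ 0 := by
  obtain ⟨a, rfl⟩ := Circle.exp_surjective z
  intro h
  have h1 : ∀ v, fderiv ℝ N.height (a, 0) v = 0 := fun v => by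
    rw [← Prod.mk.eta (p := v), fderiv_height, h]; simp
  have h2 : ∀ v, (fderiv ℝ (N.inChart a) (a, 0) v).2 = 0 := fun v => by
    rw [← h1 v]
    have h3 := (hasFDerivAt_snd (𝕜 := ℝ)).comp (a, (0 : ℂ))
      ((N.contDiffAt_inChart a).differentiableAt (by simp)).hasFDerivAt
    have h4 : (Prod.snd ∘ N.inChart a) = N.height := rfl
    rw [h4] at h3
    rw [h3.fderiv]
    rfl
  let L := (ContinuousLinearMap.fst ℝ (EuclideanSpace ℝ (Fin 2)) ℝ).comp
    (fderiv ℝ (N.inChart a) (a, 0))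
  have hL : Function.Injective L.toLinearMap := fun v w hvw =>
    N.injective_fderiv_inChart a (Prod.ext hvw ((h2 v).trans (h2 w).symm))
  have := LinearMap.finrank_le_finrank_of_injective hL
  simp at this

/-- Inverse function theorem. The direction `I * normal` is orthogonal to the gradient, so on the
span of it and the core direction the derivative of the height vanishes. The injective derivative of
the tube then stays injective after projection to the surface, hence is an isomorphism by dimension.
-/
theorem exists_local_collar (a : ℝ) : ∃ V : Set (ℝ × ℝ), IsOpen V ∧ (a, 0) ∈ V ∧
    InjOn (fun e : ℝ × ℝ => N.collarMap (Circle.exp e.1, e.2)) V ∧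
    ∀ e ∈ V, Filter.map (fun e : ℝ × ℝ => N.collarMap (Circle.exp e.1, e.2)) (𝓝 e) =
      𝓝 (N.collarMap (Circle.exp e.1, e.2)) := by
  let φ := chartAt (EuclideanSpace ℝ (Fin 2)) (C (Circle.exp a))
  let p := fun e : ℝ × ℝ => N.collarMap (Circle.exp e.1, e.2)
  have hp : Continuous p := N.continuous_collarMap.comp (by fun_prop)
  let ι := fun e : ℝ × ℝ => (e.1, (e.2 : ℂ) * (Complex.I * N.normal (Circle.exp e.1)))
  have hι0 : ι (a, 0) = (a, 0) := by simp [ι]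
  have hι : ContDiff ℝ ∞ ι := contDiff_fst.prodMk
    ((Complex.ofRealCLM.contDiff.comp contDiff_snd).mul
      (contDiff_const.mul (N.contDiff_normal.comp contDiff_fst)))
  have hιd : ∀ v, fderiv ℝ ι (a, 0) v = (v.1, v.2 * (Complex.I * N.normal (Circle.exp a))) := by
    have h1 : HasFDerivAt (fun e : ℝ × ℝ => (e.2 : ℂ)) _ (a, (0 : ℝ)) :=
      (Complex.ofRealCLM.comp (ContinuousLinearMap.snd ℝ ℝ ℝ)).hasFDerivAt
    have h2 : HasFDerivAt (fun e : ℝ × ℝ => Complex.I * N.normal (Circle.exp e.1)) _ (a, (0 : ℝ)) :=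
      (((contDiff_const.mul (N.contDiff_normal.comp contDiff_fst)).differentiable
        (by simp)) _).hasFDerivAt
    have h3 : HasFDerivAt ι _ (a, 0) := (hasFDerivAt_fst).prodMk (h1.mul h2)
    intro v
    rw [h3.fderiv]
    simp [mul_comm]
  have hchart := N.contDiffAt_inChart a
  have hstrict : HasStrictFDerivAt (fun e => (N.inChart a (ι e)).1)
      ((ContinuousLinearMap.fst ℝ (EuclideanSpace ℝ (Fin 2)) ℝ).comp
        ((fderiv ℝ (N.inChart a) (a, 0)).comp (fderiv ℝ ι (a, 0)))) (a, 0) := by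
    refine HasStrictFDerivAt.fst ?_
    refine HasStrictFDerivAt.comp (a, (0 : ℝ)) ?_ (hι.contDiffAt.hasStrictFDerivAt (by simp))
    rw [hι0]
    exact hchart.hasStrictFDerivAt (by simp)
  set L := ((ContinuousLinearMap.fst ℝ (EuclideanSpace ℝ (Fin 2)) ℝ).comp
        ((fderiv ℝ (N.inChart a) (a, 0)).comp (fderiv ℝ ι (a, 0)))) with hL
  have hinj : Function.Injective L.toLinearMap := by
    refine (injective_iff_map_eq_zero _).2 fun v hv => ?_
    have h1 : fderiv ℝ (N.inChart a) (a, 0) (fderiv ℝ ι (a, 0) v) = 0 := by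
      refine Prod.ext hv ?_
      have h3 := (hasFDerivAt_snd (𝕜 := ℝ)).comp (a, (0 : ℂ))
        (hchart.differentiableAt (by simp)).hasFDerivAt
      have h4 : (Prod.snd ∘ N.inChart a) = N.height := rfl
      rw [h4] at h3
      have h5 : (fderiv ℝ (N.inChart a) (a, 0) (fderiv ℝ ι (a, 0) v)).2 =
        fderiv ℝ N.height (a, 0) (fderiv ℝ ι (a, 0) v) := by rw [h3.fderiv]; rfl
      rw [h5, hιd, fderiv_height]
      simp
      ring
    have h2 := N.injective_fderiv_inChart a (h1.trans (map_zero _).symm)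
    rw [hιd] at h2
    simp only [Prod.mk_eq_zero, mul_eq_zero, Complex.ofReal_eq_zero, Complex.I_ne_zero,
      N.normal_ne_zero, or_false] at h2
    exact Prod.ext h2.1 h2.2
  let e := (LinearMap.linearEquivOfInjective L.toLinearMap hinj (by simp)).toContinuousLinearEquiv
  have he : (e : ℝ × ℝ →L[ℝ] EuclideanSpace ℝ (Fin 2)) = L := by ext v <;> rfl
  rw [← he] at hstrict
  let Θ := hstrict.toOpenPartialHomeomorph _
  have hΘ : ∀ e, Θ e = φ (p e) := fun e => rfl
  let Ξ := Θ.trans φ.symm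
  have hsrc : IsOpen (p ⁻¹' φ.source) := φ.open_source.preimage hp
  have heq : ∀ e ∈ p ⁻¹' φ.source, Ξ e = p e := fun e he => φ.left_inv he
  refine ⟨Ξ.source ∩ p ⁻¹' φ.source, Ξ.open_source.inter hsrc, ⟨⟨?_, ?_⟩, ?_⟩, ?_, ?_⟩
  · exact hstrict.mem_toOpenPartialHomeomorph_source
  · change Θ (a, 0) ∈ φ.target
    rw [hΘ]
    refine φ.map_source ?_
    change N.collarMap _ ∈ φ.source
    rw [collarMap_zero]
    exact mem_chart_source _ _
  · change N.collarMap _ ∈ φ.source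
    rw [collarMap_zero]
    exact mem_chart_source _ _
  · intro x hx y hy hxy
    refine Ξ.injOn hx.1 hy.1 ?_
    rw [heq x hx.2, heq y hy.2]
    exact hxy
  · intro x hx
    have h1 := Ξ.map_nhds_eq hx.1
    rw [heq x hx.2] at h1
    rw [← h1]
    refine Filter.map_congr ?_
    filter_upwards [hsrc.mem_nhds hx.2] with y hy
    exact (heq y hy).symm

/-- The map is injective on the compact zero section and locally injective near it, hence injective
on a neighbourhood; the tube lemma makes the width uniform. -/
theorem exists_collar_width [T2Space F] : ∃ ε > 0, InjOn N.collarMap (univ ×ˢ Ioo (-ε) ε) ∧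
    ∀ e ∈ (univ : Set Circle) ×ˢ Ioo (-ε) ε, Filter.map N.collarMap (𝓝 e) = 𝓝 (N.collarMap e) := by
  let π : ℝ × ℝ → Circle × ℝ := fun e => (Circle.exp e.1, e.2)
  have hπc : Continuous π := by fun_prop
  have hπ : IsOpenMap π := Circle.isCoveringMap_exp.isLocalHomeomorph.isOpenMap.prodMap IsOpenMap.id
  have hloc : ∀ z : Circle, ∃ V : Set (Circle × ℝ), IsOpen V ∧ (z, 0) ∈ V ∧
      InjOn N.collarMap V ∧ ∀ e ∈ V, Filter.map N.collarMap (𝓝 e) = 𝓝 (N.collarMap e) := by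
    intro z
    obtain ⟨a, rfl⟩ := Circle.exp_surjective z
    obtain ⟨V, hV, haV, hinj, hmap⟩ := N.exists_local_collar a
    refine ⟨π '' V, hπ _ hV, ⟨_, haV, rfl⟩, ?_, ?_⟩
    · rintro _ ⟨x, hx, rfl⟩ _ ⟨y, hy, rfl⟩ hxy
      rw [hinj hx hy hxy]
    · rintro _ ⟨x, hx, rfl⟩
      rw [← hπ.map_nhds_eq hπc.continuousAt, Filter.map_map]
      exact hmap x hx
  choose V hV hzV hinj hmap using hloc
  have hcpt : IsCompact ((univ : Set Circle) ×ˢ ({0} : Set ℝ)) :=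
    isCompact_univ.prod isCompact_singleton
  obtain ⟨T, hT, hTinj⟩ : ∃ T ∈ 𝓝ˢ ((univ : Set Circle) ×ˢ ({0} : Set ℝ)), InjOn N.collarMap T := by
    refine InjOn.exists_mem_nhdsSet ?_ hcpt (fun x _ => N.continuous_collarMap.continuousAt) ?_
    · rintro ⟨z, s⟩ ⟨-, rfl⟩ ⟨z', s'⟩ ⟨-, rfl⟩ h
      rw [collarMap_zero, collarMap_zero] at h
      rw [N.core_injective h]
    · rintro ⟨z, s⟩ ⟨-, rfl⟩
      exact ⟨V z, (hV z).mem_nhds (hzV z), hinj z⟩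
  obtain ⟨T', hT', hT'o, hT'T⟩ := mem_nhdsSet_iff_exists.1 hT
  have hW : IsOpen (T' ∩ ⋃ z, V z) := hT'.inter (isOpen_iUnion hV)
  obtain ⟨A, B, -, hB, hA, h0, hAB⟩ := generalized_tube_lemma (isCompact_univ (X := Circle))
    (isCompact_singleton (x := (0 : ℝ))) hW (by
      rintro ⟨z, s⟩ ⟨-, rfl⟩
      exact ⟨hT'o ⟨mem_univ _, rfl⟩, mem_iUnion.2 ⟨z, hzV z⟩⟩)
  obtain ⟨ε, hε, hεB⟩ := Metric.isOpen_iff.1 hB 0 (h0 rfl)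
  have hsub : (univ : Set Circle) ×ˢ Ioo (-ε) ε ⊆ T' ∩ ⋃ z, V z := by
    rintro ⟨z, s⟩ ⟨-, hs⟩
    exact hAB ⟨hA (mem_univ _), hεB (by rw [Real.ball_eq_Ioo]; simpa using hs)⟩
  refine ⟨ε, hε, hTinj.mono fun e he => hT'T (hsub he).1, fun e he => ?_⟩
  obtain ⟨z, hz⟩ := mem_iUnion.1 (hsub he).2
  exact hmap z e hz

/-- A bicollar of the curve, adapted to the tube. -/
theorem exists_collar [T2Space F] : ∃ (K : Collar F) (ρ : ℝ → ℝ), Continuous ρ ∧ ρ 0 = 0 ∧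
    (∀ s, 0 < s → 0 < ρ s) ∧ (∀ s, ρ (-s) = -ρ s) ∧
    ∀ z s, K.toFun (z, s) = N.collarMap (z, ρ s) := by
  obtain ⟨ε, hε, hinj, hmap⟩ := N.exists_collar_width
  have hemb : IsOpenEmbedding Real.arctan := by
    refine ⟨Real.arctan_strictMono.isEmbedding_of_ordConnected ?_, ?_⟩
    · rw [Real.range_arctan]; infer_instance
    · rw [Real.range_arctan]; exact isOpen_Ioo
  have hc : (2 * ε / Real.pi) ≠ 0 := by positivity
  -- An odd increasing reparametrization of `(-ε, ε)` by `ℝ`. Its parity and sign are used later to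
  -- control the winding of `oval`.
  let ρ : ℝ → ℝ := fun s => 2 * ε / Real.pi * Real.arctan s
  have hρ : IsOpenEmbedding ρ := (Homeomorph.mulLeft₀ _ hc).isOpenEmbedding.comp hemb
  have hmem : ∀ s, ρ s ∈ Ioo (-ε) ε := fun s => by
    have h1 := Real.arctan_lt_pi_div_two s
    have h2 := Real.neg_pi_div_two_lt_arctan s
    have h3 : 0 < 2 * ε / Real.pi := by positivity
    have h4 : 2 * ε / Real.pi * (Real.pi / 2) = ε := by field_simp
    constructor
    · change -ε < 2 * ε / Real.pi * Real.arctan s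
      nlinarith
    · change 2 * ε / Real.pi * Real.arctan s < ε
      nlinarith
  have hid : IsOpenEmbedding (Prod.map id ρ : Circle × ℝ → Circle × ℝ) := IsOpenEmbedding.id.prodMap hρ
  refine ⟨⟨N.collarMap ∘ Prod.map id ρ, .of_continuous_injective_isOpenMap
    (N.continuous_collarMap.comp hid.continuous) ?_ ?_⟩, ρ, hρ.continuous, by simp [ρ], ?_, ?_, ?_⟩
  · intro x y hxy
    exact hid.injective (hinj ⟨mem_univ _, hmem _⟩ ⟨mem_univ _, hmem _⟩ hxy)
  · refine IsOpenMap.of_nhds_le fun x => ?_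
    rw [← Filter.map_map, hid.map_nhds_eq, hmap _ ⟨mem_univ _, hmem _⟩]
    rfl
  · intro s hs
    have := Real.arctan_pos.2 hs
    positivity
  · intro s
    simp [ρ, Real.arctan_neg]
  · intro z s
    rfl

end PushedInTube

/-! ### Flattening a normal disc without meeting the core -/

namespace PushedInTube

variable {F : Type*} [TopologicalSpace F] [ChartedSpace (EuclideanSpace ℝ (Fin 2)) F]
  {C : Circle → F} (N : PushedInTube C)

/-- A deformation of the normal disc `ζ ↦ N (1, ζ τ)` over the point `1` of the core, where `τ` is
the gradient of the height, into a disc on which the height is linear. -/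
noncomputable def flatten : C(ℝ × ℂ, F × ℝ) where
  toFun e := ((N.toFun (1, ⟨e.1 * e.2.re, e.2.im⟩ * N.normal 1)).1,
    (1 - e.1) * (1 / 2 + Complex.normSq (N.normal 1) * e.2.re) +
      e.1 * (N.toFun (1, e.2 * N.normal 1)).2)
  continuous_toFun := by
    have := N.continuous_toFun
    have h : Continuous fun e : ℝ × ℂ => (⟨e.1 * e.2.re, e.2.im⟩ : ℂ) :=
      Complex.equivRealProdCLM.symm.continuous.comp
        (f := fun e : ℝ × ℂ => (e.1 * e.2.re, e.2.im)) (by fun_prop)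
    fun_prop

theorem flatten_one (ζ : ℂ) : N.flatten (1, ζ) = N.toFun (1, ζ * N.normal 1) := by
  simp [flatten]

theorem flatten_zero (s : ℝ) : N.flatten (s, 0) = (C 1, 1 / 2) := by
  have : (⟨0, 0⟩ : ℂ) = 0 := rfl
  simp [flatten, this, N.core]
  ring_nf

/-- First-order expansion of the height: the inner product of `ζ τ` with the gradient `τ` is `normSq
τ * re ζ`. -/
theorem eventually_height_sub_le {η : ℝ} (hη : 0 < η) :
    ∀ᶠ ζ : ℂ in 𝓝 0, |(N.toFun (1, ζ * N.normal 1)).2 - 1 / 2 -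
      Complex.normSq (N.normal 1) * ζ.re| ≤ η * ‖ζ‖ := by
  have h1 : HasFDerivAt N.height (fderiv ℝ N.height (0, 0)) (0, 0) :=
    (N.contDiff_height.differentiable (by simp) _).hasFDerivAt
  let L : ℂ →L[ℝ] ℂ := (ContinuousLinearMap.mul ℝ ℂ).flip (N.normal 1)
  have h2 : HasFDerivAt (fun ζ : ℂ => ((0 : ℝ), L ζ)) _ 0 :=
    (hasFDerivAt_const _ _).prodMk L.hasFDerivAt
  rw [show ((0 : ℝ), (0 : ℂ)) = (0, L 0) by simp] at h1
  have h3 := HasFDerivAt.comp (0 : ℂ) h1 h2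
  have h4 := (Asymptotics.isLittleO_iff.1 h3.isLittleO) hη
  filter_upwards [h4] with ζ hζ
  have e1 : N.height (0, L ζ) = (N.toFun (1, ζ * N.normal 1)).2 := by
    rw [height, unroll_apply, Circle.exp_zero]; rfl
  have e2 : N.height (0, L 0) = 1 / 2 := by rw [map_zero, height_core]
  simp only [Function.comp_apply, sub_zero, e1, e2, ContinuousLinearMap.comp_apply,
    ContinuousLinearMap.prod_apply, zero_apply] at hζ
  rw [map_zero, fderiv_height, Circle.exp_zero] at hζ
  convert hζ using 3
  simp [L, Complex.normSq_apply]
  ring_nf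

/-- A strict derivative that is injective bounds distances from below. If a point of the normal disc
lies over `C z`, it differs from the core point over `C z` in height alone, so the height must
account for the whole distance in the tube. -/
theorem eventually_le_height_sub [T2Space F] [IsManifold (𝓡 2) ∞ F] : ∃ k > 0, ∀ᶠ ζ : ℂ in 𝓝 0,
    (N.toFun (1, ζ * N.normal 1)).1 ∈ range C →
      k * ‖ζ‖ ≤ |(N.toFun (1, ζ * N.normal 1)).2 - 1 / 2| := by
  have hstrict := (N.contDiffAt_inChart 0).hasStrictFDerivAt (by simp)
  have hind : IsInducing (fderiv ℝ (N.inChart 0) (0, 0)) :=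
    ((fderiv ℝ (N.inChart 0) (0, 0)).toLinearMap.isClosedEmbedding_of_injective
      (LinearMap.ker_eq_bot.2 (N.injective_fderiv_inChart 0))).isInducing
  obtain ⟨c, hc, hbig⟩ := (hstrict.isTheta_sub hind).isBigO_symm.exists_pos
  rw [Asymptotics.isBigOWith_iff] at hbig
  have hcont : ContinuousAt (fun p : ℂ × Circle => (((0 : ℝ), p.1 * N.normal 1),
      (Complex.arg p.2, (0 : ℂ)))) (0, 1) := by
    have h1 : ContinuousAt (fun p : ℂ × Circle => Complex.arg p.2) (0, 1) :=
      ContinuousAt.comp (f := fun p : ℂ × Circle => (p.2 : ℂ)) (g := Complex.arg)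
        (Complex.continuousAt_arg (by simp)) (by fun_prop)
    have h2 : ContinuousAt (fun p : ℂ × Circle => ((0 : ℝ), p.1 * N.normal 1)) (0, 1) := by fun_prop
    exact h2.prodMk (h1.prodMk continuousAt_const)
  have h1 := hcont.eventually (p := fun x => ‖x.1 - x.2‖ ≤ c * ‖N.inChart 0 x.1 - N.inChart 0 x.2‖)
    (by simpa using hbig)
  obtain ⟨U₁, hU₁, U₂, hU₂, hUv⟩ := mem_nhds_prod_iff.1 h1
  -- Points of the curve near `C 1` come only from parameters near `1`, which brings `(arg z, 0)`
  -- into the range of the strict derivative at `(0, 0)`.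
  have hemb : IsClosedEmbedding C := N.core_continuous.isClosedEmbedding N.core_injective
  rw [hemb.isInducing.nhds_eq_comap] at hU₂
  obtain ⟨W, hW, hWU⟩ := hU₂
  have hev : ∀ᶠ ζ : ℂ in 𝓝 0, (N.toFun (1, ζ * N.normal 1)).1 ∈ W := by
    refine ContinuousAt.preimage_mem_nhds ?_ ?_
    · have := N.continuous_toFun
      fun_prop
    · rwa [zero_mul, N.core]
  have hτ : 0 < ‖N.normal 1‖ := norm_pos_iff.2 (N.normal_ne_zero 1)
  refine ⟨‖N.normal 1‖ / c, by positivity, ?_⟩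
  filter_upwards [hev, hU₁] with ζ hζ hζU
  rintro ⟨z, hz⟩
  have hzU : z ∈ U₂ := hWU (by rw [← hz] at hζ; exact hζ)
  have h2 : ‖((0 : ℝ), ζ * N.normal 1) - (Complex.arg z, (0 : ℂ))‖ ≤ c *
      ‖N.inChart 0 (0, ζ * N.normal 1) - N.inChart 0 (Complex.arg z, 0)‖ :=
    hUv (show (ζ, z) ∈ U₁ ×ˢ U₂ from ⟨hζU, hzU⟩)
  have e1 : N.unroll (0, ζ * N.normal 1) = N.toFun (1, ζ * N.normal 1) := by
    rw [unroll_apply, Circle.exp_zero]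
  have e2 : N.unroll (Complex.arg z, 0) = (C z, 1 / 2) := by
    rw [unroll_apply, Circle.exp_arg, N.core]
  have e3 : N.inChart 0 (0, ζ * N.normal 1) - N.inChart 0 (Complex.arg z, 0) =
      (0, (N.toFun (1, ζ * N.normal 1)).2 - 1 / 2) := by
    refine Prod.ext ?_ ?_
    · simp only [inChart, e1, e2, Prod.fst_sub, ← hz, sub_self]
    · simp only [inChart, height, e1, e2, Prod.snd_sub]
  have h3 : ‖ζ * N.normal 1‖ ≤ c * |(N.toFun (1, ζ * N.normal 1)).2 - 1 / 2| := by
    calc ‖ζ * N.normal 1‖ ≤ ‖((0 : ℝ), ζ * N.normal 1) - (Complex.arg z, (0 : ℂ))‖ := by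
          refine le_trans (le_of_eq ?_) (norm_snd_le _)
          simp
      _ ≤ _ := h2
      _ = _ := by
        rw [e3, Prod.norm_mk, norm_zero, Real.norm_eq_abs, max_eq_right (abs_nonneg _)]
  rw [norm_mul] at h3
  rw [div_mul_eq_mul_div, div_le_iff₀ hc]
  linarith

/-- The deformation avoids the core. -/
theorem exists_flatten_radius [T2Space F] [IsManifold (𝓡 2) ∞ F] : ∃ δ > 0, ∀ ζ : ℂ, ζ ≠ 0 →
    ‖ζ‖ < δ → ∀ s ∈ Icc (0 : ℝ) 1, N.flatten (s, ζ) ∈ range N.toFun ∧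
      ¬ ((N.flatten (s, ζ)).1 ∈ range C ∧ (N.flatten (s, ζ)).2 = 1 / 2) := by
  set A := Complex.normSq (N.normal 1) with hAdef
  have hA : 0 < A := Complex.normSq_pos.2 (N.normal_ne_zero 1)
  obtain ⟨k, hk, hk'⟩ := N.eventually_le_height_sub
  -- `η ≤ A / 2` turns `A |re ζ| ≤ η ‖ζ‖` into `A |re ζ| ≤ 2 η |im ζ|`. Then the height above the
  -- core is at most `3 η ‖ζ'‖`, and `η ≤ k / 4` makes this smaller than the lower bound `k ‖ζ'‖`.
  obtain ⟨η, hη, hηA, hηk⟩ : ∃ η > 0, η ≤ A / 2 ∧ η ≤ k / 4 :=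
    ⟨min (A / 2) (k / 4), by positivity, min_le_left _ _, min_le_right _ _⟩
  have hr : ∀ᶠ ζ : ℂ in 𝓝 0, ∀ s ∈ Icc (0 : ℝ) 1, N.flatten (s, ζ) ∈ range N.toFun := by
    refine isCompact_Icc.eventually_forall_of_forall_eventually fun s _ => ?_
    refine ContinuousAt.preimage_mem_nhds
      (f := fun p : ℂ × ℝ => N.flatten (p.2, p.1)) (by fun_prop)
      (N.isOpenEmbedding.isOpen_range.mem_nhds ?_)
    dsimp only
    rw [flatten_zero]
    exact ⟨_, N.core 1⟩
  obtain ⟨δ, hδ, hball⟩ := Metric.eventually_nhds_iff.1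
    ((N.eventually_height_sub_le hη).and (hk'.and hr))
  refine ⟨δ, hδ, fun ζ hζ0 hζ s hs => ?_⟩
  have hb := hball (y := ζ) (by simpa using hζ)
  refine ⟨hb.2.2 s hs, ?_⟩
  rintro ⟨hC, hh⟩
  -- The point of the normal disc from which `flatten` takes its surface coordinate; its height is
  -- still that of the tube.
  let ζ' : ℂ := ⟨s * ζ.re, ζ.im⟩
  have hζ' : ‖ζ'‖ ≤ ‖ζ‖ := by
    rw [Complex.norm_def, Complex.norm_def, Complex.normSq_apply, Complex.normSq_apply]
    refine Real.sqrt_le_sqrt ?_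
    have : s * s ≤ 1 := by nlinarith [hs.1, hs.2]
    simp only [ζ']
    nlinarith [mul_self_nonneg ζ.re]
  have hb' := hball (y := ζ') (by simpa using hζ'.trans_lt hζ)
  have h1 := hb.1
  have h2 := hb'.1
  have h3 := hb'.2.1 hC
  have hh' : (1 - s) * (1 / 2 + A * ζ.re) + s * (N.toFun (1, ζ * N.normal 1)).2 = 1 / 2 := hh
  set h := (N.toFun (1, ζ * N.normal 1)).2
  set h' := (N.toFun (1, ζ' * N.normal 1)).2
  have h4 : A * |ζ.re| ≤ η * ‖ζ‖ := by
    have e : A * ζ.re = -(s * (h - 1 / 2 - A * ζ.re)) := by linarith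
    calc A * |ζ.re| = |A * ζ.re| := by rw [abs_mul, abs_of_pos hA]
      _ = s * |h - 1 / 2 - A * ζ.re| := by
        conv_lhs => rw [e]
        rw [abs_neg, abs_mul, abs_of_nonneg hs.1]
      _ ≤ 1 * |h - 1 / 2 - A * ζ.re| := by gcongr; exact hs.2
      _ ≤ η * ‖ζ‖ := by rw [one_mul]; exact h1
  have h5 := Complex.norm_le_abs_re_add_abs_im ζ
  have h6 : A * |ζ.re| ≤ 2 * η * |ζ.im| := by
    have := abs_nonneg ζ.re
    nlinarith
  have h7 : 0 < |ζ.im| := by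
    rcases (abs_nonneg ζ.im).lt_or_eq with h | h
    · exact h
    · exfalso
      rw [← h, mul_zero] at h6
      have h8 : ζ.re = 0 := by
        rw [← abs_eq_zero]
        exact le_antisymm (by nlinarith) (abs_nonneg _)
      exact hζ0 (Complex.ext h8 (abs_eq_zero.1 h.symm))
  have h8 : |ζ.im| ≤ ‖ζ'‖ := Complex.abs_im_le_norm ζ'
  have h9 : |A * ζ'.re| ≤ A * |ζ.re| := by
    simp only [ζ']
    rw [abs_mul, abs_mul, abs_of_pos hA, abs_of_nonneg hs.1]
    have := mul_le_of_le_one_left (abs_nonneg ζ.re) hs.2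
    gcongr
  have h10 : |h' - 1 / 2| ≤ η * ‖ζ'‖ + A * |ζ.re| := by
    have := abs_add_le (h' - 1 / 2 - A * ζ'.re) (A * ζ'.re)
    rw [sub_add_cancel] at this
    linarith
  nlinarith

end PushedInTube

/-- A free homotopy of loops: the two sides of the rectangle are the same path, and conjugation is
along that path. -/
theorem Holonomy.diff_conj {Z : Type*} [TopologicalSpace Z] {G : Type*} [Group G]
    (c : Holonomy Z G) (f : C(I × ℝ, Z)) (a b : ℝ) (h : ∀ u, f (u, a) = f (u, b)) :
    (c.comap f).diff (1, a) (1, b) = (c.comap f).diff (0, a) (1, a) *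
      (c.comap f).diff (0, a) (0, b) * ((c.comap f).diff (0, a) (1, a))⁻¹ := by
  have h1 : (c.comap f).diff (0, a) (1, a) = (c.comap f).diff (0, b) (1, b) := by
    rw [← Holonomy.apply_eq_diff _ (Path.id.prod (Path.refl a)),
      ← Holonomy.apply_eq_diff _ (Path.id.prod (Path.refl b))]
    exact c.map_eq_of_eq fun t => h t
  rw [Holonomy.diff_inv]
  conv_rhs => rw [h1]
  rw [Holonomy.diff_mul, Holonomy.diff_mul]

theorem Holonomy.diff_eq_diff {Y Y' W Z : Type*} [TopologicalSpace Y] [TopologicalSpace Y']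
    [TopologicalSpace W] [TopologicalSpace Z] [SimplyConnectedSpace Y] [SimplyConnectedSpace Y']
    [SimplyConnectedSpace W] {G : Type*} [Group G] (c : Holonomy Z G) (f : C(Y, Z)) (f' : C(Y', Z))
    (φ : C(W, Y)) (φ' : C(W, Y')) (h : ∀ w, f (φ w) = f' (φ' w)) (w w' : W) :
    (c.comap f).diff (φ w) (φ w') = (c.comap f').diff (φ' w) (φ' w') :=
  (c.diff_eq_of_comp f (f.comp φ) φ (fun _ => rfl) w w').symm.trans
    (c.diff_eq_of_comp f' (f.comp φ) φ' h w w')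

/-! ### Comparing the tube with the bicollar -/

namespace PushedInTube

variable {F : Type u} [TopologicalSpace F] [ChartedSpace (EuclideanSpace ℝ (Fin 2)) F]
  {C : Circle → F} (N : PushedInTube C)

theorem notMem_core_of_ne_zero {z : Circle} {w : ℂ} (hw : w ≠ 0) :
    ¬ ((N.toFun (z, w)).1 ∈ range C ∧ (N.toFun (z, w)).2 = 1 / 2) := by
  rintro ⟨⟨z', hz'⟩, h⟩
  have h1 : N.toFun (z', 0) = N.toFun (z, w) := by
    rw [N.core]
    exact Prod.ext hz' h.symm
  exact hw (congrArg Prod.snd (N.injective h1)).symm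

variable (K : Collar F) (hK : ∀ z, K.toFun (z, 0) = C z)

omit [ChartedSpace (EuclideanSpace ℝ (Fin 2)) F] in
include hK in
theorem core_eq_range : K.core = range C := congrArg range (funext hK)

include hK in
theorem mem_space {z : Circle} {w : ℂ} (hw : w ≠ 0) : N.toFun (z, w) ∈ K.space :=
  ⟨Ioo_subset_Icc_self (N.mem_Ioo _), by
    rw [core_eq_range K hK]
    exact N.notMem_core_of_ne_zero hw⟩

/-- The universal cover of the tube without its core. -/
noncomputable def punctured : C(ℝ × ℂ, K.space) where
  toFun e := ⟨N.toFun (Circle.exp e.1, Complex.exp e.2), N.mem_space K hK (Complex.exp_ne_zero _)⟩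
  continuous_toFun := by have := N.continuous_toFun; fun_prop

theorem exists_lift_punctured {a b : K.space} (p : Path a b)
    (hp : ∀ t, (p t).1 ∈ range N.toFun) (e : ℝ × ℂ) (he : N.punctured K hK e = a) :
    ∃ q : C(I, ℝ × ℂ), q 0 = e ∧ ∀ t, p t = N.punctured K hK (q t) := by
  let ψ := N.isOpenEmbedding.toIsEmbedding.toHomeomorph
  let p' : C(I, Circle × ℂ) := ⟨fun t => ψ.symm ⟨(p t).1, hp t⟩, by fun_prop⟩
  have hp' : ∀ t, N.toFun (p' t) = (p t).1 := fun t =>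
    congrArg Subtype.val (ψ.apply_symm_apply ⟨(p t).1, hp t⟩)
  have h0 : ∀ t, (p' t).2 ≠ 0 := fun t ht => by
    have h1 := hp' t
    rw [← Prod.mk.eta (p := p' t), ht, N.core] at h1
    refine (p t).2.2 ?_
    rw [← h1, core_eq_range K hK]
    exact ⟨⟨_, rfl⟩, rfl⟩
  have h1 : (Circle.exp e.1, Complex.exp e.2) = p' 0 := N.injective (by
    rw [hp', p.source, ← he]
    rfl)
  obtain ⟨q₁, hq₁, hq₁0⟩ := Circle.isCoveringMap_exp.exists_path_lifts
    (ContinuousMap.fst.comp p') e.1 (congrArg Prod.fst h1).symm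
  obtain ⟨q₂, hq₂, hq₂0⟩ := Complex.isCoveringMap_exp.exists_path_lifts
    (⟨fun t => ⟨(p' t).2, h0 t⟩, by fun_prop⟩ : C(I, {z : ℂ // z ≠ 0})) e.2
    (Subtype.ext (congrArg Prod.snd h1).symm)
  refine ⟨q₁.prodMk q₂, Prod.ext hq₁0 hq₂0, fun t => Subtype.ext ?_⟩
  have h2 : Circle.exp (q₁ t) = (p' t).1 := congr_fun hq₁ t
  have h3 : Complex.exp (q₂ t) = (p' t).2 := congrArg Subtype.val (congr_fun hq₂ t)
  change _ = N.toFun (Circle.exp (q₁ t), Complex.exp (q₂ t))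
  rw [h2, h3, hp']

variable {G : Type*} [Group G] (c : Holonomy K.space G)

/-- Translation by `2πi` is a deck transformation, so the lifts of a path starting at `e` and at its
translate have the same value. -/
theorem punctured_meridian (e e' : ℝ × ℂ) :
    (c.comap (N.punctured K hK)).diff e' (e'.1, e'.2 + 2 * Real.pi * Complex.I) =
      (c.comap (N.punctured K hK)).diff e e' *
      (c.comap (N.punctured K hK)).diff e (e.1, e.2 + 2 * Real.pi * Complex.I) *
      ((c.comap (N.punctured K hK)).diff e e')⁻¹ := by
  have h : _ = (c.comap (N.punctured K hK)).diff (e.1, e.2 + 2 * Real.pi * Complex.I)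
      (e'.1, e'.2 + 2 * Real.pi * Complex.I) :=
    Holonomy.diff_eq_of_comp c (N.punctured K hK) (N.punctured K hK) ⟨fun e => (e.1, e.2 + 2 * Real.pi * Complex.I), by fun_prop⟩
    (fun e => by simp [punctured, Complex.exp_add]) e e'
  rw [Holonomy.diff_inv]
  conv_rhs => rw [h]
  rw [Holonomy.diff_mul, Holonomy.diff_mul]

/-- An oval around the origin of the plane. -/
noncomputable def oval (d : ℝ) (g : ℝ → ℝ) (ψ : ℝ) : ℂ := ⟨d * Real.cos ψ, g (Real.sin ψ)⟩

section Oval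

variable {d : ℝ} (hd : 0 < d) {g : ℝ → ℝ} (hg : Continuous g) (hg0 : g 0 = 0)
  (hpos : ∀ s, 0 < s → 0 < g s) (hodd : ∀ s, g (-s) = -g s)

include hg in
theorem continuous_oval : Continuous (oval d g) :=
  Complex.equivRealProdCLM.symm.continuous.comp
    (f := fun ψ : ℝ => (d * Real.cos ψ, g (Real.sin ψ))) (by fun_prop)

include hd hg0 hpos hodd in
-- Since `g` has the sign of its argument, the oval stays within a right angle of the unit circle at
-- the same parameter. Thus it avoids `0` and winds once.
theorem re_oval_pos (ψ : ℝ) : 0 < (oval d g ψ * Complex.exp (-(ψ * Complex.I))).re := by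
  have h1 : (oval d g ψ * Complex.exp (-(ψ * Complex.I))).re =
      d * Real.cos ψ ^ 2 + g (Real.sin ψ) * Real.sin ψ := by
    rw [show -(ψ * Complex.I) = ((-ψ : ℝ) : ℂ) * Complex.I by push_cast; ring, Complex.mul_re,
      Complex.exp_ofReal_mul_I_re, Complex.exp_ofReal_mul_I_im]
    simp [oval]
    ring
  rw [h1]
  rcases lt_trichotomy (Real.sin ψ) 0 with h | h | h
  · have h2 := hpos (-Real.sin ψ) (by linarith)
    rw [hodd] at h2
    nlinarith [mul_nonneg hd.le (sq_nonneg (Real.cos ψ))]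
  · have h2 := Real.sin_sq_add_cos_sq ψ
    rw [h, hg0, mul_zero, add_zero]
    rw [h] at h2
    nlinarith
  · have h2 := hpos _ h
    nlinarith [mul_nonneg hd.le (sq_nonneg (Real.cos ψ))]

include hd hg hg0 hpos hodd in
/-- A logarithm of the oval. -/
theorem exists_log_oval {τ ζ : ℂ} (hζ : Complex.exp ζ = d * τ) : ∃ l : C(ℝ, ℂ), l 0 = ζ ∧
    l (2 * Real.pi) = ζ + 2 * Real.pi * Complex.I ∧ ∀ ψ, Complex.exp (l ψ) = oval d g ψ * τ := by
  have hp := re_oval_pos hd hg0 hpos hodd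
  have hre : ∀ ψ, 0 < (oval d g ψ * Complex.exp (-(ψ * Complex.I)) / d).re := fun ψ => by
    rw [Complex.div_ofReal_re]
    exact div_pos (hp ψ) hd
  have hoval0 : oval d g 0 = d := Complex.ext (by simp [oval]) (by simp [oval, hg0])
  have hoval2 : oval d g (2 * Real.pi) = d := Complex.ext (by simp [oval]) (by simp [oval, hg0])
  have hd' : (d : ℂ) ≠ 0 := Complex.ofReal_ne_zero.2 hd.ne'
  -- The winding is carried by `ψ * I`; the remaining factor lies in the right half plane, where the
  -- principal logarithm is continuous.
  refine ⟨⟨fun ψ => ζ + ψ * Complex.I +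
    Complex.log (oval d g ψ * Complex.exp (-(ψ * Complex.I)) / d), ?_⟩, ?_, ?_, fun ψ => ?_⟩
  · have := continuous_oval (d := d) hg
    exact Continuous.add (by fun_prop) (Continuous.clog (by fun_prop) fun ψ => Or.inl (hre ψ))
  · simp [hoval0, hd']
  · have : Complex.exp (-(((2 * Real.pi : ℝ) : ℂ) * Complex.I)) = 1 := by
      rw [Complex.exp_neg]; push_cast; rw [Complex.exp_two_pi_mul_I, inv_one]
    simp only [ContinuousMap.coe_mk, hoval2, this]
    simp [hd']
  · simp only [ContinuousMap.coe_mk]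
    rw [Complex.exp_add, Complex.exp_add, hζ, Complex.exp_log (fun h => by
      have := hre ψ; rw [h] at this; simp at this), Complex.exp_neg]
    field_simp

end Oval

variable [T2Space F] [IsManifold (𝓡 2) ∞ F]

/-- The meridian and the longitude of the tube are those of a bicollar of the curve. -/
theorem exists_collar_comparison : ∃ (K : Collar F) (hK : ∀ z, K.toFun (z, 0) = C z) (r s : ℝ)
    (hr : 0 < r) (hs : 0 < s) (hs' : s < 1 / 2)
    (τ : Path (N.punctured K hK (0, 0)) (K.meridian r s hr hs hs' Real.pi)),
    ∀ (G : Type u) [Group G] (c : Holonomy K.space G),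
      (c.comap (K.meridian r s hr hs hs')).diff Real.pi (3 * Real.pi) =
        c τ * (c.comap (N.punctured K hK)).diff (0, 0) (0, 2 * Real.pi * Complex.I) * (c τ)⁻¹ ∧
      (c.comap (K.torus r s hr hs hs')).diff (0, Real.pi) (2 * Real.pi, Real.pi) =
        c τ * (c.comap (N.punctured K hK)).diff (0, 0) (2 * Real.pi, 0) * (c τ)⁻¹ := by
  obtain ⟨K, ρ, hρ, hρ0, hρpos, hρodd, hKρ⟩ := N.exists_collar
  have hK : ∀ z, K.toFun (z, 0) = C z := fun z => by rw [hKρ, hρ0, collarMap_zero]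
  obtain ⟨δ, hδ, hflat⟩ := N.exists_flatten_radius
  obtain ⟨ε, hε, hcol, h, hcont, hh0, hh1, hhm⟩ := N.framing
  set A := Complex.normSq (N.normal 1) with hAdef
  have hA : 0 < A := Complex.normSq_pos.2 (N.normal_ne_zero 1)
  -- The oval has both coordinates at most `d`, so `δ / 3` keeps it where `flatten` avoids the core.
  -- The ellipse has vertical half-axis `A * d`; the other bounds keep it below the push off and
  -- inside `F × (0,1)`.
  obtain ⟨d, hd, hdδ, hdε, hdA⟩ : ∃ d > 0, d ≤ δ / 3 ∧ d ≤ ε / A ∧ d ≤ 1 / (4 * A) :=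
    ⟨min (δ / 3) (min (ε / A) (1 / (4 * A))), by positivity, min_le_left _ _,
      (min_le_right _ _).trans (min_le_left _ _), (min_le_right _ _).trans (min_le_right _ _)⟩
  obtain ⟨r, hr, hrd⟩ : ∃ r > 0, ∀ x, |x| ≤ r → |ρ x| ≤ d := by
    obtain ⟨r, hr, h⟩ := Metric.continuousAt_iff.1 (hρ.continuousAt (x := 0)) d hd
    refine ⟨r / 2, by positivity, fun x hx => ?_⟩
    have := h (x := x) (by rw [Real.dist_eq, sub_zero]; linarith)
    rw [hρ0, Real.dist_eq, sub_zero] at this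
    exact this.le
  have hs : 0 < A * d := by positivity
  have hsε : A * d ≤ ε := by rw [le_div_iff₀ hA] at hdε; linarith
  have hs' : A * d < 1 / 2 := by
    rw [le_div_iff₀ (by positivity)] at hdA
    linarith
  let g : ℝ → ℝ := fun x => ρ (r * x)
  have hg : Continuous g := by fun_prop
  have hg0 : g 0 = 0 := by simp [g, hρ0]
  have hgpos : ∀ x, 0 < x → 0 < g x := fun x hx => hρpos _ (by positivity)
  have hgodd : ∀ x, g (-x) = -g x := fun x => by simp only [g, mul_neg, hρodd]
  have hoval := continuous_oval (d := d) hg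
  have hov0 : ∀ ψ, oval d g ψ ≠ 0 := fun ψ h => by
    have := re_oval_pos hd hg0 hgpos hgodd ψ
    simp [h] at this
  have hovδ : ∀ ψ, ‖oval d g ψ‖ < δ := fun ψ => by
    have h1 := Complex.norm_le_abs_re_add_abs_im (oval d g ψ)
    have h2 : |(oval d g ψ).re| ≤ d := by
      change |d * Real.cos ψ| ≤ d
      rw [abs_mul, abs_of_pos hd]
      exact mul_le_of_le_one_right hd.le (Real.abs_cos_le_one ψ)
    have h3 : |(oval d g ψ).im| ≤ d := hrd _ (by
      rw [abs_mul, abs_of_pos hr]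
      exact mul_le_of_le_one_right hr.le (Real.abs_sin_le_one ψ))
    linarith
  -- the homotopies
  let H : C(I × ℝ, K.space) := ⟨fun e => ⟨N.flatten (1 - e.1, oval d g e.2), by
    have h1 := hflat _ (hov0 e.2) (hovδ e.2) (1 - e.1)
      ⟨by linarith [e.1.2.2], by linarith [e.1.2.1]⟩
    obtain ⟨p, hp⟩ := h1.1
    refine ⟨?_, ?_⟩
    · rw [← hp]
      exact Ioo_subset_Icc_self (N.mem_Ioo _)
    · rw [core_eq_range K hK]
      exact h1.2⟩, by fun_prop⟩
  -- The longitude moves in two stages: `L₁` is the homotopy of the framing up to the push off, `L₂`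
  -- lowers the push off to the top of the ellipse.
  let L₁ : C(I × ℝ, K.space) := ⟨fun e => ⟨h (Circle.exp e.2, e.1), by
    obtain ⟨⟨z, w⟩, hw, hp⟩ := hhm (Circle.exp e.2, e.1)
    rw [← hp]
    exact N.mem_space K hK hw.2.2⟩, by fun_prop⟩
  have hmix : ∀ u : I, 0 < (1 - (u : ℝ)) * ε + u * (A * d) ∧
      (1 - (u : ℝ)) * ε + u * (A * d) ≤ ε := fun u => by
    have h1 := u.2.1
    have h2 := u.2.2
    constructor
    · nlinarith
    · nlinarith
  let L₂ : C(I × ℝ, K.space) := ⟨fun e => ⟨(C (Circle.exp e.2),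
    1 / 2 + ((1 - (e.1 : ℝ)) * ε + e.1 * (A * d))), by
    obtain ⟨p, -, hp⟩ := hcol (Circle.exp e.2) _ ⟨(hmix e.1).1.le, (hmix e.1).2⟩
    refine ⟨?_, fun h => ?_⟩
    · rw [← hp]
      exact Ioo_subset_Icc_self (N.mem_Ioo _)
    · have := h.2
      dsimp only at this
      linarith [(hmix e.1).1]⟩, by have := N.core_continuous; fun_prop⟩
  -- The shift by `π` occurs because the oval starts on the side of increasing height, the ellipse
  -- at its lowest point.
  have hHmer : ∀ ψ, H (1, ψ) = K.meridian r (A * d) hr hs hs' (ψ + Real.pi) := fun ψ => by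
    refine Subtype.ext ?_
    change N.flatten (1 - ((1 : I) : ℝ), oval d g ψ) =
      (K.toFun (1, -(r * Real.sin (ψ + Real.pi))), 1 / 2 - A * d * Real.cos (ψ + Real.pi))
    rw [Real.sin_add_pi, Real.cos_add_pi, mul_neg, neg_neg, hKρ]
    refine Prod.ext ?_ ?_
    · change (N.toFun (1, ⟨(1 - ((1 : I) : ℝ)) * (d * Real.cos ψ), g (Real.sin ψ)⟩ *
        N.normal 1)).1 = (N.toFun (1, (ρ (r * Real.sin ψ) : ℂ) * (Complex.I * N.normal 1))).1
      have e : (⟨(1 - ((1 : I) : ℝ)) * (d * Real.cos ψ), g (Real.sin ψ)⟩ : ℂ) =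
          (ρ (r * Real.sin ψ) : ℂ) * Complex.I := Complex.ext (by simp) (by simp [g])
      rw [e, mul_assoc]
    · change (1 - (1 - ((1 : I) : ℝ))) * (1 / 2 + A * (d * Real.cos ψ)) +
        (1 - ((1 : I) : ℝ)) * _ = _
      simp
      ring
  have hHN : ∀ ψ, (H (0, ψ)).1 = N.toFun (1, oval d g ψ * N.normal 1) := fun ψ => by
    change N.flatten (1 - ((0 : I) : ℝ), oval d g ψ) = _
    rw [show (1 - ((0 : I) : ℝ)) = 1 by simp, flatten_one]
  have hL₁N : ∀ a, L₁ (0, a) = N.punctured K hK (a, 0) := fun a => Subtype.ext (by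
    change h (Circle.exp a, 0) = N.toFun (Circle.exp a, Complex.exp 0)
    rw [hh0, Complex.exp_zero])
  have hL₁L₂ : ∀ a, L₁ (1, a) = L₂ (0, a) := fun a => Subtype.ext (by
    change h (Circle.exp a, 1) = (C (Circle.exp a),
      1 / 2 + ((1 - ((0 : I) : ℝ)) * ε + ((0 : I) : ℝ) * (A * d)))
    rw [hh1]
    simp)
  have hL₂K : ∀ a, L₂ (1, a) = K.torus r (A * d) hr hs hs' (a, Real.pi) := fun a =>
    Subtype.ext (by
      change (C (Circle.exp a), 1 / 2 + ((1 - ((1 : I) : ℝ)) * ε + ((1 : I) : ℝ) * (A * d))) =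
        (K.toFun (Circle.exp a, -(r * Real.sin Real.pi)), 1 / 2 - A * d * Real.cos Real.pi)
      simp [hK])
  have hπ : H (1, 0) = K.meridian r (A * d) hr hs hs' Real.pi := by rw [hHmer, zero_add]
  have hπ' : L₂ (1, 0) = K.meridian r (A * d) hr hs hs' Real.pi := by
    rw [hL₂K, K.meridian_eq_torus]
  let side : ∀ f : C(I × ℝ, K.space), Path (f (0, 0)) (f (1, 0)) := fun f =>
    (Path.id.prod (Path.refl (0 : ℝ))).map f.continuous
  let τ : Path (N.punctured K hK (0, 0)) (K.meridian r (A * d) hr hs hs' Real.pi) :=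
    ((side L₁).trans ((side L₂).cast (hL₁L₂ 0) rfl)).cast (hL₁N 0).symm hπ'.symm
  -- The conjugating path `τ` comes from the longitude, while the meridian is moved by `H`. Their
  -- difference `p` stays in the punctured tube, so it lifts to the universal cover.
  let p := τ.trans ((side H).symm.cast hπ.symm rfl)
  have hp : ∀ t, (p t).1 ∈ range N.toFun := by
    have h1 : range p ⊆ {y | y.1 ∈ range N.toFun} := by
      rw [Path.trans_range]
      refine union_subset ?_ ?_
      · change range ((side L₁).trans ((side L₂).cast (hL₁L₂ 0) rfl)) ⊆ _
        rw [Path.trans_range]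
        refine union_subset ?_ ?_
        · rintro _ ⟨t, rfl⟩
          obtain ⟨p, -, hp⟩ := hhm (Circle.exp 0, t)
          exact ⟨p, hp⟩
        · rintro _ ⟨t, rfl⟩
          obtain ⟨p, -, hp⟩ := hcol (Circle.exp 0) _ ⟨(hmix t).1.le, (hmix t).2⟩
          exact ⟨p, hp⟩
      · change range (side H).symm ⊆ _
        rw [Path.symm_range]
        rintro _ ⟨t, rfl⟩
        exact (hflat _ (hov0 0) (hovδ 0) (1 - t) ⟨by linarith [t.2.2], by linarith [t.2.1]⟩).1
    exact fun t => h1 ⟨t, rfl⟩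
  obtain ⟨q, hq0, hq⟩ := N.exists_lift_punctured K hK p hp (0, 0) rfl
  have hq1 : (Circle.exp (q 1).1, Complex.exp (q 1).2) = (1, oval d g 0 * N.normal 1) := by
    refine N.injective ?_
    rw [← hHN, ← p.target, hq]
    rfl
  obtain ⟨hqa, hqb⟩ := Prod.ext_iff.1 hq1
  dsimp only at hqa hqb
  obtain ⟨l, hl0, hl2, hl⟩ := exists_log_oval hd hg hg0 hgpos hgodd (τ := N.normal 1)
    (ζ := (q 1).2) (by
      rw [hqb]
      congr 1
      exact Complex.ext (by simp [oval]) (by simp [oval, hg0]))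
  refine ⟨K, hK, r, A * d, hr, hs, hs', τ, fun G _ c => ⟨?_, ?_⟩⟩
  · have hcp : c p = (c.comap (N.punctured K hK)).diff (0, 0) (q 1) :=
      Holonomy.apply_eq_diff_of_lift c (N.punctured K hK) p ⟨q, hq0, rfl⟩ hq
    have hcp' : c p = ((c.comap H).diff (0, 0) (1, 0))⁻¹ * c τ := by
      rw [← Holonomy.apply_eq_diff (c.comap H) (Path.id.prod (Path.refl 0))]
      refine (c.map_trans τ ((side H).symm.cast hπ.symm rfl)).trans ?_
      rw [Holonomy.map_cast, Holonomy.map_symm]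
      rfl
    have e1 : (c.comap H).diff (1, 0) (1, 2 * Real.pi) =
        (c.comap (K.meridian r (A * d) hr hs hs')).diff Real.pi (3 * Real.pi) := by
      have := Holonomy.diff_eq_diff c H (K.meridian r (A * d) hr hs hs')
        (⟨fun ψ => (1, ψ), by fun_prop⟩ : C(ℝ, I × ℝ)) ⟨fun ψ => ψ + Real.pi, by fun_prop⟩
        hHmer 0 (2 * Real.pi)
      refine this.trans ?_
      change (c.comap (K.meridian r (A * d) hr hs hs')).diff (0 + Real.pi)
        (2 * Real.pi + Real.pi) = _
      rw [zero_add]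
      congr 1
      ring
    have e2 : (c.comap H).diff (0, 0) (0, 2 * Real.pi) = (c.comap (N.punctured K hK)).diff (q 1)
        ((q 1).1, (q 1).2 + 2 * Real.pi * Complex.I) := by
      have := Holonomy.diff_eq_diff c H (N.punctured K hK)
        (⟨fun ψ => (0, ψ), by fun_prop⟩ : C(ℝ, I × ℝ)) ⟨fun ψ => ((q 1).1, l ψ), by fun_prop⟩
        (fun ψ => Subtype.ext ((hHN ψ).trans (by
          change _ = N.toFun (Circle.exp (q 1).1, Complex.exp (l ψ))
          rw [hl, hqa]))) 0 (2 * Real.pi)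
      refine this.trans ?_
      change (c.comap (N.punctured K hK)).diff ((q 1).1, l 0) ((q 1).1, l (2 * Real.pi)) = _
      rw [hl0, hl2]
    have e3 := Holonomy.diff_conj c H 0 (2 * Real.pi) fun u => Subtype.ext (by
      change N.flatten (_, oval d g _) = N.flatten (_, oval d g _)
      simp [oval])
    -- Wherever the lift of `p` ends, the meridian there is conjugate to the one at `(0, 0)` by `c
    -- p`, so the winding of `p` is irrelevant.
    have e4 := N.punctured_meridian K hK c (0, 0) (q 1)
    rw [← e1, e3, e2, e4, ← hcp, hcp']
    simp only [zero_add]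
    group
  · have hcτ : c τ = (c.comap L₂).diff (0, 0) (1, 0) * (c.comap L₁).diff (0, 0) (1, 0) := by
      rw [← Holonomy.apply_eq_diff (c.comap L₁) (Path.id.prod (Path.refl 0)),
        ← Holonomy.apply_eq_diff (c.comap L₂) (Path.id.prod (Path.refl 0))]
      refine (c.map_cast _ (hL₁N 0).symm hπ'.symm).trans
        ((c.map_trans (side L₁) ((side L₂).cast (hL₁L₂ 0) rfl)).trans ?_)
      rw [Holonomy.map_cast]
      rfl
    have hper : ∀ u, L₁ (u, 0) = L₁ (u, 2 * Real.pi) := fun u => Subtype.ext (by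
      change h (Circle.exp 0, u) = h (Circle.exp (2 * Real.pi), u)
      rw [Circle.exp_zero, Circle.exp_two_pi])
    have hper' : ∀ u, L₂ (u, 0) = L₂ (u, 2 * Real.pi) := fun u => Subtype.ext (by
      change (C (Circle.exp 0), _) = (C (Circle.exp (2 * Real.pi)), _)
      rw [Circle.exp_zero, Circle.exp_two_pi])
    have e1 := Holonomy.diff_eq_diff c L₂ (K.torus r (A * d) hr hs hs')
      (⟨fun a => (1, a), by fun_prop⟩ : C(ℝ, I × ℝ)) ⟨fun a => (a, Real.pi), by fun_prop⟩
      hL₂K 0 (2 * Real.pi)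
    have e2 := Holonomy.diff_eq_diff c L₁ L₂
      (⟨fun a => (1, a), by fun_prop⟩ : C(ℝ, I × ℝ)) (⟨fun a => (0, a), by fun_prop⟩)
      hL₁L₂ 0 (2 * Real.pi)
    have e3 := Holonomy.diff_eq_diff c L₁ (N.punctured K hK)
      (⟨fun a => (0, a), by fun_prop⟩ : C(ℝ, I × ℝ)) ⟨fun a => (a, 0), by fun_prop⟩
      hL₁N 0 (2 * Real.pi)
    simp only [ContinuousMap.coe_mk] at e1 e2 e3
    rw [← e1, Holonomy.diff_conj c L₂ 0 _ hper', ← e2, Holonomy.diff_conj c L₁ 0 _ hper, e3, hcτ]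
    group

end PushedInTube

/-- A holonomy is invariant under homotopies relative to the endpoints. -/
theorem Holonomy.apply_eq_of_homotopy {Y : Type*} [TopologicalSpace Y] {G : Type*} [Group G]
    (c : Holonomy Y G) (f : C(I × I, Y)) {a b a' b' : Y} (p : Path a b) (q : Path a' b')
    (hp : ∀ t, p t = f (0, t)) (hq : ∀ t, q t = f (1, t)) (h0 : ∀ s, f (s, 0) = f (0, 0))
    (h1 : ∀ s, f (s, 1) = f (0, 1)) : c p = c q := by
  rw [c.apply_eq_diff_of_lift f p ((Path.refl 0).prod Path.id) hp,
    c.apply_eq_diff_of_lift f q ((Path.refl 1).prod Path.id) hq]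
  have e0 : (c.comap f).diff (0, 0) (1, 0) = 1 := by
    rw [← c.map_refl (a := f (0, 0))]
    exact (c.apply_eq_diff_of_lift f _ (Path.id.prod (Path.refl 0)) fun s => (h0 s).symm).symm
  have e1 : (c.comap f).diff (0, 1) (1, 1) = 1 := by
    rw [← c.map_refl (a := f (0, 1))]
    exact (c.apply_eq_diff_of_lift f _ (Path.id.prod (Path.refl 1)) fun s => (h1 s).symm).symm
  have h2 := Holonomy.diff_mul (c.comap f) (0, 0) (1, 0) (1, 1)
  have h3 := Holonomy.diff_mul (c.comap f) (0, 0) (0, 1) (1, 1)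
  rw [e0, mul_one] at h2
  rw [e1, one_mul] at h3
  rw [h2, h3]

/-! ### The radial retraction and the groupoid of the exterior -/

namespace PushedInTube

variable {F : Type u} [TopologicalSpace F] [ChartedSpace (EuclideanSpace ℝ (Fin 2)) F]
  {C : Circle → F} (N : PushedInTube C) (K : Collar F) (hK : ∀ z, K.toFun (z, 0) = C z)

/-- The inclusion of the exterior of the tube into the complement of the core. -/
def inclusion : C(N.exterior, K.space) where
  toFun x := ⟨x.1, x.2.1, fun h => by
    rw [core_eq_range K hK] at h
    obtain ⟨⟨z, hz⟩, h2⟩ := h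
    exact x.2.2 ⟨(z, 0), by simp, (N.core z).trans (Prod.ext hz h2.symm)⟩⟩
  continuous_toFun := by fun_prop

/-- The scale factor of the radial deformation. -/
noncomputable def radius (s : I) (w : ℂ) : ℝ := 1 - s + s * min ‖w‖ 1

theorem radius_pos (s : I) {w : ℂ} (hw : w ≠ 0) : 0 < radius s w := by
  have h1 : 0 < min ‖w‖ 1 := lt_min (norm_pos_iff.2 hw) one_pos
  have h2 := s.2.1
  have h3 := s.2.2
  unfold radius
  rcases h2.lt_or_eq with h | h
  · nlinarith
  · rw [← h]; norm_num

theorem radius_of_one_le (s : I) {w : ℂ} (hw : 1 ≤ ‖w‖) : radius s w = 1 := by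
  simp [radius, hw]

theorem radius_zero (w : ℂ) : radius 0 w = 1 := by simp [radius]

theorem continuous_radius : Continuous fun e : I × ℂ => radius e.1 e.2 := by
  unfold radius
  fun_prop

open Classical in
/-- The radial deformation of the complement of the core onto the exterior of the tube. -/
noncomputable def pushOutFun (s : I) (y : F × ℝ) : F × ℝ :=
  if h : y ∈ range N.toFun then N.toFun (h.choose.1, (radius s h.choose.2)⁻¹ • h.choose.2) else y

theorem pushOutFun_apply (s : I) (z : Circle) (w : ℂ) :
    N.pushOutFun s (N.toFun (z, w)) = N.toFun (z, (radius s w)⁻¹ • w) := by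
  have h : N.toFun (z, w) ∈ range N.toFun := ⟨_, rfl⟩
  have h1 : h.choose = (z, w) := N.injective h.choose_spec
  rw [pushOutFun, dif_pos h, h1]

theorem pushOutFun_of_notMem (s : I) {y : F × ℝ} (h : y ∉ N.toFun '' (univ ×ˢ Metric.ball 0 1)) :
    N.pushOutFun s y = y := by
  by_cases hy : y ∈ range N.toFun
  · obtain ⟨⟨z, w⟩, rfl⟩ := hy
    have hw : 1 ≤ ‖w‖ := by
      by_contra hw
      exact h ⟨_, ⟨mem_univ _, by simpa using hw⟩, rfl⟩
    rw [pushOutFun_apply, radius_of_one_le s hw, inv_one, one_smul]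
  · rw [pushOutFun, dif_neg hy]

theorem pushOutFun_zero (y : F × ℝ) : N.pushOutFun 0 y = y := by
  by_cases hy : y ∈ range N.toFun
  · obtain ⟨⟨z, w⟩, rfl⟩ := hy
    rw [pushOutFun_apply, radius_zero, inv_one, one_smul]
  · rw [pushOutFun, dif_neg hy]

variable {K} in
include hK in
theorem pushOutFun_mem (s : I) (y : K.space) : N.pushOutFun s y ∈ K.space := by
  by_cases hy : y.1 ∈ range N.toFun
  · obtain ⟨⟨z, w⟩, h⟩ := hy
    have hw : w ≠ 0 := by
      rintro rfl
      refine y.2.2 ?_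
      rw [← h, N.core, core_eq_range K hK]
      exact ⟨⟨_, rfl⟩, rfl⟩
    rw [← h, pushOutFun_apply]
    exact N.mem_space K hK (smul_ne_zero (inv_ne_zero (radius_pos s hw).ne') hw)
  · rw [pushOutFun, dif_neg hy]
    exact y.2

variable {K} in
include hK in
theorem pushOutFun_one_mem (y : K.space) : N.pushOutFun 1 y ∈ N.exterior := by
  by_cases hy : y.1 ∈ range N.toFun
  · obtain ⟨⟨z, w⟩, h⟩ := hy
    have hw : w ≠ 0 := by
      rintro rfl
      refine y.2.2 ?_
      rw [← h, N.core, core_eq_range K hK]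
      exact ⟨⟨_, rfl⟩, rfl⟩
    rw [← h, pushOutFun_apply]
    refine ⟨Ioo_subset_Icc_self (N.mem_Ioo _), ?_⟩
    rintro ⟨⟨z', w'⟩, ⟨-, hw'⟩, h'⟩
    have e := congrArg Prod.snd (N.injective h')
    dsimp only at e
    rw [e, mem_ball_zero_iff, norm_smul, norm_inv, Real.norm_eq_abs,
      abs_of_pos (radius_pos 1 hw), inv_mul_lt_iff₀ (radius_pos 1 hw)] at hw'
    simp [radius] at hw'
  · rw [pushOutFun, dif_neg hy]
    exact ⟨y.2.1, fun h => hy (image_subset_range _ _ h)⟩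

variable [T2Space F]

variable {K} in
include hK in
-- Near the tube the map is explicit in the coordinates. Near any other point it is the identity,
-- because the closed unit tube is compact and hence closed.
theorem continuous_pushOutFun :
    Continuous fun e : I × K.space => N.pushOutFun e.1 e.2 := by
  refine continuous_iff_continuousAt.2 fun ⟨s, y⟩ => ?_
  have hsnd : Continuous fun e : I × K.space => e.2.1 := by fun_prop
  by_cases hy : y.1 ∈ range N.toFun
  · let Ψ := N.isOpenEmbedding.toOpenPartialHomeomorph N.toFun
    have hΨ : ∀ p, Ψ.symm (N.toFun p) = p := fun p => Ψ.left_inv (mem_univ p)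
    have hyT : y.1 ∈ Ψ.target := by
      change y.1 ∈ N.toFun '' univ
      rwa [image_univ]
    have h0 : (Ψ.symm y.1).2 ≠ 0 := by
      obtain ⟨⟨z, w⟩, h⟩ := hy
      rintro h'
      refine y.2.2 ?_
      rw [← h, hΨ] at h'
      dsimp only at h'
      rw [← h, h', N.core, core_eq_range K hK]
      exact ⟨⟨_, rfl⟩, rfl⟩
    have hc : ContinuousAt (fun e : I × K.space => Ψ.symm e.2.1) (s, y) :=
      ContinuousAt.comp (f := fun e : I × K.space => e.2.1) (Ψ.symm.continuousAt hyT)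
        hsnd.continuousAt
    have hrad : ContinuousAt (fun e : I × K.space => radius e.1 (Ψ.symm e.2.1).2) (s, y) :=
      ContinuousAt.comp (f := fun e : I × K.space => (e.1, (Ψ.symm e.2.1).2))
        continuous_radius.continuousAt (continuousAt_fst.prodMk hc.snd)
    have h1 : ContinuousAt (fun e : I × K.space => N.toFun ((Ψ.symm e.2.1).1,
        (radius e.1 (Ψ.symm e.2.1).2)⁻¹ • (Ψ.symm e.2.1).2)) (s, y) :=
      ContinuousAt.comp (g := N.toFun) N.continuous_toFun.continuousAt
        (hc.fst.prodMk ((hrad.inv₀ (radius_pos s h0).ne').smul hc.snd))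
    refine h1.congr ?_
    filter_upwards [(N.isOpenEmbedding.isOpen_range.preimage hsnd).mem_nhds hy] with e he
    obtain ⟨⟨z, w⟩, h⟩ := he
    dsimp only at h
    rw [← h, hΨ, pushOutFun_apply]
  · have hcl : IsClosed (N.toFun '' (univ ×ˢ Metric.closedBall 0 1)) :=
      ((isCompact_univ.prod (isCompact_closedBall 0 1)).image N.continuous_toFun).isClosed
    refine hsnd.continuousAt.congr ?_
    filter_upwards [(hcl.isOpen_compl.preimage hsnd).mem_nhds
      fun h => hy (image_subset_range _ _ h)] with e he
    exact (N.pushOutFun_of_notMem _ fun h => he (image_mono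
      (prod_mono le_rfl Metric.ball_subset_closedBall) h)).symm

/-- The radial deformation of the complement of the core onto the exterior of the tube. -/
noncomputable def pushOut : C(I × K.space, K.space) where
  toFun e := ⟨N.pushOutFun e.1 e.2, N.pushOutFun_mem hK e.1 e.2⟩
  continuous_toFun := (N.continuous_pushOutFun hK).subtype_mk _

/-- The radial retraction of the complement of the core onto the exterior of the tube. -/
noncomputable def retraction : C(K.space, N.exterior) where
  toFun y := ⟨N.pushOutFun 1 y, N.pushOutFun_one_mem hK y⟩
  continuous_toFun :=
    ((N.continuous_pushOutFun hK).comp (Continuous.prodMk_right (1 : I))).subtype_mk _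

theorem retraction_inclusion (x : N.exterior) :
    N.retraction K hK (N.inclusion K hK x) = x :=
  Subtype.ext (N.pushOutFun_of_notMem 1 x.2.2)

theorem holonomy_retraction {G : Type*} [Group G] (c : Holonomy N.exterior G) {a b : N.exterior}
    (p : Path a b) : c.comap (N.retraction K hK) (p.map (N.inclusion K hK).continuous) = c p :=
  c.map_eq_of_eq fun t => N.retraction_inclusion K hK (p t)

/-- The deformation `pushOut` fixes the exterior, so it is a homotopy relative to the endpoints of
`p`. -/
theorem holonomy_inclusion {G : Type*} [Group G] (c : Holonomy K.space G) {a b : N.exterior}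
    (p : Path (N.inclusion K hK a) (N.inclusion K hK b)) :
    (c.comap (N.inclusion K hK)) (p.map (N.retraction K hK).continuous) = c p := by
  have hfix : ∀ s x, N.pushOut K hK (s, N.inclusion K hK x) = N.inclusion K hK x := fun s x =>
    Subtype.ext (N.pushOutFun_of_notMem s x.2.2)
  refine (c.apply_eq_of_homotopy ((N.pushOut K hK).comp
    ⟨fun e => (e.1, p e.2), by fun_prop⟩) _ _ (fun t => ?_) (fun t => ?_) (fun s => ?_)
    fun s => ?_).symm
  · exact (Subtype.ext (N.pushOutFun_zero _)).symm
  · rfl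
  · change N.pushOut K hK (s, p 0) = N.pushOut K hK (0, p 0)
    rw [p.source, hfix, hfix]
  · change N.pushOut K hK (s, p 1) = N.pushOut K hK (0, p 1)
    rw [p.target, hfix, hfix]

variable [LocallyPathConnectedSpace F] [IsManifold (𝓡 2) ∞ F]

/-- The fundamental groupoid of the exterior in terms of that of an end and of the meridian. -/
theorem exists_end_data (hF : ∀ x : F, ∃ B, IsOpen B ∧ x ∈ B ∧ SimplyConnectedSpace B)
    {t : ℝ} (ht : t = 0 ∨ t = 1) :
    ∃ (δ : Path N.basePoint (N.endInclusion ht (C 1))) (ℓ : Path (C 1) (C 1)),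
    (∀ (G : Type u) [Group G] (c : Holonomy N.exterior G),
      c δ * c N.longitude * (c δ)⁻¹ = c.comap (N.endInclusion ht) ℓ) ∧
    (∀ (G : Type u) [Group G] (c c' : Holonomy N.exterior G),
      (∀ {a b : F} (p : Path a b), c.comap (N.endInclusion ht) p =
        c'.comap (N.endInclusion ht) p) →
      c δ * c N.meridian * (c δ)⁻¹ = c' δ * c' N.meridian * (c' δ)⁻¹ →
      ∀ {a b : F} (p : Path (N.endInclusion ht a) (N.endInclusion ht b)), c p = c' p) ∧
    (∀ (G : Type u) [Group G] (c₀ : Holonomy F G) (m : G), Commute m (c₀ ℓ) →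
      ∃ c : Holonomy N.exterior G,
        (∀ {a b : F} (p : Path a b), c.comap (N.endInclusion ht) p = c₀ p) ∧
        c δ * c N.meridian * (c δ)⁻¹ = m) := by
  obtain ⟨K, hK, r, s, hr, hs, hs', τ, hτ⟩ := N.exists_collar_comparison
  obtain ⟨e, hend, he⟩ : ∃ e : C(F, K.space), K.IsEnd hr hs hs' e ∧
      ∀ x, N.inclusion K hK (N.endInclusion ht x) = e x := by
    rcases ht with rfl | rfl
    · exact ⟨K.bottom, K.isEnd_bottom hr hs hs' hF, fun x => rfl⟩
    · exact ⟨K.top, K.isEnd_top hr hs hs' hF, fun x => Subtype.ext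
        (Prod.ext rfl (show (1 : ℝ) = 1 - 0 by norm_num))⟩
  obtain ⟨δ', hlong, huniq, hex⟩ := hend
  have hbase : N.inclusion K hK N.basePoint = N.punctured K hK (0, 0) := Subtype.ext (by
    change N.toFun (1, 1) = N.toFun (Circle.exp 0, Complex.exp 0)
    rw [Circle.exp_zero, Complex.exp_zero])
  have hK1 : e (K.toFun (1, 0)) = e (C 1) := by rw [hK]
  let δY : Path (N.inclusion K hK N.basePoint) (N.inclusion K hK (N.endInclusion ht (C 1))) :=
    (τ.trans δ').cast hbase ((he _).trans hK1.symm)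
  have hδY : ∀ (G : Type u) [Group G] (c : Holonomy K.space G), c δY = c δ' * c τ :=
    fun G _ c => (c.map_cast _ _ _).trans (c.map_trans _ _)
  -- The connecting path is built in the complement of the core and then retracted into the
  -- exterior.
  let δ : Path N.basePoint (N.endInclusion ht (C 1)) :=
    (δY.map (N.retraction K hK).continuous).cast (N.retraction_inclusion K hK _).symm
      (N.retraction_inclusion K hK _).symm
  let ℓ : Path (C 1) (C 1) := K.coreLoop.cast (hK 1).symm (hK 1).symm
  have hmer : ∀ (G : Type u) [Group G] (c : Holonomy K.space G),
      c (N.meridian.map (N.inclusion K hK).continuous) =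
        (c.comap (N.punctured K hK)).diff (0, 0) (0, 2 * Real.pi * Complex.I) := fun G _ c =>
    Holonomy.apply_eq_diff_of_lift c _ _ ((Path.refl (0 : ℝ)).prod
      (⟨⟨fun t => 2 * Real.pi * t * Complex.I, by fun_prop⟩, by simp, by simp⟩ :
        Path (0 : ℂ) (2 * Real.pi * Complex.I))) fun t => Subtype.ext (by
      change N.toFun (1, (Circle.exp (2 * Real.pi * t) : ℂ)) =
        N.toFun (Circle.exp 0, Complex.exp (2 * Real.pi * t * Complex.I))
      rw [Circle.exp_zero, Circle.coe_exp]
      push_cast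
      rfl)
  have hlon : ∀ (G : Type u) [Group G] (c : Holonomy K.space G),
      c (N.longitude.map (N.inclusion K hK).continuous) =
        (c.comap (N.punctured K hK)).diff (0, 0) (2 * Real.pi, 0) := fun G _ c =>
    Holonomy.apply_eq_diff_of_lift c _ _
      ((⟨⟨fun t => 2 * Real.pi * t, by fun_prop⟩, by simp, by simp⟩ :
        Path (0 : ℝ) (2 * Real.pi)).prod (Path.refl (0 : ℂ))) fun t => Subtype.ext (by
      change N.toFun (Circle.exp (2 * Real.pi * t), 1) =
        N.toFun (Circle.exp (2 * Real.pi * t), Complex.exp 0)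
      rw [Complex.exp_zero])
  have hmer' : ∀ (G : Type u) [Group G] (c : Holonomy K.space G),
      c δ' * (c.comap (K.meridian r s hr hs hs')).diff Real.pi (3 * Real.pi) * (c δ')⁻¹ =
        c δY * c (N.meridian.map (N.inclusion K hK).continuous) * (c δY)⁻¹ := fun G _ c => by
    rw [(hτ G c).1, hδY, hmer]
    group
  have hlon' : ∀ (G : Type u) [Group G] (c : Holonomy K.space G),
      c.comap e K.coreLoop =
        c δY * c (N.longitude.map (N.inclusion K hK).continuous) * (c δY)⁻¹ := fun G _ c => by
    rw [← hlong, (hτ G c).2, hδY, hlon]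
    group
  have hRe : ∀ x, N.retraction K hK (e x) = N.endInclusion ht x := fun x => by
    rw [← he, retraction_inclusion]
  have hcδ : ∀ (G : Type u) [Group G] (c : Holonomy N.exterior G),
      c.comap (N.retraction K hK) δY = c δ := fun G _ c => (c.map_cast _ _ _).symm
  refine ⟨δ, ℓ, fun G _ c => ?_, fun G _ c c' h hm a b p => ?_, fun G _ c₀ m hc => ?_⟩
  · have h1 := hlon' G (c.comap (N.retraction K hK))
    rw [holonomy_retraction, hcδ] at h1
    rw [← h1]
    exact c.map_eq_of_eq fun t => hRe _
  · have key := huniq G (c.comap (N.retraction K hK)) (c'.comap (N.retraction K hK))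
      (fun {a b} p => by
        have : ∀ c : Holonomy N.exterior G, (c.comap (N.retraction K hK)).comap e p =
          c.comap (N.endInclusion ht) p := fun c => c.map_eq_of_eq fun t => hRe _
        rw [this, this, h])
      (by rw [hmer', hmer', holonomy_retraction, holonomy_retraction, hcδ, hcδ, hm])
      ((p.map (N.inclusion K hK).continuous).cast (he a).symm (he b).symm)
    rw [Holonomy.map_cast, Holonomy.map_cast] at key
    rwa [holonomy_retraction, holonomy_retraction] at key
  · obtain ⟨c, h1, h2⟩ := hex G c₀ m (by
      rw [show c₀ K.coreLoop = c₀ ℓ from (c₀.map_cast _ _ _).symm]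
      exact hc)
    refine ⟨c.comap (N.inclusion K hK), fun p => ?_, ?_⟩
    · rw [← h1]
      exact c.map_eq_of_eq fun t => he _
    · rw [hmer'] at h2
      have h3 : c.comap (N.inclusion K hK) δ = c δY := by
        rw [← N.holonomy_inclusion K hK c δY]
        exact Holonomy.map_cast _ _ _ _
      rw [h3]
      exact h2

end PushedInTube

/-! ### Smoothness of radial functions -/

/-- `R` is of class `C^n` and its derivatives of order at most `n` vanish at `0`. -/
def IsFlat : ℕ → (ℝ → ℝ) → Prop
  | 0, R => Continuous R ∧ R 0 = 0
  | n + 1, R => R 0 = 0 ∧ Differentiable ℝ R ∧ IsFlat n (deriv R)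

namespace IsFlat

theorem zero : ∀ {n : ℕ} {R : ℝ → ℝ}, IsFlat n R → R 0 = 0
  | 0, _, h => h.2
  | _ + 1, _, h => h.1

theorem continuous : ∀ {n : ℕ} {R : ℝ → ℝ}, IsFlat n R → Continuous R
  | 0, _, h => h.1
  | _ + 1, _, h => h.2.1.continuous

theorem of_succ : ∀ {n : ℕ} {R : ℝ → ℝ}, IsFlat (n + 1) R → IsFlat n R
  | 0, _, h => ⟨h.2.1.continuous, h.1⟩
  | _ + 1, _, h => ⟨h.1, h.2.1, h.2.2.of_succ⟩

/-- The bound for the derivative is integrated by the mean value inequality. -/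
theorem eventually_le : ∀ {n : ℕ} {R : ℝ → ℝ}, IsFlat n R → ∀ {ε : ℝ}, 0 < ε →
    ∀ᶠ r in 𝓝 (0 : ℝ), |R r| ≤ ε * |r| ^ n
  | 0, R, h, ε, hε => by
    have h1 := h.1.continuousAt (x := 0)
    rw [ContinuousAt, h.2] at h1
    filter_upwards [h1.eventually (Metric.ball_mem_nhds 0 hε)] with r hr
    rw [pow_zero, mul_one]
    simpa using (show dist (R r) 0 < ε from hr).le
  | n + 1, R, h, ε, hε => by
    obtain ⟨δ, hδ, hb⟩ := Metric.eventually_nhds_iff.1 (h.2.2.eventually_le hε)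
    refine Metric.eventually_nhds_iff.2 ⟨δ, hδ, fun r hr => ?_⟩
    rw [dist_zero_right, Real.norm_eq_abs] at hr
    have h1 := (convex_Icc (-|r|) |r|).norm_image_sub_le_of_norm_deriv_le (f := R)
      (C := ε * |r| ^ n) (x := 0) (y := r) (fun x _ => h.2.1 x) (fun x hx => by
        have hx' : |x| ≤ |r| := abs_le.2 hx
        refine (hb (by rw [dist_zero_right, Real.norm_eq_abs]; linarith)).trans ?_
        gcongr) (by simp) (by simp [neg_abs_le, le_abs_self])
    rw [h.1, sub_zero, sub_zero, Real.norm_eq_abs, Real.norm_eq_abs] at h1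
    rw [pow_succ, ← mul_assoc]
    exact h1

end IsFlat

section Radial

variable {E W : Type} [NormedAddCommGroup E] [InnerProductSpace ℝ E] [FiniteDimensional ℝ E]
  [NormedAddCommGroup W] [NormedSpace ℝ W]

/-- `g` is smooth away from `0` and positively homogeneous of degree `-m`. -/
structure IsHomogeneous (m : ℕ) (g : E → W) : Prop where
  contDiffOn : ContDiffOn ℝ ∞ g {0}ᶜ
  map_smul : ∀ (t : ℝ) (v : E), 0 < t → v ≠ 0 → g (t • v) = (t ^ m)⁻¹ • g v

namespace IsHomogeneous

variable {m : ℕ} {g : E → W}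

omit [FiniteDimensional ℝ E] in
theorem differentiableAt (hg : IsHomogeneous m g) {v : E} (hv : v ≠ 0) :
    DifferentiableAt ℝ g v :=
  (hg.contDiffOn.contDiffAt (isOpen_compl_singleton.mem_nhds hv)).differentiableAt (by simp)

omit [FiniteDimensional ℝ E] in
theorem fderiv_smul (hg : IsHomogeneous m g) {t : ℝ} {v : E} (ht : 0 < t) (hv : v ≠ 0) :
    fderiv ℝ g (t • v) = (t ^ (m + 1))⁻¹ • fderiv ℝ g v := by
  have h1 : (fun x => g (t • x)) =ᶠ[𝓝 v] fun x => (t ^ m)⁻¹ • g x := by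
    filter_upwards [isOpen_compl_singleton.mem_nhds hv] with x hx
    exact hg.map_smul t x ht hx
  have h2 := h1.fderiv_eq (𝕜 := ℝ)
  rw [fderiv_comp_smul, fderiv_fun_const_smul (hg.differentiableAt hv)] at h2
  rw [pow_succ', mul_inv, mul_smul, ← h2, inv_smul_smul₀ ht.ne']

omit [FiniteDimensional ℝ E] in
theorem fderiv (hg : IsHomogeneous m g) : IsHomogeneous (m + 1) (fderiv ℝ g) :=
  ⟨hg.contDiffOn.fderiv_of_isOpen isOpen_compl_singleton (by simp),
    fun _ _ ht hv => hg.fderiv_smul ht hv⟩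

omit [FiniteDimensional ℝ E] in
-- The derivative of the norm is homogeneous of degree `0`. This is the factor that accompanies
-- `deriv R` when `R ‖v‖ • g v` is differentiated.
theorem fderiv_norm_smulRight (hg : IsHomogeneous m g) :
    IsHomogeneous m fun v => (_root_.fderiv ℝ (fun x : E => ‖x‖) v).smulRight (g v) := by
  have hn : ContDiffOn ℝ ∞ (fun x : E => ‖x‖) {0}ᶜ := fun x hx =>
    (contDiffAt_norm ℝ hx).contDiffWithinAt
  refine ⟨ContDiffOn.smulRight (hn.fderiv_of_isOpen isOpen_compl_singleton (by simp))
    hg.contDiffOn, fun t v ht hv => ?_⟩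
  have h1 : (fun x : E => ‖t • x‖) = fun x => t • ‖x‖ := funext fun x => by
    rw [norm_smul, Real.norm_eq_abs, abs_of_pos ht, smul_eq_mul]
  have h2 : _root_.fderiv ℝ (fun x : E => ‖t • x‖) v =
    _root_.fderiv ℝ (fun x : E => t • ‖x‖) v := by rw [h1]
  rw [fderiv_comp_smul (f := fun x : E => ‖x‖),
    fderiv_fun_const_smul ((contDiffAt_norm ℝ hv (n := 1)).differentiableAt (by simp))] at h2
  rw [hg.map_smul t v ht hv, smul_right_injective _ ht.ne' h2]
  ext x
  exact smul_comm _ _ _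

theorem exists_bound (hg : IsHomogeneous m g) : ∃ M, 0 < M ∧ ∀ v, v ≠ 0 →
    ‖g v‖ ≤ M * (‖v‖ ^ m)⁻¹ := by
  have hc : ContinuousOn g (Metric.sphere 0 1) := hg.contDiffOn.continuousOn.mono fun v hv => by
    rintro rfl
    simp at hv
  obtain ⟨M, hM⟩ := (isCompact_sphere (0 : E) 1).exists_bound_of_continuousOn hc
  refine ⟨max M 1, by positivity, fun v hv => ?_⟩
  have hv' : 0 < ‖v‖ := norm_pos_iff.2 hv
  have hu : ‖‖v‖⁻¹ • v‖ = 1 := by rw [norm_smul, norm_inv, norm_norm, inv_mul_cancel₀ hv'.ne']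
  have h1 := hg.map_smul ‖v‖ (‖v‖⁻¹ • v) hv' (fun h => by rw [h, norm_zero] at hu; simp at hu)
  rw [smul_inv_smul₀ hv'.ne'] at h1
  rw [h1, norm_smul, norm_inv, norm_pow, norm_norm, mul_comm]
  have := (hM (‖v‖⁻¹ • v) (by simpa using hu)).trans (le_max_left M 1)
  gcongr

end IsHomogeneous

theorem IsFlat.hasFDerivAt_zero {m : ℕ} {R : ℝ → ℝ} {g : E → W} (hR : IsFlat (m + 1) R)
    (hg : IsHomogeneous m g) : HasFDerivAt (fun v => R ‖v‖ • g v) (0 : E →L[ℝ] W) 0 := by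
  obtain ⟨M, hM, hb⟩ := hg.exists_bound
  rw [hasFDerivAt_iff_isLittleO_nhds_zero, Asymptotics.isLittleO_iff]
  intro ε hε
  have h1 := (continuous_norm (E := E)).tendsto 0
  rw [norm_zero] at h1
  filter_upwards [h1.eventually (hR.eventually_le (div_pos hε hM))] with v hv
  rw [zero_add, norm_zero, hR.zero, zero_smul, sub_zero, zero_apply, sub_zero]
  rcases eq_or_ne v 0 with rfl | h0
  · simp [hR.zero]
  have hv' : 0 < ‖v‖ := norm_pos_iff.2 h0
  rw [norm_smul, Real.norm_eq_abs]
  rw [abs_norm] at hv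
  calc |R ‖v‖| * ‖g v‖ ≤ (ε / M * ‖v‖ ^ (m + 1)) * (M * (‖v‖ ^ m)⁻¹) := by
        gcongr
        exact hb v h0
    _ = ε * ‖v‖ := by field_simp; ring

theorem IsFlat.continuous_radial {m : ℕ} {R : ℝ → ℝ} {g : E → W} (hR : IsFlat m R)
    (hg : IsHomogeneous m g) : Continuous (fun v => R ‖v‖ • g v) := by
  refine continuous_iff_continuousAt.2 fun v => ?_
  rcases eq_or_ne v 0 with rfl | h0
  · obtain ⟨M, hM, hb⟩ := hg.exists_bound
    rw [Metric.continuousAt_iff']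
    intro ε hε
    have h1 := (continuous_norm (E := E)).tendsto 0
    rw [norm_zero] at h1
    filter_upwards [h1.eventually (hR.eventually_le (div_pos (half_pos hε) hM))] with v hv
    rw [norm_zero, hR.zero, zero_smul, dist_zero_right]
    rcases eq_or_ne v 0 with rfl | h0
    · simpa [hR.zero] using hε
    have hv' : 0 < ‖v‖ := norm_pos_iff.2 h0
    rw [norm_smul, Real.norm_eq_abs]
    rw [abs_norm] at hv
    calc |R ‖v‖| * ‖g v‖ ≤ (ε / 2 / M * ‖v‖ ^ m) * (M * (‖v‖ ^ m)⁻¹) := by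
          gcongr
          exact hb v h0
      _ = ε / 2 := by field_simp
      _ < ε := half_lt_self hε
  · exact (hR.continuous.comp continuous_norm).continuousAt.smul
      (hg.differentiableAt h0).continuousAt

/-- A flat function of the norm times a homogeneous function. -/
theorem IsFlat.contDiff_radial (n : ℕ) : ∀ {W : Type} [NormedAddCommGroup W] [NormedSpace ℝ W]
    {m : ℕ} {R : ℝ → ℝ} {g : E → W}, IsFlat (n + m) R → IsHomogeneous m g →
    ContDiff ℝ n fun v => R ‖v‖ • g v := by
  induction n with
  | zero =>
    intro W _ _ m R g hR hg
    rw [zero_add] at hR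
    exact contDiff_zero.2 (hR.continuous_radial hg)
  | succ n ih =>
    intro W _ _ m R g hR hg
    have hR' : IsFlat (n + m + 1) R := by rwa [add_right_comm] at hR
    have hR1 : IsFlat (n + m) (deriv R) := hR'.2.2
    have hR2 : IsFlat (m + 1) R := by
      clear ih hR hR1
      induction n with
      | zero => rwa [zero_add] at hR'
      | succ n ih => exact ih (by rw [add_right_comm n 1 m] at hR'; exact hR'.of_succ)
    push_cast
    -- Both terms of the product rule are again flat times homogeneous: one order of flatness is
    -- lost for the same degree, or `R` is kept and the pole order rises by one. In each case `n`
    -- drops by one.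
    refine contDiff_succ_iff_hasFDerivAt.2 ⟨fun v => deriv R ‖v‖ •
      (fderiv ℝ (fun x : E => ‖x‖) v).smulRight (g v) + R ‖v‖ • fderiv ℝ g v,
      (ih hR1 hg.fderiv_norm_smulRight).add (ih (by rwa [← add_assoc]) hg.fderiv), fun v => ?_⟩
    rcases eq_or_ne v 0 with rfl | h0
    · refine (hR2.hasFDerivAt_zero hg).congr_fderiv ?_
      simp only [norm_zero, hR1.zero, hR'.zero, zero_smul, add_zero]
    · have h1 : HasFDerivAt (fun x : E => R ‖x‖) _ v :=
        (hR'.2.1 ‖v‖).hasDerivAt.comp_hasFDerivAt v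
          ((contDiffAt_norm ℝ h0 (n := 1)).differentiableAt (by simp)).hasFDerivAt
      refine (h1.smul (hg.differentiableAt h0).hasFDerivAt).congr_fderiv ?_
      rw [add_comm]
      congr 1
      ext x
      simp [mul_smul]

end Radial

open Polynomial in
/-- The even Taylor polynomial of an even function and the odd one of an odd function. -/
theorem exists_isFlat_sub (n : ℕ) :
    (∀ a : ℝ → ℝ, ContDiff ℝ n a → a.Even →
      ∃ q : ℝ[X], IsFlat n fun r => a r - q.eval (r ^ 2)) ∧
    ∀ b : ℝ → ℝ, ContDiff ℝ n b → b.Odd →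
      ∃ q : ℝ[X], IsFlat n fun r => b r - r * q.eval (r ^ 2) := by
  have hodd0 : ∀ b : ℝ → ℝ, b.Odd → b 0 = 0 := fun b hb => by
    have := hb 0
    rw [neg_zero] at this
    linarith
  induction n with
  | zero =>
    refine ⟨fun a ha _ => ⟨C (a 0), ?_⟩, fun b hb hb' => ⟨0, ?_⟩⟩
    · exact ⟨by have := ha.continuous; simp only [eval_C]; fun_prop, by simp⟩
    · exact ⟨by simpa using hb.continuous, by simp [hodd0 b hb']⟩
  | succ n ih =>
    have hsq : ∀ r : ℝ, HasDerivAt (fun r : ℝ => r ^ 2) (2 * r) r := fun r => by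
      simpa using hasDerivAt_pow 2 r
    refine ⟨fun a ha ha' => ?_, fun b hb hb' => ?_⟩
    · push_cast at ha
      have hd : Differentiable ℝ a := ha.differentiable (by simp)
      obtain ⟨q, hq⟩ := ih.2 (deriv a) ((contDiff_succ_iff_deriv.1 ha).2.2) fun x => by
        have h1 : (fun x => a (-x)) = a := funext ha'
        have h2 := deriv_comp_neg (f := a) x
        rw [h1] at h2
        rw [h2, neg_neg]
      -- Integration of the odd Taylor polynomial of `a'`: the derivative of `Q(r²)` is `2 r
      -- Q'(r²)`. The constant added to `Q` below makes the remainder vanish at `0`.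
      obtain ⟨Q, hQ⟩ : ∃ Q : ℝ[X], C 2 * derivative Q = q := by
        clear hq
        induction q using Polynomial.induction_on' with
        | add p q hp hq =>
          obtain ⟨P, rfl⟩ := hp
          obtain ⟨Q, rfl⟩ := hq
          exact ⟨P + Q, by simp; ring⟩
        | monomial j c =>
          refine ⟨monomial (j + 1) (c / (2 * (j + 1))), ?_⟩
          rw [derivative_monomial, C_mul_monomial]
          congr 1
          push_cast
          field_simp
      have hder : ∀ r, HasDerivAt (fun r => a r - (Q + C (a 0 - Q.eval 0)).eval (r ^ 2))
          (deriv a r - r * q.eval (r ^ 2)) r := fun r => by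
        refine ((hd r).hasDerivAt.sub (((Q + C (a 0 - Q.eval 0)).hasDerivAt _).comp r
          (hsq r))).congr_deriv ?_
        rw [← hQ]
        simp
        ring
      refine ⟨Q + C (a 0 - Q.eval 0), by simp, fun r => (hder r).differentiableAt, ?_⟩
      rwa [show deriv _ = _ from funext fun r => (hder r).deriv]
    · push_cast at hb
      have hd : Differentiable ℝ b := hb.differentiable (by simp)
      obtain ⟨q, hq⟩ := ih.1 (deriv b) ((contDiff_succ_iff_deriv.1 hb).2.2) fun x => by
        have h1 : (fun x => b (-x)) = fun x => -b x := funext hb'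
        have h2 := deriv_comp_neg (f := b) x
        rw [h1, deriv.fun_neg] at h2
        linarith
      -- The derivative of `r Q(r²)` is `Q(r²) + 2 r² Q'(r²)`; on monomials this is multiplication
      -- by `1 + 2 j`.
      obtain ⟨Q, hQ⟩ : ∃ Q : ℝ[X], Q + C 2 * X * derivative Q = q := by
        clear hq
        induction q using Polynomial.induction_on' with
        | add p q hp hq =>
          obtain ⟨P, rfl⟩ := hp
          obtain ⟨Q, rfl⟩ := hq
          exact ⟨P + Q, by simp; ring⟩
        | monomial j c =>
          refine ⟨monomial j (c / (1 + 2 * j)), ?_⟩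
          have h0 : (1 + 2 * (j : ℝ)) ≠ 0 := by positivity
          have h1 : X * derivative (monomial j (c / (1 + 2 * j))) =
              monomial j (c / (1 + 2 * (j : ℝ)) * j) := by
            rw [derivative_monomial]
            cases j with
            | zero => simp
            | succ j => rw [X_mul_monomial]; rfl
          rw [mul_assoc, h1, C_mul_monomial, ← map_add]
          congr 1
          field_simp
      have hder : ∀ r, HasDerivAt (fun r => b r - r * Q.eval (r ^ 2))
          (deriv b r - q.eval (r ^ 2)) r := fun r => by
        refine ((hd r).hasDerivAt.sub ((hasDerivAt_id r).mul ((Q.hasDerivAt _).comp r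
          (hsq r)))).congr_deriv ?_
        rw [← hQ]
        simp
        ring
      refine ⟨Q, by simp [hodd0 b hb'], fun r => (hder r).differentiableAt, ?_⟩
      rwa [show deriv _ = _ from funext fun r => (hder r).deriv]

section EvenOdd

variable {E : Type} [NormedAddCommGroup E] [InnerProductSpace ℝ E] [FiniteDimensional ℝ E]
  {k : ℕ∞}

/-- An even function of the norm is as smooth as the function. -/
theorem ContDiff.comp_norm_of_even {a : ℝ → ℝ} (ha : ContDiff ℝ k a) (ha' : a.Even) :
    ContDiff ℝ k fun v : E => a ‖v‖ := by
  refine contDiff_iff_forall_nat_le.2 fun n hn => ?_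
  -- The norm enters the polynomial part only through its square, and the flat remainder is smooth
  -- enough by `IsFlat.contDiff_radial`.
  obtain ⟨q, hq⟩ := (exists_isFlat_sub n).1 a (contDiff_iff_forall_nat_le.1 ha n hn) ha'
  have h1 : IsHomogeneous 0 (fun _ : E => (1 : ℝ)) := ⟨contDiffOn_const, by simp⟩
  have h2 := IsFlat.contDiff_radial n (m := 0) hq h1
  have h3 : ContDiff ℝ n fun v : E => q.eval (‖v‖ ^ 2) := (q.contDiff_aeval n).comp (contDiff_norm_sq ℝ)
  convert! h2.add h3 using 1
  funext v
  simp

/-- The radial vector field with an odd profile is as smooth as the profile. -/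
theorem ContDiff.radial_of_odd {b : ℝ → ℝ} (hb : ContDiff ℝ k b) (hb' : b.Odd) :
    ContDiff ℝ k fun v : E => b ‖v‖ • ‖v‖⁻¹ • v := by
  refine contDiff_iff_forall_nat_le.2 fun n hn => ?_
  obtain ⟨q, hq⟩ := (exists_isFlat_sub n).2 b (contDiff_iff_forall_nat_le.1 hb n hn) hb'
  have h1 : IsHomogeneous 0 (fun v : E => ‖v‖⁻¹ • v) := by
    refine ⟨fun v hv => (((contDiffAt_norm ℝ hv).inv (norm_ne_zero_iff.2 hv)).smul
      contDiffAt_id).contDiffWithinAt, fun t v ht hv => ?_⟩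
    rw [norm_smul, Real.norm_eq_abs, abs_of_pos ht, mul_inv, smul_smul, pow_zero, inv_one, one_smul]
    congr 1
    field_simp
  have h2 := IsFlat.contDiff_radial n (m := 0) hq h1
  have h3 : ContDiff ℝ n fun v : E => q.eval (‖v‖ ^ 2) • v :=
    ((q.contDiff_aeval n).comp (contDiff_norm_sq ℝ)).smul contDiff_id
  convert! h2.add h3 using 1
  funext v
  rcases eq_or_ne v 0 with rfl | hv
  · simp
  · have : ‖v‖ ≠ 0 := norm_ne_zero_iff.2 hv
    simp only [smul_smul, ← add_smul]
    congr 1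
    field_simp
    ring

end EvenOdd

/-! ### The perturbation map as a `C^k` map of the quaternions -/

namespace IsPerturbationFunction

variable {k : ℕ∞} {f : ℝ → ℝ}

/-- Replacing the angle `α` by `π - α` exchanges the poles `1` and `-1`, so the chart at one pole
also serves the other. -/
theorem reflect (hf : IsPerturbationFunction k f) :
    IsPerturbationFunction k fun x => f (Real.pi - x) := by
  refine ⟨hf.contDiff.comp (contDiff_const.sub contDiff_id), fun x => ?_, fun x => ?_⟩
  · have h1 := hf.odd (Real.pi - x)
    have h2 := hf.periodic (-(Real.pi - x))
    rw [← h1, ← h2]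
    congr 1
    ring
  · have h2 := hf.periodic (Real.pi - (x + 2 * Real.pi))
    rw [← h2]
    congr 1
    ring

end IsPerturbationFunction

/-- The real part of a quaternion, as a continuous linear map. -/
noncomputable def Quaternion.reL : ℍ[ℝ] →L[ℝ] ℝ :=
  LinearMap.toContinuousLinearMap
    { toFun := fun q => q.re, map_add' := fun _ _ => rfl, map_smul' := fun _ _ => rfl }

theorem Quaternion.reL_apply (q : ℍ[ℝ]) : Quaternion.reL q = q.re := rfl

/-- The extension of `cos α + sin α • Q ↦ cos (f α) + sin (f α) • Q` by means of stereographic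
projection from `-1`. -/
noncomputable def stereoExt (f : ℝ → ℝ) (q : ℍ[ℝ]) : ℍ[ℝ] :=
  (Real.cos (f (2 * Real.arctan ‖(1 + q.re)⁻¹ • (q - (q.re : ℍ[ℝ]))‖)) : ℍ[ℝ]) +
    Real.sin (f (2 * Real.arctan ‖(1 + q.re)⁻¹ • (q - (q.re : ℍ[ℝ]))‖)) •
      ‖(1 + q.re)⁻¹ • (q - (q.re : ℍ[ℝ]))‖⁻¹ • ((1 + q.re)⁻¹ • (q - (q.re : ℍ[ℝ])))

theorem contDiff_quaternion_coe {n : WithTop ℕ∞} : ContDiff ℝ n fun x : ℝ => (x : ℍ[ℝ]) := by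
  have : (fun x : ℝ => (x : ℍ[ℝ])) = fun x => x • (1 : ℍ[ℝ]) := by
    funext x
    rw [← Algebra.algebraMap_eq_smul_one]
    rfl
  rw [this]
  exact contDiff_id.smul contDiff_const

section Perturbation

variable {k : ℕ∞} {f : ℝ → ℝ} (hf : IsPerturbationFunction k f)
include hf

/-- In the stereographic coordinate `w` the angle is `2 arctan ‖w‖`. As `f` is odd, the cosine term
is an even function of `‖w‖` and the sine term a radial field with odd profile. -/
theorem contDiffAt_stereoExt {q : ℍ[ℝ]} (hq : 1 + q.re ≠ 0) :
    ContDiffAt ℝ k (stereoExt f) q := by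
  have hodd : ∀ s, f (2 * Real.arctan (-s)) = -f (2 * Real.arctan s) := fun s => by
    rw [Real.arctan_neg, mul_neg, hf.odd]
  have hc : ContDiff ℝ k fun s => f (2 * Real.arctan s) :=
    hf.contDiff.comp (contDiff_const.mul Real.contDiff_arctan)
  have hA : ContDiff ℝ k fun w : ℍ[ℝ] => Real.cos (f (2 * Real.arctan ‖w‖)) :=
    ContDiff.comp_norm_of_even (a := fun s => Real.cos (f (2 * Real.arctan s)))
      (Real.contDiff_cos.comp hc) fun s => by simp only [hodd, Real.cos_neg]
  have hB : ContDiff ℝ k fun w : ℍ[ℝ] => Real.sin (f (2 * Real.arctan ‖w‖)) • ‖w‖⁻¹ • w :=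
    ContDiff.radial_of_odd (b := fun s => Real.sin (f (2 * Real.arctan s)))
      (Real.contDiff_sin.comp hc) fun s => by simp only [hodd, Real.sin_neg]
  have hre : ContDiff ℝ k fun q : ℍ[ℝ] => q.re := Quaternion.reL.contDiff
  have hw : ContDiffAt ℝ k (fun q : ℍ[ℝ] => (1 + q.re)⁻¹ • (q - (q.re : ℍ[ℝ]))) q :=
    ((contDiff_const.add hre).contDiffAt.inv hq).smul
      (contDiff_id.sub (contDiff_quaternion_coe.comp hre)).contDiffAt
  exact ((contDiff_quaternion_coe.comp hA).add hB).contDiffAt.comp q hw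

theorem stereoExt_apply {α : ℝ} {Q : ℍ[ℝ]} (hQ : Q.re = 0) (hQ' : ‖Q‖ = 1)
    (hα : Real.cos α ≠ -1) : stereoExt f ((Real.cos α : ℍ[ℝ]) + Real.sin α • Q) =
      (Real.cos (f α) : ℍ[ℝ]) + Real.sin (f α) • Q := by
  have hre : ((Real.cos α : ℍ[ℝ]) + Real.sin α • Q).re = Real.cos α := by simp [hQ]
  obtain ⟨β, hβ, n, rfl⟩ : ∃ β ∈ Ioc (-Real.pi) Real.pi, ∃ n : ℤ, α = β + n * (2 * Real.pi) :=
    ⟨toIocMod Real.two_pi_pos (-Real.pi) α, by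
      have := toIocMod_mem_Ioc Real.two_pi_pos (-Real.pi) α
      rwa [show -Real.pi + 2 * Real.pi = Real.pi by ring] at this,
      toIocDiv Real.two_pi_pos (-Real.pi) α, by
      have := toIocMod_add_toIocDiv_zsmul Real.two_pi_pos (-Real.pi) α
      rw [zsmul_eq_mul] at this
      exact this.symm⟩
  have hβπ : β ≠ Real.pi := by
    rintro rfl
    refine hα ?_
    rw [Real.cos_add_int_mul_two_pi, Real.cos_pi]
  have h1 : -(Real.pi / 2) < β / 2 := by linarith [hβ.1]
  have h2 : β / 2 < Real.pi / 2 := by linarith [lt_of_le_of_ne hβ.2 hβπ]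
  have hcos : 0 < Real.cos (β / 2) := Real.cos_pos_of_mem_Ioo ⟨h1, h2⟩
  have hper : f (β + n * (2 * Real.pi)) = f β := by
    simpa using (hf.periodic.int_mul n) β
  rw [hper, Real.cos_add_int_mul_two_pi, Real.sin_add_int_mul_two_pi]
  rw [Real.cos_add_int_mul_two_pi, Real.sin_add_int_mul_two_pi] at hre
  set T := Real.tan (β / 2) with hT
  have hw : (1 + Real.cos β)⁻¹ • ((Real.cos β : ℍ[ℝ]) + Real.sin β • Q - (Real.cos β : ℍ[ℝ])) =
      T • Q := by
    rw [add_sub_cancel_left, smul_smul]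
    congr 1
    have e1 : β = 2 * (β / 2) := by ring
    rw [hT, Real.tan_eq_sin_div_cos]
    conv_lhs => rw [e1, Real.cos_two_mul, Real.sin_two_mul]
    field_simp
    ring
  have hβT : 2 * Real.arctan T = β := by
    rw [hT, Real.arctan_tan h1 h2]; ring
  rw [stereoExt, hre, hw, norm_smul, hQ', mul_one, Real.norm_eq_abs]
  -- For negative `T` the norm of `w` is `-T`, so the formula sees the angle `-β` and the axis `-Q`;
  -- oddness of `f` makes the result the same.
  have hodd : f (2 * Real.arctan (-T)) = -f β := by
    rw [Real.arctan_neg, mul_neg, hf.odd, hβT]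
  rcases lt_trichotomy T 0 with h | h | h
  · rw [abs_of_neg h, hodd, Real.cos_neg, Real.sin_neg, smul_smul, smul_smul]
    have h0 : T ≠ 0 := h.ne
    congr 2
    field_simp
  · have hβ0 : β = 0 := by rw [← hβT, h, Real.arctan_zero, mul_zero]
    have hf0 : f 0 = 0 := by
      have := hf.odd 0
      rw [neg_zero] at this
      linarith
    simp [h, hβ0, hf0]
  · rw [abs_of_pos h, hβT, smul_smul, smul_smul]
    congr 2
    field_simp

/-- The perturbation map extends to a `C^k` map of the quaternions. -/
theorem exists_contDiff_perturbation : ∃ P : ℍ[ℝ] → ℍ[ℝ], ContDiff ℝ k P ∧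
    ∀ (α : ℝ) (Q : ℍ[ℝ]), Q.re = 0 → ‖Q‖ = 1 → P ((Real.cos α : ℍ[ℝ]) + Real.sin α • Q) =
      (Real.cos (f α) : ℍ[ℝ]) + Real.sin (f α) • Q := by
  -- The cutoff vanishes near `-1`, where the first chart fails, and equals `1` near `1`, where the
  -- second one does.
  let χ : ℍ[ℝ] → ℝ := fun q => Real.smoothTransition (q.re + 1 / 2)
  have hre : ContDiff ℝ k fun q : ℍ[ℝ] => q.re := Quaternion.reL.contDiff
  have hχ : ContDiff ℝ k χ := Real.smoothTransition.contDiff.comp (hre.add contDiff_const)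
  have hχ0 : ∀ q : ℍ[ℝ], q.re ≤ -1 / 2 → χ q = 0 := fun q hq =>
    Real.smoothTransition.zero_of_nonpos (by linarith)
  have hχ1 : ∀ q : ℍ[ℝ], 1 / 2 ≤ q.re → χ q = 1 := fun q hq =>
    Real.smoothTransition.one_of_one_le (by linarith)
  let g := fun x => f (Real.pi - x)
  -- Changing the sign of the real part turns the angle `α` into `π - α` with the same axis.
  have hstar : ContDiff ℝ k fun q : ℍ[ℝ] => q - (2 * q.re : ℝ) • (1 : ℍ[ℝ]) :=
    contDiff_id.sub ((contDiff_const.mul hre).smul contDiff_const)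
  refine ⟨fun q => χ q • stereoExt f q + (1 - χ q) • stereoExt g (q - (2 * q.re : ℝ) • 1),
    contDiff_iff_contDiffAt.2 fun q => ?_, fun α Q hQ hQ' => ?_⟩
  · refine ContDiffAt.add ?_ ?_
    · by_cases hq : q.re < -1 / 2
      · refine contDiffAt_const (c := (0 : ℍ[ℝ])) |>.congr_of_eventuallyEq ?_
        filter_upwards [(isOpen_lt Quaternion.reL.continuous continuous_const).mem_nhds
          (show Quaternion.reL q < -1 / 2 from hq)] with p hp
        rw [hχ0 p (le_of_lt hp), zero_smul]
      · exact hχ.contDiffAt.smul (contDiffAt_stereoExt hf (by linarith))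
    · by_cases hq : 1 / 2 < q.re
      · refine contDiffAt_const (c := (0 : ℍ[ℝ])) |>.congr_of_eventuallyEq ?_
        filter_upwards [(isOpen_lt continuous_const Quaternion.reL.continuous).mem_nhds
          (show 1 / 2 < Quaternion.reL q from hq)] with p hp
        rw [hχ1 p (le_of_lt hp), sub_self, zero_smul]
      · refine (contDiff_const.sub hχ).contDiffAt.smul ?_
        refine (contDiffAt_stereoExt hf.reflect ?_).comp q hstar.contDiffAt
        simp
        linarith
  · have hre : ((Real.cos α : ℍ[ℝ]) + Real.sin α • Q).re = Real.cos α := by simp [hQ]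
    set q := (Real.cos α : ℍ[ℝ]) + Real.sin α • Q with hq
    have h1 : χ q • stereoExt f q = χ q • ((Real.cos (f α) : ℍ[ℝ]) + Real.sin (f α) • Q) := by
      by_cases hα : Real.cos α = -1
      · rw [hχ0 q (by rw [hre, hα]; norm_num), zero_smul, zero_smul]
      · rw [stereoExt_apply hf hQ hQ' hα]
    have h2 : (1 - χ q) • stereoExt g (q - (2 * q.re : ℝ) • 1) =
        (1 - χ q) • ((Real.cos (f α) : ℍ[ℝ]) + Real.sin (f α) • Q) := by
      by_cases hα : Real.cos α = 1
      · rw [hχ1 q (by rw [hre, hα]; norm_num), sub_self, zero_smul, zero_smul]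
      · have e : q - (2 * q.re : ℝ) • (1 : ℍ[ℝ]) =
            (Real.cos (Real.pi - α) : ℍ[ℝ]) + Real.sin (Real.pi - α) • Q := by
          rw [Real.cos_pi_sub, Real.sin_pi_sub, hre, hq]
          ext <;> simp
          ring
        rw [e, stereoExt_apply hf.reflect hQ hQ' (by
          rw [Real.cos_pi_sub]
          exact fun h => hα (neg_injective h))]
        simp only [sub_sub_cancel]
    dsimp only
    rw [h1, h2, ← add_smul, add_sub_cancel, one_smul]

omit hf in
theorem Quaternion.exists_polar {q : ℍ[ℝ]} (hq : ‖q‖ = 1) : ∃ (α : ℝ) (Q : ℍ[ℝ]), Q.re = 0 ∧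
    ‖Q‖ = 1 ∧ q = (Real.cos α : ℍ[ℝ]) + Real.sin α • Q := by
  have hn : q.re ^ 2 + ‖q.im‖ ^ 2 = 1 := by
    have h1 := Quaternion.normSq_eq_norm_mul_self q
    have h2 := Quaternion.normSq_eq_norm_mul_self q.im
    rw [hq] at h1
    rw [Quaternion.normSq_def'] at h1 h2
    simp at h2
    nlinarith
  have hcos : Real.cos (Real.arccos q.re) = q.re :=
    Real.cos_arccos (by nlinarith [sq_nonneg ‖q.im‖]) (by nlinarith [sq_nonneg ‖q.im‖])
  have hsin : Real.sin (Real.arccos q.re) = ‖q.im‖ := by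
    rw [Real.sin_arccos, show 1 - q.re ^ 2 = ‖q.im‖ ^ 2 by linarith, Real.sqrt_sq (norm_nonneg _)]
  by_cases h : q.im = 0
  · refine ⟨Real.arccos q.re, ((Complex.I : ℂ) : ℍ[ℝ]), by simp, ?_, ?_⟩
    · have h1 := Quaternion.normSq_eq_norm_mul_self ((Complex.I : ℂ) : ℍ[ℝ])
      rw [Quaternion.normSq_def'] at h1
      simp at h1
      nlinarith [norm_nonneg ((Complex.I : ℂ) : ℍ[ℝ])]
    · rw [hcos, hsin, h, norm_zero, zero_smul, add_zero]
      conv_lhs => rw [← Quaternion.re_add_im q, h, add_zero]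
  · have h0 : ‖q.im‖ ≠ 0 := norm_ne_zero_iff.2 h
    refine ⟨Real.arccos q.re, ‖q.im‖⁻¹ • q.im, by simp, ?_, ?_⟩
    · rw [norm_smul, norm_inv, norm_norm, inv_mul_cancel₀ h0]
    · rw [hcos, hsin, smul_inv_smul₀ h0, Quaternion.re_add_im]

end Perturbation

/-! ### Restriction of representations with a `C^k` inverse -/

namespace RepSpace

variable {G G' : Type*} [Group G] [Group G']

theorem continuous_apply (a : G) : Continuous fun ρ : RepSpace G => ρ a :=
  (_root_.continuous_apply a).comp continuous_induced_dom

theorem continuous_iff {X : Type*} [TopologicalSpace X] {g : X → RepSpace G} :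
    Continuous g ↔ ∀ a, Continuous fun x => g x a :=
  continuous_induced_rng.trans continuous_pi_iff

theorem comap_apply (φ : G' →* G) (ρ : RepSpace G) (a : G') : comap φ ρ a = ρ (φ a) := rfl

theorem continuous_comap (φ : G' →* G) : Continuous (comap φ) :=
  continuous_iff.2 fun a => continuous_apply (φ a)

theorem comap_smul (φ : G' →* G) (g : SU2) (ρ : RepSpace G) :
    comap φ (g • ρ) = g • comap φ ρ := rfl

/-- An `SU(2)`-valued function that is a `C^k` function of finitely many values of the
representation. -/
def IsCk (k : ℕ∞) (u : RepSpace G → SU2) : Prop :=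
  ∃ (m : ℕ) (s : Fin m → G) (Φ : (Fin m → ℍ[ℝ]) → ℍ[ℝ]), ContDiff ℝ k Φ ∧
    ∀ χ, (u χ : ℍ[ℝ]) = Φ fun i => (χ (s i) : ℍ[ℝ])

theorem IsCk.continuous {k : ℕ∞} {u : RepSpace G → SU2} (hu : IsCk k u) : Continuous u := by
  obtain ⟨m, s, Φ, hΦ, h⟩ := hu
  refine continuous_induced_rng.2 ?_
  have : Subtype.val ∘ u = fun χ => Φ fun i => (χ (s i) : ℍ[ℝ]) := funext h
  rw [this]
  exact hΦ.continuous.comp (continuous_pi fun i =>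
    continuous_subtype_val.comp (continuous_apply (s i)))

end RepSpace

namespace CharVar

variable {Γ Δ : Type*} [Group Γ] [Group Δ] {P : Set (RepSpace Δ)}

theorem mk_eq_mk {ρ ρ' : P} : mk ρ = mk ρ' ↔ ∃ g : SU2, g • (ρ' : RepSpace Δ) = ρ :=
  Quotient.eq.trans Iff.rfl

theorem exists_mk (q : CharVar P) : ∃ ρ : P, mk ρ = q := Quotient.exists_rep q

theorem continuous_mk : Continuous (mk : P → CharVar P) := continuous_quotient_mk'

theorem restrict_mk (φ : Γ →* Δ) (ρ : P) :
    restrict φ P (mk ρ) = mk ⟨RepSpace.comap φ ρ, mem_univ _⟩ := rfl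

theorem continuous_restrict (φ : Γ →* Δ) : Continuous (restrict φ P) :=
  continuous_quot_lift _ (continuous_mk.comp
    (((RepSpace.continuous_comap φ).comp continuous_subtype_val).subtype_mk _))

section Extension

variable {φ : Γ →* Δ} {k : ℕ∞} {ext : RepSpace Γ → RepSpace Δ}
  (hP : ∀ (g : SU2), ∀ ρ ∈ P, g • ρ ∈ P)
  (hcomap : ∀ χ, RepSpace.comap φ (ext χ) = χ) (hmem : ∀ χ, ext χ ∈ P)
  (hext : ∀ ρ ∈ P, ext (RepSpace.comap φ ρ) = ρ) (hCk : ∀ q, RepSpace.IsCk k fun χ => ext χ q)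

include hP hcomap hmem hext

/-- Both sides lie in `P` and restrict to `g • χ`, and by `hext` elements of `P` are determined by
their restriction. -/
theorem extension_smul (g : SU2) (χ : RepSpace Γ) : ext (g • χ) = g • ext χ := by
  have h := hext _ (hP g _ (hmem χ))
  rwa [RepSpace.comap_smul, hcomap] at h

theorem stabilizer_extension (χ : RepSpace Γ) :
    MulAction.stabilizer SU2 (ext χ) = MulAction.stabilizer SU2 χ := by
  ext g
  rw [MulAction.mem_stabilizer_iff, MulAction.mem_stabilizer_iff]
  constructor
  · intro h
    have := congrArg (RepSpace.comap φ) h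
    rwa [RepSpace.comap_smul, hcomap] at this
  · intro h
    rw [← extension_smul hP hcomap hmem hext, h]

theorem bijective_restrict : Function.Bijective (restrict φ P) := by
  constructor
  · intro q q' h
    obtain ⟨ρ, rfl⟩ := exists_mk q
    obtain ⟨ρ', rfl⟩ := exists_mk q'
    rw [restrict_mk, restrict_mk, mk_eq_mk] at h
    obtain ⟨g, hg⟩ := h
    refine mk_eq_mk.2 ⟨g, ?_⟩
    rw [← hext _ (hP g _ ρ'.2), RepSpace.comap_smul]
    exact (congrArg ext hg).trans (hext _ ρ.2)
  · intro q
    obtain ⟨χ, rfl⟩ := exists_mk q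
    refine ⟨mk ⟨ext χ, hmem _⟩, ?_⟩
    rw [restrict_mk]
    exact congrArg mk (Subtype.ext (hcomap _))

theorem restrict_mem_stratum_iff (H : Subgroup SU2) (q : CharVar P) :
    restrict φ P q ∈ stratum univ H ↔ q ∈ stratum P H := by
  constructor
  · rintro ⟨χ, hχ, hH⟩
    refine ⟨⟨ext χ, hmem _⟩, (bijective_restrict hP hcomap hmem hext).1 ?_, ?_⟩
    · rw [← hχ, restrict_mk]
      exact congrArg mk (Subtype.ext (hcomap _))
    · rw [← hH]
      exact stabilizer_extension hP hcomap hmem hext χ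
  · rintro ⟨ρ, rfl, hH⟩
    refine ⟨_, (restrict_mk φ ρ).symm, ?_⟩
    rw [← hH, ← stabilizer_extension hP hcomap hmem hext, hext _ ρ.2]

include hCk

omit hP hcomap hmem hext in
theorem continuous_extension : Continuous ext :=
  RepSpace.continuous_iff.2 fun q => (hCk q).continuous

theorem isHomeomorph_restrict : IsHomeomorph (restrict φ P) := by
  have hbij := bijective_restrict hP hcomap hmem hext
  refine ⟨continuous_restrict φ, ?_, hbij⟩
  have hc := continuous_extension hCk
  let g : CharVar (univ : Set (RepSpace Γ)) → CharVar P :=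
    Quotient.lift (fun χ => mk ⟨ext χ, hmem _⟩) (by
      rintro χ χ' ⟨g, hg⟩
      refine mk_eq_mk.2 ⟨g, ?_⟩
      rw [← extension_smul hP hcomap hmem hext]
      exact congrArg ext hg)
  have hg : Continuous g := continuous_quot_lift _
    (continuous_mk.comp ((hc.comp continuous_subtype_val).subtype_mk _))
  have hgr : Function.LeftInverse (restrict φ P) g := fun q => by
    obtain ⟨χ, rfl⟩ := exists_mk q
    exact congrArg mk (Subtype.ext (hcomap _))
  exact IsOpenMap.of_inverse hg hgr (hgr.rightInverse_of_injective hbij.1)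

/-- In one direction the group elements are pushed forward along `φ`; in the other each value of
`ext χ` is replaced by its `C^k` expression in values of `χ`. -/
theorem isCkOn_restrict_iff (H : Subgroup SU2) (u : CharVar (univ : Set (RepSpace Γ)) → ℝ) :
    IsCkOn k (stratum univ H) u ↔ IsCkOn k (stratum P H) (u ∘ restrict φ P) := by
  have hS := restrict_mem_stratum_iff hP hcomap hmem hext H
  constructor
  · intro h ρ₀ hρ₀
    obtain ⟨m, s, Φ, hΦ, hev⟩ := h ⟨RepSpace.comap φ ρ₀, mem_univ _⟩ ((hS _).2 hρ₀)
    refine ⟨m, φ ∘ s, Φ, hΦ, ?_⟩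
    have hc : Continuous fun ρ : P => (⟨RepSpace.comap φ ρ, mem_univ _⟩ :
        (univ : Set (RepSpace Γ))) :=
      ((RepSpace.continuous_comap φ).comp continuous_subtype_val).subtype_mk _
    filter_upwards [(hc.tendsto ρ₀).eventually hev] with ρ hρ hρS
    exact hρ ((hS _).2 hρS)
  · intro h χ₀ hχ₀
    have hr : ∀ χ : (univ : Set (RepSpace Γ)), restrict φ P (mk ⟨ext χ, hmem _⟩) = mk χ :=
      fun χ => congrArg mk (Subtype.ext (hcomap _))
    obtain ⟨m, s, Φ, hΦ, hev⟩ := h ⟨ext χ₀, hmem _⟩ ((hS _).1 (by rwa [hr]))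
    choose M S Ψ hΨ hS' using fun i => hCk (s i)
    let ε := Fintype.equivFin (Σ i, Fin (M i))
    refine ⟨_, fun j => S (ε.symm j).1 (ε.symm j).2,
      fun v => Φ fun i => Ψ i fun j => v (ε ⟨i, j⟩),
      hΦ.comp (contDiff_pi.2 fun i => (hΨ i).comp (contDiff_pi.2 fun j => contDiff_apply _ _ _)), ?_⟩
    have hc : Continuous fun χ : (univ : Set (RepSpace Γ)) => (⟨ext χ, hmem _⟩ : P) :=
      ((continuous_extension hCk).comp continuous_subtype_val).subtype_mk _
    filter_upwards [(hc.tendsto χ₀).eventually hev] with χ hχ hχS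
    have h1 := hχ ((hS _).1 (by rwa [hr]))
    rw [Function.comp_apply, hr] at h1
    rw [h1]
    congr 1
    funext i
    rw [hS' i]
    congr 1
    funext j
    rw [Equiv.symm_apply_apply]

/-- Restriction along a homomorphism is an isomorphism of character varieties if it has an inverse
that is given by `C^k` functions. -/
theorem isIso_restrict : IsHomeomorph (restrict φ P) ∧ ∀ H : Subgroup SU2,
    IsCkDiffeoOn k (restrict φ P) (stratum P H) (stratum univ H) := by
  have hbij := bijective_restrict hP hcomap hmem hext
  have hS := restrict_mem_stratum_iff hP hcomap hmem hext
  refine ⟨isHomeomorph_restrict hP hcomap hmem hext hCk, fun H =>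
    ⟨⟨fun q hq => (hS H q).2 hq, hbij.1.injOn, fun q hq => ?_⟩,
      isCkOn_restrict_iff hP hcomap hmem hext hCk H⟩⟩
  obtain ⟨q, rfl⟩ := hbij.2 q
  exact ⟨q, (hS H q).1 hq, rfl⟩

end Extension

end CharVar

/-- Every point of a surface lies in a simply connected open set. -/
theorem exists_isOpen_simplyConnectedSpace {F : Type*} [TopologicalSpace F]
    [ChartedSpace (EuclideanSpace ℝ (Fin 2)) F] (x : F) :
    ∃ B : Set F, IsOpen B ∧ x ∈ B ∧ SimplyConnectedSpace B := by
  let φ := chartAt (EuclideanSpace ℝ (Fin 2)) x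
  obtain ⟨r, hr, hB⟩ := Metric.isOpen_iff.1 φ.open_target (φ x) (mem_chart_target _ x)
  have hB' : IsOpen (φ.symm '' Metric.ball (φ x) r) :=
    φ.symm.isOpen_image_of_subset_source Metric.isOpen_ball hB
  refine ⟨_, hB', ⟨φ x, Metric.mem_ball_self hr, φ.left_inv (mem_chart_source _ x)⟩, ?_⟩
  let e := φ.symm.homeomorphOfImageSubsetSource hB rfl
  have : ContractibleSpace (Metric.ball (φ x) r) :=
    (convex_ball _ _).contractibleSpace ⟨_, Metric.mem_ball_self hr⟩
  have : ContractibleSpace (φ.symm '' Metric.ball (φ x) r) :=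
    e.symm.contractibleSpace
  infer_instance

/-! ### Connectedness of the exterior -/

namespace Collar

variable {F : Type*} [TopologicalSpace F] (K : Collar F)

theorem joined_lower (y : K.space) : ∃ z ∈ K.lower, Joined z y := by
  by_cases hy : y ∈ K.lower
  · exact ⟨y, hy, Joined.refl y⟩
  obtain ⟨⟨⟨z, b⟩, hzb⟩, hy2⟩ := K.mem_upper_of_notMem_lower hy
  let p : I → K.space := fun t => ⟨(K.toFun (z, b + t * (1 - b)), y.1.2), y.2.1, fun h => by
    linarith [h.2]⟩
  have hp : Continuous p := by
    have := K.continuous_toFun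
    fun_prop
  refine ⟨p 1, fun h => ?_, (Joined.symm ⟨⟨p, hp⟩, ?_, rfl⟩)⟩
  · have := K.mem_core_iff.1 h
    simp at this
  · refine Subtype.ext (Prod.ext ?_ rfl)
    change K.toFun (z, b + (0 : ℝ) * (1 - b)) = _
    rw [zero_mul, add_zero, hzb]

theorem pathConnectedSpace_space [PathConnectedSpace F] : PathConnectedSpace K.space := by
  have key : ∀ y : K.space, ∃ x, Joined (K.bottom x) y := fun y => by
    obtain ⟨z, hz, hzy⟩ := K.joined_lower y
    exact ⟨_, Joined.trans ⟨K.vert z hz⟩ hzy⟩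
  obtain ⟨x₀⟩ := ‹PathConnectedSpace F›.nonempty
  refine ⟨⟨K.bottom x₀⟩, fun y y' => ?_⟩
  obtain ⟨x, hx⟩ := key y
  obtain ⟨x', hx'⟩ := key y'
  exact hx.symm.trans (Joined.trans ⟨(PathConnectedSpace.somePath x x').map K.bottom.continuous⟩ hx')

end Collar

theorem PushedInTube.pathConnectedSpace_exterior {F : Type*} [TopologicalSpace F] [T2Space F]
    [PathConnectedSpace F] [ChartedSpace (EuclideanSpace ℝ (Fin 2)) F] [IsManifold (𝓡 2) ∞ F]
    {C : Circle → F} (N : PushedInTube C) : PathConnectedSpace N.exterior := by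
  obtain ⟨K, ρ, -, hρ0, -, -, hKρ⟩ := N.exists_collar
  have hK : ∀ z, K.toFun (z, 0) = C z := fun z => by rw [hKρ, hρ0, collarMap_zero]
  have := K.pathConnectedSpace_space
  exact Function.Surjective.pathConnectedSpace
    (f := N.retraction K hK) (fun x => ⟨_, N.retraction_inclusion K hK x⟩)
    (N.retraction K hK).continuous

/-! ### From holonomies to homomorphisms of fundamental groups -/

namespace Holonomy

variable {Y Z : Type*} [TopologicalSpace Y] [TopologicalSpace Z] {G G' : Type*} [Group G] [Group G']

/-- The image of a holonomy under a homomorphism of groups. -/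
def mapHom (c : Holonomy Y G) (φ : G →* G') : Holonomy Y G' where
  toFun p := φ (c p)
  map_trans' p q := by rw [c.map_trans, map_mul]
  map_homotopic' h := by rw [c.map_homotopic h]

theorem hom_mulEquivOfPath (c : Holonomy Y G) {y y' : Y} (p : Path y y')
    (a : FundamentalGroup Y y) :
    c.hom y' (FundamentalGroup.fundamentalGroupMulEquivOfPath p a) =
      c p * c.hom y a * (c p)⁻¹ := by
  refine Quotient.inductionOn a fun q => ?_
  have h : FundamentalGroup.fundamentalGroupMulEquivOfPath p
      (FundamentalGroup.fromPath (Path.Homotopic.Quotient.mk q)) =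
      FundamentalGroup.fromPath (Path.Homotopic.Quotient.mk (p.symm.trans (q.trans p))) := rfl
  refine (congrArg (c.hom y') h).trans ?_
  rw [hom_mk, map_trans, map_trans, map_symm]
  rfl

theorem hom_map (c : Holonomy Z G) (f : C(Y, Z)) (y : Y) (a : FundamentalGroup Y y) :
    c.hom (f y) (FundamentalGroup.map f y a) = (c.comap f).hom y a :=
  Quotient.inductionOn a fun _ => rfl

theorem exists_hom_apply_eq {y a b : Y} (p : Path a b) (q : Path y a) (r : Path y b) :
    ∃ l : FundamentalGroup Y y, ∀ c : Holonomy Y G, c.hom y l = (c r)⁻¹ * c p * c q :=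
  ⟨FundamentalGroup.fromPath (Path.Homotopic.Quotient.mk ((q.trans p).trans r.symm)), fun c => by
    rw [hom_mk, map_trans, map_trans, map_symm, mul_assoc]⟩

/-- Holonomies that induce the same homomorphism at a base point are gauge equivalent. -/
theorem gauge_eq_of_hom_eq (c c' : Holonomy Y G) {y : Y} (h : c.hom y = c'.hom y)
    (r : ∀ z, Path y z) {a b : Y} (p : Path a b) :
    c'.gauge (fun z => c (r z) * (c' (r z))⁻¹) p = c p := by
  obtain ⟨l, hl⟩ := exists_hom_apply_eq (G := G) p (r a) (r b)
  have h1 := hl c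
  rw [h, hl c'] at h1
  rw [gauge_apply]
  have h2 : c' p = c' (r b) * ((c (r b))⁻¹ * c p * c (r a)) * (c' (r a))⁻¹ := by
    rw [← h1]; group
  rw [h2]
  group

end Holonomy

theorem Quaternion.re_mul_comm (p q : ℍ[ℝ]) : (p * q).re = (q * p).re := by
  rw [Quaternion.re_mul, Quaternion.re_mul]
  ring

theorem Quaternion.norm_cos_add_sin_smul (α : ℝ) {Q : ℍ[ℝ]} (hQ : Q.re = 0) (hQ' : ‖Q‖ = 1) :
    ‖(Real.cos α : ℍ[ℝ]) + Real.sin α • Q‖ = 1 := by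
  have h1 := Quaternion.normSq_eq_norm_mul_self Q
  have h2 := Quaternion.normSq_eq_norm_mul_self ((Real.cos α : ℍ[ℝ]) + Real.sin α • Q)
  rw [hQ', Quaternion.normSq_def', hQ] at h1
  rw [Quaternion.normSq_def'] at h2
  simp [hQ] at h2
  have h3 := Real.sin_sq_add_cos_sq α
  have h4 : ‖(Real.cos α : ℍ[ℝ]) + Real.sin α • Q‖ ^ 2 = 1 ^ 2 := by
    linear_combination -h2 + h3 + Real.sin α ^ 2 * h1
  exact (pow_left_inj₀ (norm_nonneg _) zero_le_one two_ne_zero).1 h4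

/-- Conjugation changes the axis to another imaginary unit and keeps the angle, so the relation for
the axis `g⁻¹ Q g` gives the one for `Q`. -/
theorem PerturbationRelation.conj {f : ℝ → ℝ} {l m : SU2} (h : PerturbationRelation f l m)
    (g : SU2) : PerturbationRelation f (g * l * g⁻¹) (g * m * g⁻¹) := by
  intro α Q hQ hQ' hl
  have hg : (g : ℍ[ℝ]) ≠ 0 := ne_zero_of_mem_unit_sphere g
  simp only [Metric.unitSphere.coe_mul, Metric.unitSphere.coe_inv] at hl ⊢
  have key : ∀ a b : ℝ, (g : ℍ[ℝ]) * ((a : ℍ[ℝ]) + b • ((g : ℍ[ℝ])⁻¹ * Q * g)) * (g : ℍ[ℝ])⁻¹ =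
      a + b • Q := fun a b => by
    rw [mul_add, add_mul, ← Quaternion.coe_commutes, mul_assoc (a : ℍ[ℝ]), mul_inv_cancel₀ hg,
      mul_one, mul_smul_comm, smul_mul_assoc]
    congr 2
    rw [mul_assoc, mul_assoc, mul_assoc, mul_inv_cancel₀ hg, mul_one, mul_inv_cancel_left₀ hg]
  rw [← key] at hl ⊢
  rw [h α ((g : ℍ[ℝ])⁻¹ * Q * g) ?_ ?_ (mul_left_cancel₀ hg (mul_right_cancel₀ (inv_ne_zero hg) hl))]
  · rw [Quaternion.re_mul_comm, mul_inv_cancel_left₀ hg, hQ]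
  · rw [norm_mul, norm_mul, norm_inv, hQ', norm_eq_of_mem_sphere g]
    norm_num

/-- The perturbation relation is the graph of a map of `SU(2)` that extends to a `C^k` map of the
quaternions. -/
theorem IsPerturbationFunction.exists_map {k : ℕ∞} {f : ℝ → ℝ} (hf : IsPerturbationFunction k f) :
    ∃ (P : ℍ[ℝ] → ℍ[ℝ]) (p : SU2 → SU2), ContDiff ℝ k P ∧ (∀ l : SU2, (p l : ℍ[ℝ]) = P l) ∧
      ∀ l m, PerturbationRelation f l m ↔ m = p l := by
  obtain ⟨P, hP, hPf⟩ := exists_contDiff_perturbation hf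
  have hpol := fun l : SU2 => Quaternion.exists_polar (norm_eq_of_mem_sphere l)
  refine ⟨P, fun l => ⟨P l, ?_⟩, hP, fun _ => rfl, fun l m => ⟨fun h => ?_, fun h α Q hQ hQ' hl => ?_⟩⟩
  · obtain ⟨α, Q, hQ, hQ', hl⟩ := hpol l
    rw [mem_sphere_zero_iff_norm, hl, hPf α Q hQ hQ', Quaternion.norm_cos_add_sin_smul _ hQ hQ']
  · obtain ⟨α, Q, hQ, hQ', hl⟩ := hpol l
    refine Subtype.ext ?_
    rw [h α Q hQ hQ' hl]
    change _ = P l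
    rw [hl, hPf α Q hQ hQ']
  · rw [h, ← hPf α Q hQ hQ', ← hl]

/-! ### The group of `C^k` maps and the universal representation -/

namespace RepSpace

variable {G : Type*} [Group G] {k : ℕ∞}

theorem isCk_of_fintype {ι : Type*} [Fintype ι] {w : RepSpace G → SU2} (s : ι → G)
    (Φ : (ι → ℍ[ℝ]) → ℍ[ℝ]) (hΦ : ContDiff ℝ k Φ)
    (h : ∀ χ, (w χ : ℍ[ℝ]) = Φ fun i => (χ (s i) : ℍ[ℝ])) : IsCk k w := by
  let ε := Fintype.equivFin ι
  refine ⟨_, s ∘ ε.symm, fun v => Φ (v ∘ ε),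
    hΦ.comp (contDiff_pi.2 fun i => contDiff_apply _ _ _), fun χ => ?_⟩
  rw [h]
  congr 1
  funext i
  simp

theorem isCk_apply (a : G) : IsCk k fun χ => χ a :=
  isCk_of_fintype (fun _ : Unit => a) (fun v => v ()) (contDiff_apply _ _ _) fun _ => rfl

theorem IsCk.comp {w : RepSpace G → SU2} (hw : IsCk k w) {P : ℍ[ℝ] → ℍ[ℝ]} (hP : ContDiff ℝ k P)
    {p : SU2 → SU2} (hp : ∀ l : SU2, (p l : ℍ[ℝ]) = P l) : IsCk k fun χ => p (w χ) := by
  obtain ⟨m, s, Φ, hΦ, h⟩ := hw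
  exact ⟨m, s, fun v => P (Φ v), hP.comp hΦ, fun χ => by rw [hp, h]⟩

variable (G k) in
/-- The group of `SU(2)`-valued functions of class `C^k` on `Hom(G, SU(2))`. -/
noncomputable def ckSubgroup : Subgroup (RepSpace G → SU2) where
  carrier := {w | IsCk k w}
  mul_mem' := by
    rintro w w' ⟨m, s, Φ, hΦ, h⟩ ⟨m', s', Φ', hΦ', h'⟩
    refine isCk_of_fintype (Sum.elim s s') (fun v => Φ (v ∘ Sum.inl) * Φ' (v ∘ Sum.inr))
      ((hΦ.comp (contDiff_pi.2 fun i => contDiff_apply _ _ _)).mul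
        (hΦ'.comp (contDiff_pi.2 fun i => contDiff_apply _ _ _))) fun χ => ?_
    rw [Pi.mul_apply, Metric.unitSphere.coe_mul, h, h']
    rfl
  one_mem' := ⟨0, Fin.elim0, fun _ => 1, contDiff_const, fun _ => rfl⟩
  inv_mem' := by
    intro w hw
    -- On unit quaternions the inverse is the conjugate, which is linear and so smooth on all of
    -- `ℍ[ℝ]`.
    refine hw.comp (P := fun q => (2 * Quaternion.reL q) • (1 : ℍ[ℝ]) - q)
      (((contDiff_const.mul Quaternion.reL.contDiff).smul contDiff_const).sub contDiff_id)
      (p := fun l => l⁻¹) fun l => ?_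
    rw [Metric.unitSphere.coe_inv, Quaternion.inv_def, Quaternion.normSq_eq_norm_mul_self,
      norm_eq_of_mem_sphere l, Quaternion.reL_apply]
    ext <;> simp
    ring

/-- Evaluation at a representation. -/
noncomputable def ckEval (χ : RepSpace G) : ckSubgroup G k →* SU2 :=
  (Pi.evalMonoidHom _ χ).comp (ckSubgroup G k).subtype

variable (G k) in
/-- The universal representation. -/
noncomputable def ckUniversal : G →* ckSubgroup G k where
  toFun a := ⟨fun χ => χ a, isCk_apply a⟩
  map_one' := Subtype.ext (funext fun χ => map_one χ)
  map_mul' a b := Subtype.ext (funext fun χ => map_mul χ a b)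

theorem ckEval_ckUniversal (χ : RepSpace G) (a : G) :
    ckEval χ (ckUniversal G k a) = χ a := rfl

end RepSpace

theorem inv_conj_conj {G : Type*} [Group G] (a b : G) : a⁻¹ * (a * b * a⁻¹) * a = b := by
  group

theorem inv_conj_conj_conj {G : Type*} [Group G] (a b d l : G) :
    a⁻¹ * (b * l * b⁻¹) * a =
      a⁻¹ * b * d⁻¹ * (d * l * d⁻¹) * (a⁻¹ * b * d⁻¹)⁻¹ := by
  group

/-! ### Extending representations from an end -/

namespace PushedInTube

section Exterior

variable {F : Type u} [TopologicalSpace F] [ChartedSpace (EuclideanSpace ℝ (Fin 2)) F]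
  {C : Circle → F} (N : PushedInTube C) {f : ℝ → ℝ} {k : ℕ∞} {y : N.exterior}

theorem hom_loopClass {G : Type*} [Group G] (c : Holonomy N.exterior G) (δ : Path N.basePoint y)
    (l : Path N.basePoint N.basePoint) :
    c.hom y (N.loopClass δ l) = c δ * c l * (c δ)⁻¹ :=
  (c.hom_mulEquivOfPath δ _).trans rfl

theorem smul_mem_perturbedReps (g : SU2) {ρ : RepSpace (FundamentalGroup N.exterior y)}
    (hρ : ρ ∈ N.perturbedReps f y) : g • ρ ∈ N.perturbedReps f y :=
  fun δ => (hρ δ).conj g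

theorem perturbationRelation_of_mem {ρ : RepSpace (FundamentalGroup N.exterior y)}
    (hρ : ρ ∈ N.perturbedReps f y) {c : Holonomy N.exterior SU2} (hc : c.hom y = ρ)
    (δ : Path N.basePoint y) (g : SU2) :
    PerturbationRelation f (g * c N.longitude * g⁻¹) (g * c N.meridian * g⁻¹) := by
  have h := (hρ δ).conj (g * (c δ)⁻¹)
  have e : ∀ l, ρ (N.loopClass δ l) = c δ * c l * (c δ)⁻¹ := fun l => by
    rw [← hom_loopClass, hc]
    rfl
  rw [e, e] at h
  convert h using 1 <;> group

/-- The homomorphism of fundamental groups that defines the restriction to an end. -/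
noncomputable def endHom {t : ℝ} (ht : t = 0 ∨ t = 1) {x : F} (γ : Path (N.endInclusion ht x) y) :
    FundamentalGroup F x →* FundamentalGroup N.exterior y :=
  (FundamentalGroup.fundamentalGroupMulEquivOfPath γ).toMonoidHom.comp
    (FundamentalGroup.map (N.endInclusion ht) x)

theorem hom_endHom {G : Type*} [Group G] (c : Holonomy N.exterior G) {t : ℝ} (ht : t = 0 ∨ t = 1)
    {x : F} (γ : Path (N.endInclusion ht x) y) (a : FundamentalGroup F x) :
    c.hom y (N.endHom ht γ a) = c γ * (c.comap (N.endInclusion ht)).hom x a * (c γ)⁻¹ := by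
  rw [← Holonomy.hom_map]
  exact c.hom_mulEquivOfPath γ _

variable [T2Space F] [PathConnectedSpace F] [IsManifold (𝓡 2) ∞ F]
  (hf : IsPerturbationFunction k f) {t : ℝ} (ht : t = 0 ∨ t = 1) {x : F}
  (γ : Path (N.endInclusion ht x) y)

include hf

/-- The universal representation is extended once, with values in the group of `C^k` maps;
evaluation at `χ` gives all the extensions together with their regularity. -/
theorem exists_extension : ∃ extn : RepSpace (FundamentalGroup F x) →
      RepSpace (FundamentalGroup N.exterior y),
    (∀ χ, RepSpace.comap (N.endHom ht γ) (extn χ) = χ) ∧ (∀ χ, extn χ ∈ N.perturbedReps f y) ∧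
    ∀ q, RepSpace.IsCk k fun χ => extn χ q := by
  have := ChartedSpace.locallyPathConnectedSpace (EuclideanSpace ℝ (Fin 2)) F
  obtain ⟨P, p, hP, hp, hrel⟩ := hf.exists_map
  obtain ⟨δ, ℓ, hlong, -, hex⟩ := N.exists_end_data exists_isOpen_simplyConnectedSpace ht
  obtain ⟨c₀, hc₀⟩ := Holonomy.exists_hom_eq x (RepSpace.ckUniversal (FundamentalGroup F x) k)
  let m : RepSpace.ckSubgroup (FundamentalGroup F x) k :=
    ⟨fun χ => p ((c₀ ℓ).1 χ), RepSpace.IsCk.comp (c₀ ℓ).2 hP hp⟩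
  -- Conjugation by `l` fixes `l`, hence also `p l`, by equivariance.
  have hpc : ∀ l, Commute (p l) l := fun l => by
    have h := ((hrel l (p l)).2 rfl).conj l
    rw [mul_inv_cancel_right, hrel, mul_inv_eq_iff_eq_mul] at h
    exact h.symm
  obtain ⟨c, hce, hcm⟩ := hex _ c₀ m (Subtype.ext (funext fun χ => hpc _))
  have hhom : (c.comap (N.endInclusion ht)).hom x = c₀.hom x :=
    MonoidHom.ext fun a => Quotient.inductionOn a fun _ => hce _
  let E : FundamentalGroup N.exterior y →* RepSpace.ckSubgroup (FundamentalGroup F x) k :=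
    (MulAut.conj (c γ)).symm.toMonoidHom.comp (c.hom y)
  have hE : ∀ q, E q = (c γ)⁻¹ * c.hom y q * c γ := fun _ => rfl
  let extn : RepSpace (FundamentalGroup F x) → RepSpace (FundamentalGroup N.exterior y) :=
    fun χ => ((RepSpace.ckEval χ).comp E : FundamentalGroup N.exterior y →* SU2)
  have hextn : ∀ χ q, extn χ q = RepSpace.ckEval χ (E q) := fun _ _ => rfl
  refine ⟨extn, fun χ => DFunLike.ext _ _ fun a => ?_, fun χ δ' => ?_, fun q => (E q).2⟩
  · rw [RepSpace.comap_apply, hextn, hE, hom_endHom, hhom, hc₀]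
    rw [← RepSpace.ckEval_ckUniversal (k := k) χ a]
    exact congrArg _ (inv_conj_conj _ _)
  · have h1 : ∀ l, extn χ (N.loopClass δ' l) =
        RepSpace.ckEval χ ((c γ)⁻¹ * c δ' * (c δ)⁻¹) * RepSpace.ckEval χ (c δ * c l * (c δ)⁻¹) *
          (RepSpace.ckEval χ ((c γ)⁻¹ * c δ' * (c δ)⁻¹))⁻¹ := fun l => by
      rw [hextn, hE, hom_loopClass, ← map_inv, ← map_mul, ← map_mul]
      exact congrArg _ (inv_conj_conj_conj _ _ _ _)
    rw [h1, h1, hlong, hcm, hce]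
    exact ((hrel _ _).2 rfl).conj _

omit hf in
/-- A homomorphism on the fundamental group of the exterior is determined by its restriction to an
end if the image of the meridian is a function of the image of the longitude. -/
theorem hom_eq_of_hom_endHom_eq {G : Type} [Group G] {c c' : Holonomy N.exterior G} (p : G → G)
    (h : ∀ a, c.hom y (N.endHom ht γ a) = c'.hom y (N.endHom ht γ a))
    (hc : ∀ g, g * c N.meridian * g⁻¹ = p (g * c N.longitude * g⁻¹))
    (hc' : ∀ g, g * c' N.meridian * g⁻¹ = p (g * c' N.longitude * g⁻¹)) : c.hom y = c'.hom y := by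
  have := ChartedSpace.locallyPathConnectedSpace (EuclideanSpace ℝ (Fin 2)) F
  obtain ⟨δ, ℓ, hlong, huniq, -⟩ := N.exists_end_data exists_isOpen_simplyConnectedSpace ht
  -- `exists_end_data` speaks of groups in the universe of `F`.
  let L : G →* ULift.{u} G := MulEquiv.ulift.symm.toMonoidHom
  have hL : Function.Injective L := MulEquiv.ulift.symm.injective
  replace hlong : ∀ c : Holonomy N.exterior G,
      c δ * c N.longitude * (c δ)⁻¹ = c.comap (N.endInclusion ht) ℓ := fun c =>
    hL (hlong _ (c.mapHom L))
  -- A constant gauge removes the discrepancy along `γ`. The second gauge `v`, which depends only on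
  -- the surface point and is `1` at `x`, then makes the holonomies equal on all paths of the end.
  let c₁ := c'.gauge fun _ => (c γ)⁻¹ * c' γ
  have hc₁ : (c.comap (N.endInclusion ht)).hom x = (c₁.comap (N.endInclusion ht)).hom x := by
    refine MonoidHom.ext fun a => ?_
    have h1 := h a
    rw [hom_endHom, hom_endHom] at h1
    have h2 : (c₁.comap (N.endInclusion ht)).hom x a = (c γ)⁻¹ * c' γ *
        (c'.comap (N.endInclusion ht)).hom x a * ((c γ)⁻¹ * c' γ)⁻¹ :=
      Quotient.inductionOn a fun _ => rfl
    rw [h2]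
    calc _ = (c γ)⁻¹ * (c γ * (c.comap (N.endInclusion ht)).hom x a * (c γ)⁻¹) * c γ := by group
      _ = _ := by rw [h1]; group
  let r : ∀ z : F, Path x z := fun z => PathConnectedSpace.somePath x z
  let v : F → G := fun z =>
    c.comap (N.endInclusion ht) (r z) * (c₁.comap (N.endInclusion ht) (r z))⁻¹
  have hvx : v x = 1 := mul_inv_eq_one.2
    (DFunLike.congr_fun hc₁ (FundamentalGroup.fromPath (Path.Homotopic.Quotient.mk (r x))))
  let c₂ := c₁.gauge fun w => v w.1.1
  have hc₂ : ∀ {a b : F} (q : Path a b), c.comap (N.endInclusion ht) q =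
      c₂.comap (N.endInclusion ht) q := fun q =>
    (Holonomy.gauge_eq_of_hom_eq _ _ hc₁ r q).symm
  -- Both sides are `p` of the conjugated longitude, which is read off on the end, where `c` and
  -- `c₂` agree.
  have hmer : c δ * c N.meridian * (c δ)⁻¹ = c₂ δ * c₂ N.meridian * (c₂ δ)⁻¹ := by
    have h1 := hc (c δ)
    let g := c₂ δ * (v N.basePoint.1.1 * ((c γ)⁻¹ * c' γ))
    have h2 := hc' g
    have h3 : ∀ l : Path N.basePoint N.basePoint,
        g * c' l * g⁻¹ = c₂ δ * c₂ l * (c₂ δ)⁻¹ := fun l => by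
      have : c₂ l = v N.basePoint.1.1 * ((c γ)⁻¹ * c' γ * c' l * ((c γ)⁻¹ * c' γ)⁻¹) *
        (v N.basePoint.1.1)⁻¹ := rfl
      rw [this]
      simp only [g]
      group
    rw [h3, h3, hlong, ← hc₂] at h2
    rw [hlong] at h1
    rw [h1, h2]
  have key : ∀ {a b : F} (q : Path (N.endInclusion ht a) (N.endInclusion ht b)), c q = c₂ q :=
    fun q => hL (huniq _ (c.mapHom L) (c₂.mapHom L) (fun q => congrArg L (hc₂ q))
      (congrArg L hmer) q)
  refine MonoidHom.ext fun a => Quotient.inductionOn a fun q => ?_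
  change c q = c' q
  have h1 := key ((γ.trans q).trans γ.symm)
  have h2 : c₂ ((γ.trans q).trans γ.symm) = v x * ((c γ)⁻¹ * c' γ *
    c' ((γ.trans q).trans γ.symm) * ((c γ)⁻¹ * c' γ)⁻¹) * (v x)⁻¹ := rfl
  rw [h2, hvx] at h1
  simp only [Holonomy.map_trans, Holonomy.map_symm] at h1
  calc c q = c γ * ((c γ)⁻¹ * (c q * c γ)) * (c γ)⁻¹ := by group
    _ = c' q := by rw [h1]; group

theorem eq_of_comap_endHom_eq {ρ ρ' : RepSpace (FundamentalGroup N.exterior y)}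
    (hρ : ρ ∈ N.perturbedReps f y) (hρ' : ρ' ∈ N.perturbedReps f y)
    (h : RepSpace.comap (N.endHom ht γ) ρ = RepSpace.comap (N.endHom ht γ) ρ') : ρ = ρ' := by
  have := N.pathConnectedSpace_exterior
  obtain ⟨P, p, -, -, hrel⟩ := hf.exists_map
  obtain ⟨c, hc⟩ := Holonomy.exists_hom_eq y (ρ : FundamentalGroup N.exterior y →* SU2)
  obtain ⟨c', hc'⟩ := Holonomy.exists_hom_eq y (ρ' : FundamentalGroup N.exterior y →* SU2)
  let δ := PathConnectedSpace.somePath N.basePoint y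
  have key : c.hom y = c'.hom y := N.hom_eq_of_hom_endHom_eq ht γ p
    (fun a => by
      rw [hc, hc']
      exact DFunLike.congr_fun h a)
    (fun g => (hrel _ _).1 (N.perturbationRelation_of_mem hρ hc δ g))
    fun g => (hrel _ _).1 (N.perturbationRelation_of_mem hρ' hc' δ g)
  exact hc.symm.trans (key.trans hc')

end Exterior

end PushedInTube

theorem proposition7p1 {F : Type*} [TopologicalSpace F] [T2Space F] [CompactSpace F]
    [ConnectedSpace F] [ChartedSpace (EuclideanSpace ℝ (Fin 2)) F] [IsManifold (𝓡 2) ∞ F]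
    (C : Circle → F) (hC : Manifold.IsSmoothEmbedding (𝓡 1) (𝓡 2) ∞ C) (N : PushedInTube C)
    (k : ℕ∞) (f : ℝ → ℝ) (hf : IsPerturbationFunction k f)
    (t : ℝ) (ht : t = 0 ∨ t = 1) (x : F) (y : N.exterior) (γ : Path (N.endInclusion ht x) y) :
    IsHomeomorph (N.restrictToEnd f ht γ) ∧
      ∀ H : Subgroup SU2,
        CharVar.IsCkDiffeoOn k (N.restrictToEnd f ht γ)
          (CharVar.stratum (N.perturbedReps f y) H) (CharVar.stratum Set.univ H) := by
  have := ChartedSpace.locallyPathConnectedSpace (EuclideanSpace ℝ (Fin 2)) F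
  have : PathConnectedSpace F := PathConnectedSpace.of_locallyPathConnectedSpace
  obtain ⟨extn, hcomap, hmem, hCk⟩ := N.exists_extension hf ht γ
  exact CharVar.isIso_restrict (φ := N.endHom ht γ) (fun g _ hρ => N.smul_mem_perturbedReps g hρ)
    -- Uniqueness makes `extn` a two-sided inverse on the perturbed representations.
    hcomap hmem (fun ρ hρ => N.eq_of_comap_endHom_eq hf ht γ (hmem _) hρ (hcomap _)) hCk
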